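/- **Setting.** Let $m\ge 3$. Let $\mathbb R_m$ be the real Clifford algebra generated by $e_1,\dots,e_m$ with $e_j^2=-1$, $e_je_k=-e_ke_j$ ($j\ne k$), and let $\mathbb C_m=\mathbb C\otimes\mathbb R_m$. A vector $w\in\mathbb C^m$ is identified with $\underline w=\sum_j w_je_j$; $\langle w,w'\rangle=\sum_j w_jw'_j$ is bilinear, and $\underline x\wedge\underline y=\sum_{i<j}(x_iy_j-x_jy_i)e_ie_j$. Hermitian conjugation $\dagger$ is the conjugate-linear anti-automorphism of $\mathbb C_m$ with $e_j^\dagger=-e_j$. Every $\mathbb C_m$-valued polynomial $P$ on $\mathbb C^m$ that is homogeneous of degree $n$ has a unique decomposition $P(\underline z)=\sum_{j=0}^n\underline z^{\,j}M_{n-j}(\underline z)$, where $M_{n-j}$ is homogeneous of degree $n-j$ and left monogenic, i.e. $\sum_i e_i\partial_{z_i}M_{n-j}=0$; put $M[P]=M_n$. For $\underline t,\underline s\in\mathbb S^{m-1}$ with $\langle\underline t,\underline s\rangle=0$ let $\underline\tau=\underline t+i\underline s$, so that $\underline\tau^\dagger=-\underline t+i\underline s$, and for $r,k\in\mathbb N=\{0,1,2,\dots\}$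 let $$\psi_{\underline\tau,2r,k}(\underline z)=\underline\tau\,\langle\underline z,\underline\tau\rangle^{r+k}\langle\underline z,\underline\tau^\dagger\rangle^{r},\qquad \psi_{\underline\tau,2r+1,k}(\underline z)=\underline\tau^\dagger\underline\tau\,\langle\underline z,\underline\tau\rangle^{r+k+1}\langle\underline z,\underline\tau^\dagger\rangle^{r}.$$ The zonal spherical monogenic of degree $n$ is $$\mathcal C_n(\underline x,\underline y)=\frac{(|\underline x||\underline y|)^n}{m-2}\Big((n+m-2)\,C_n^{\frac m2-1}(u)+(m-2)\,\frac{\underline x\wedge\underline y}{|\underline x||\underline y|}\,C_{n-1}^{\frac m2}(u)\Big),\qquad u=\frac{\langle\underline x,\underline y\rangle}{|\underline x||\underline y|},$$ where $C_n^\lambda$ are the Gegenbauer polynomials and $C_{-1}^\lambda=0$ (for $\underline x=0$ or $\underline y=0$ this is read as the value of the corresponding polynomial: $1$ if $n=0$ and $0$ otherwise). **Proposition 6.3.** Let $m\ge3$ and $\alpha,k\in\mathbb N$. For all $\underline x,\underline y\in\mathbb R^m$, $$\int_{\mathbb S^{m-1}}\int_{\mathbb S^{m-2}}M[\psi_{\underline\tau,\alpha,k}](\underline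 x)\,M[\psi_{\underline\tau,\alpha,k}](\underline y)^\dagger\,dS(\underline s)\,dS(\underline t)=A_mA_{m-1}\,\gamma_{\alpha,k}\;\mathcal C_{\alpha+k}(\underline x,\underline y).$$ Here $\mathbb S^{m-2}$ is the unit sphere of the orthogonal complement of $\underline t$, $dS$ is the (unnormalized) surface measure, $A_m=2\pi^{m/2}/\Gamma(m/2)$ is the area of $\mathbb S^{m-1}$, and the constants $\gamma_{\alpha,k}$ are $$\gamma_{2r,k}=\frac{r!\,(r+k)!\,\Gamma(\frac m2+r-1)\,\Gamma(\frac m2+r+k)}{\Gamma(\frac m2+2r+k)^2}\,(m-2)\,\frac{\Gamma(m-1)\,\Gamma(2r+k+1)}{\Gamma(2r+k+m-1)},$$ $$\gamma_{2r+1,k}=\frac{4\,r!\,(r+k+1)!\,\Gamma(\frac m2+r)\,\Gamma(\frac m2+r+k)}{\Gamma(\frac m2+2r+k+1)^2}\,(m-2)\,\frac{\Gamma(m-1)\,\Gamma(2r+k+2)}{\Gamma(2r+k+m)}.$$ -/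

import Mathlib

open MeasureTheory
open scoped TensorProduct

noncomputable section

namespace HuaRadon

/-! ### Clifford algebras -/

/-- The quadratic form `v ↦ -∑ vⱼ²` on `ℝᵐ`, so that `eⱼ² = -1` and `eⱼ eₖ = -eₖ eⱼ`. -/
def negSumSq (m : ℕ) : QuadraticForm ℝ (Fin m → ℝ) :=
  QuadraticMap.weightedSumSquares ℝ (fun _ : Fin m => (-1 : ℝ))

/-- The real Clifford algebra `ℝ_m`. -/
abbrev RealCl (m : ℕ) : Type := CliffordAlgebra (negSumSq m)

/-- The complex Clifford algebra `ℂ_m = ℂ ⊗ ℝ_m`. -/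
abbrev ComplexCl (m : ℕ) : Type := ℂ ⊗[ℝ] RealCl m

/-- The generator `eⱼ` of `ℝ_m`. -/
def e {m : ℕ} (j : Fin m) : RealCl m :=
  CliffordAlgebra.ι (negSumSq m) (Pi.single j (1 : ℝ))

/-- The 1-vector `∑ wⱼ eⱼ` with complex coordinates. -/
def vec {m : ℕ} (w : Fin m → ℂ) : ComplexCl m := ∑ j, w j ⊗ₜ[ℝ] e j

/-- Hermitian conjugation on `ℂ_m`: the conjugate-linear anti-automorphism with `eⱼ† = -eⱼ`;
it conjugates the complex scalars and applies Clifford conjugation to `ℝ_m`. -/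
def dagger (m : ℕ) : ComplexCl m →ₗ[ℝ] ComplexCl m :=
  TensorProduct.map Complex.conjAe.toLinearMap
    (CliffordAlgebra.reverse ∘ₗ
      (CliffordAlgebra.involute : RealCl m →ₐ[ℝ] RealCl m).toLinearMap)

/-! ### Clifford-valued polynomials -/

/-- Polynomials in the commuting complex variables `z₁, …, z_m` with coefficients in `ℂ_m`:
`ℂ[z₁, …, z_m] ⊗ ℝ_m` (the variables and complex numbers commute with the `eⱼ`). -/
abbrev ClPoly (m : ℕ) : Type := MvPolynomial (Fin m) ℂ ⊗[ℝ] RealCl m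

/-- A scalar polynomial, as a Clifford-valued polynomial. -/
def scalarPoly {m : ℕ} (p : MvPolynomial (Fin m) ℂ) : ClPoly m := p ⊗ₜ[ℝ] (1 : RealCl m)

/-- The constant polynomial with value `a ∈ ℂ_m`. -/
def constPoly (m : ℕ) : ComplexCl m →ₐ[ℝ] ClPoly m :=
  Algebra.TensorProduct.map
    ((Algebra.ofId ℂ (MvPolynomial (Fin m) ℂ)).restrictScalars ℝ) (AlgHom.id ℝ (RealCl m))

/-- The value `P(z) ∈ ℂ_m` of a Clifford-valued polynomial at a point `z ∈ ℂᵐ`. -/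
def evalAt {m : ℕ} (z : Fin m → ℂ) : ClPoly m →ₐ[ℝ] ComplexCl m :=
  Algebra.TensorProduct.map
    ((MvPolynomial.aeval z : MvPolynomial (Fin m) ℂ →ₐ[ℂ] ℂ).restrictScalars ℝ)
    (AlgHom.id ℝ (RealCl m))

/-- The vector variable `z = ∑ zⱼ eⱼ`. -/
def vecVar (m : ℕ) : ClPoly m := ∑ j, (MvPolynomial.X j : MvPolynomial (Fin m) ℂ) ⊗ₜ[ℝ] e j

/-- The Dirac operator `∂_z = ∑ eⱼ ∂_{zⱼ}`, acting from the left. -/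
def dirac (m : ℕ) : ClPoly m →ₗ[ℝ] ClPoly m :=
  ∑ j : Fin m, TensorProduct.map
    ((MvPolynomial.pderiv j : Derivation ℂ (MvPolynomial (Fin m) ℂ) (MvPolynomial (Fin m) ℂ)
      ).toLinearMap.restrictScalars ℝ)
    (LinearMap.mulLeft ℝ (e j))

/-- The Clifford-valued polynomials that are homogeneous of degree `n`. -/
def homogPoly (m n : ℕ) : Submodule ℝ (ClPoly m) :=
  Submodule.span ℝ
    {P | ∃ (p : MvPolynomial (Fin m) ℂ) (a : RealCl m), p.IsHomogeneous n ∧ P = p ⊗ₜ[ℝ] a}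

/-- `M` is the leading term `M_n` of a Fischer decomposition `P = ∑_{j=0}^n z^j M_{n-j}`, in which
`M_{n-j}` is (left) monogenic and homogeneous of degree `n - j`. -/
def IsMonogenicPart {m : ℕ} (n : ℕ) (P M : ClPoly m) : Prop :=
  ∃ N : ℕ → ClPoly m,
    (∀ j ≤ n, N j ∈ homogPoly m j ∧ dirac m (N j) = 0) ∧
    P = ∑ j ∈ Finset.range (n + 1), vecVar m ^ j * N (n - j) ∧
    M = N n

open Classical in
/-- The monogenic projection `M[P]` of a homogeneous polynomial `P` of degree `n`
(the Fischer decomposition of `P` exists and is unique; `0` if `P` is not of this kind). -/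
def monogenicProj {m : ℕ} (n : ℕ) (P : ClPoly m) : ClPoly m :=
  if h : ∃ M, IsMonogenicPart n P M then h.choose else 0

/-! ### The polynomials `ψ_{τ,α,k}` -/

/-- The linear polynomial `⟨z, w⟩ = ∑ zⱼ wⱼ` (bilinear, no conjugation). -/
def pairing {m : ℕ} (w : Fin m → ℂ) : MvPolynomial (Fin m) ℂ :=
  ∑ j, MvPolynomial.C (w j) * MvPolynomial.X j

/-- `τ = t + i s`. -/
def tau {m : ℕ} (t s : EuclideanSpace ℝ (Fin m)) : Fin m → ℂ :=
  fun j => (t j : ℂ) + Complex.I * (s j : ℂ)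

/-- `τ† = -t + i s`. -/
def tauDag {m : ℕ} (t s : EuclideanSpace ℝ (Fin m)) : Fin m → ℂ :=
  fun j => -(t j : ℂ) + Complex.I * (s j : ℂ)

/-- `ψ_{τ,2r,k}(z) = τ ⟨z,τ⟩^{r+k} ⟨z,τ†⟩^r` and
`ψ_{τ,2r+1,k}(z) = τ† τ ⟨z,τ⟩^{r+k+1} ⟨z,τ†⟩^r`, where `τ = t + i s`. -/
def psi {m : ℕ} (t s : EuclideanSpace ℝ (Fin m)) (α k : ℕ) : ClPoly m :=
  if Even α then
    constPoly m (vec (tau t s)) *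
      scalarPoly (pairing (tau t s) ^ (α / 2 + k) * pairing (tauDag t s) ^ (α / 2))
  else
    constPoly m (vec (tauDag t s) * vec (tau t s)) *
      scalarPoly (pairing (tau t s) ^ (α / 2 + k + 1) * pairing (tauDag t s) ^ (α / 2))

/-- The value `M[ψ_{τ,α,k}](x)` at a real point `x`, where `τ = t + i s`. -/
def MPsi {m : ℕ} (t s : EuclideanSpace ℝ (Fin m)) (α k : ℕ) (x : EuclideanSpace ℝ (Fin m)) :
    ComplexCl m :=
  evalAt (fun j => (x j : ℂ)) (monogenicProj (α + k) (psi t s α k))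

/-! ### Zonal spherical monogenics -/

/-- The Gegenbauer polynomial
`C_n^λ(u) = ∑_{j ≤ n/2} (-1)^j (λ)_{n-j} / (j! (n-2j)!) (2u)^{n-2j}`. -/
def gegenbauer (n : ℕ) (lam u : ℝ) : ℝ :=
  ∑ j ∈ Finset.range (n / 2 + 1),
    (-1) ^ j * (ascPochhammer ℝ (n - j)).eval lam / (j.factorial * (n - 2 * j).factorial) *
      (2 * u) ^ (n - 2 * j)

/-- `C_{n-1}^λ(u)`, with the convention `C_{-1}^λ = 0`. -/
def gegenbauerPred (n : ℕ) (lam u : ℝ) : ℝ :=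
  if n = 0 then 0 else gegenbauer (n - 1) lam u

/-- The bivector `x ∧ y = ∑_{i<j} (xᵢ yⱼ - xⱼ yᵢ) eᵢ eⱼ`. -/
def wedge {m : ℕ} (x y : EuclideanSpace ℝ (Fin m)) : RealCl m :=
  ∑ i, ∑ j, if i < j then (x i * y j - x j * y i) • (e i * e j) else 0

/-- The zonal spherical monogenic `C_n(x, y)` on `ℝᵐ`: with `u = ⟨x,y⟩ / (|x||y|)`,
`(|x||y|)^n / (m-2) * ((n+m-2) C_n^{m/2-1}(u) + (m-2) (x∧y)/(|x||y|) C_{n-1}^{m/2}(u))`. -/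
def zonal {m : ℕ} (n : ℕ) (x y : EuclideanSpace ℝ (Fin m)) : RealCl m :=
  ((‖x‖ * ‖y‖) ^ n / ((m : ℝ) - 2)) •
    (algebraMap ℝ (RealCl m)
        (((n : ℝ) + m - 2) * gegenbauer n ((m : ℝ) / 2 - 1) (inner ℝ x y / (‖x‖ * ‖y‖))) +
      (((m : ℝ) - 2) / (‖x‖ * ‖y‖) *
          gegenbauerPred n ((m : ℝ) / 2) (inner ℝ x y / (‖x‖ * ‖y‖))) • wedge x y)

/-! ### Integration over the Stiefel manifold -/

/-- The (unnormalized) surface measure `dS` on the unit sphere of a Euclidean space `V`,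
obtained from the Lebesgue measure of `V` by polar coordinates. -/
def surfaceMeasure (V : Type*) [NormedAddCommGroup V] [InnerProductSpace ℝ V]
    [FiniteDimensional ℝ V] [MeasurableSpace V] [BorelSpace V] :
    Measure (Metric.sphere (0 : V) 1) :=
  (volume : Measure V).toSphere

/-- The orthogonal complement of `t` in `ℝᵐ`. -/
abbrev Perp {m : ℕ} (t : EuclideanSpace ℝ (Fin m)) : Submodule ℝ (EuclideanSpace ℝ (Fin m)) :=
  (Submodule.span ℝ {t})ᗮ

/-- `∫_{t ∈ S^{m-1}} ∫_{s ∈ S^{m-2}} F(t, s) dS(s) dS(t) = I`, where `S^{m-1}` is the unit sphere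
of `ℝᵐ` and `S^{m-2}` is the unit sphere of the orthogonal complement of `t`. The integral of a
function with values in the finite-dimensional space `ℂ_m` is taken coordinatewise, i.e. after
every linear functional; the two integrals have to converge. -/
def HasStiefelIntegral {m : ℕ}
    (F : EuclideanSpace ℝ (Fin m) → EuclideanSpace ℝ (Fin m) → ComplexCl m)
    (I : ComplexCl m) : Prop :=
  ∀ φ : ComplexCl m →ₗ[ℂ] ℂ,
    (∀ t : Metric.sphere (0 : EuclideanSpace ℝ (Fin m)) 1,
      Integrable (fun s : Metric.sphere (0 : Perp t.1) 1 => φ (F t.1 (s.1 : Perp t.1)))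
        (surfaceMeasure (Perp t.1))) ∧
    Integrable
      (fun t : Metric.sphere (0 : EuclideanSpace ℝ (Fin m)) 1 =>
        ∫ s : Metric.sphere (0 : Perp t.1) 1, φ (F t.1 (s.1 : Perp t.1))
          ∂surfaceMeasure (Perp t.1))
      (surfaceMeasure (EuclideanSpace ℝ (Fin m))) ∧
    ∫ t : Metric.sphere (0 : EuclideanSpace ℝ (Fin m)) 1,
        ∫ s : Metric.sphere (0 : Perp t.1) 1, φ (F t.1 (s.1 : Perp t.1))
          ∂surfaceMeasure (Perp t.1)
      ∂surfaceMeasure (EuclideanSpace ℝ (Fin m)) = φ I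

/-- The area `A_m = 2 π^{m/2} / Γ(m/2)` of the unit sphere of `ℝᵐ`. -/
def sphereArea (m : ℕ) : ℝ := 2 * Real.pi ^ ((m : ℝ) / 2) / Real.Gamma ((m : ℝ) / 2)

/-- The constants `γ_{2r,k}` (first branch, `r = α / 2`) and `γ_{2r+1,k}` (second branch), for the
integral normalized to total mass one. -/
def gammaConst (m α k : ℕ) : ℝ :=
  let r : ℕ := α / 2
  let h : ℝ := (m : ℝ) / 2
  if Even α then
    (r.factorial : ℝ) * (r + k).factorial * Real.Gamma (h + r - 1) * Real.Gamma (h + r + k) /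
        Real.Gamma (h + 2 * r + k) ^ 2 *
      ((m : ℝ) - 2) *
      (Real.Gamma ((m : ℝ) - 1) * Real.Gamma (2 * r + k + 1) / Real.Gamma (2 * r + k + m - 1))
  else
    4 * ((r.factorial : ℝ) * (r + k + 1).factorial * Real.Gamma (h + r) *
        Real.Gamma (h + r + k)) / Real.Gamma (h + 2 * r + k + 1) ^ 2 *
      ((m : ℝ) - 2) *
      (Real.Gamma ((m : ℝ) - 1) * Real.Gamma (2 * r + k + 2) / Real.Gamma (2 * r + k + m))

end HuaRadon

end

/-!
The proof rests on three facts.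

*Monogenic projections.* On homogeneous polynomials of degree `n` the projection `M` is the operator
`monoProj m n = ∑ c_j z^j ∂^j` with explicit `c_j` (`monogenicProj_eq`). It is linear over constants
on the right and kills every multiple `z Q` of the vector variable. Since `τ` and `τ†` are null
vectors, `∂²` maps `⟨z,τ⟩^p ⟨z,τ†⟩^r` to a multiple of `⟨z,τ⟩^{p-1} ⟨z,τ†⟩^{r-1}`, which makes
`M[ψ_τ]` explicit. On the other hand the zonal monogenic `C_n(x, y)` is a multiple of the value at
`x` of `M[⟨z,y⟩^n]` (`one_tmul_zonal`).

*Invariance.* Fix a unit vector `u`. The mean over `(t, s)` of `ψ_τ(z) ψ_τ(u)†` is invariant under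
the reflections that fix `u`. Hence it is a combination of terms `⟨z,u⟩^a (|z|² - ⟨z,u⟩²)^b`, possibly
times `u (z - ⟨z,u⟩ u)`. Modulo multiples of `z` each of them is a multiple of `⟨z,u⟩^n`, so the mean
of `M[ψ_τ](x) ψ_τ(u)†` is `κ M[⟨z,u⟩^n](x)` for some constant `κ` (`monoProj_mean_eq`). By
homogeneity this holds for every vector `y` in place of `u`, with the same `κ`. Conjugation
exchanges `x` and `y` on the right-hand side, so a second projection, now in `y`, leaves that side
unchanged and replaces `ψ_τ(y)` by `M[ψ_τ](y)` (`hasMean_monoTau_mul_dagger`).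

*The constant.* Both sides are compared at `x = y = u`. The left-hand side reduces to the moments
of `|⟨u,τ⟩|²` (`hasMean_tauForm_pow`) and a terminating hypergeometric sum
(`sum_partial_fractions`), the right-hand side to the values of Gegenbauer polynomials at `1`
(`zonalKernel_self`).

For odd `α` the integrand is `4` times one of even type at `(t, -s)`, because `s ↦ -s` exchanges `τ`
and `-τ†`, and `τ† τ τ† τ = 4 τ† τ`.
-/

noncomputable section

namespace HuaRadon

/-! ### Clifford relations -/

lemma e_mul_e_add_swap {m : ℕ} (i j : Fin m) :
    e i * e j + e j * e i = algebraMap ℝ (RealCl m) (if i = j then -2 else 0) := by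
  rw [e, e, CliffordAlgebra.ι_mul_ι_add_swap]
  congr 1
  simp only [QuadraticMap.polar, negSumSq, QuadraticMap.weightedSumSquares_apply]
  rw [← Finset.sum_sub_distrib, ← Finset.sum_sub_distrib]
  by_cases h : i = j
  · subst h
    rw [Finset.sum_eq_single i]
    · simp; norm_num
    · intro b _ hb; simp [hb]
    · simp
  · rw [if_neg h]
    apply Finset.sum_eq_zero
    intro k _
    by_cases h1 : k = i
    · subst h1; simp [h]
    · simp [h1]

lemma e_mul_self {m : ℕ} (i : Fin m) : e i * e i = (-1 : RealCl m) := by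
  have h := e_mul_e_add_swap i i
  rw [if_pos rfl, ← two_smul ℝ (e i * e i), Algebra.algebraMap_eq_smul_one] at h
  have h2 : (2 : ℝ) • (e i * e i) = (2 : ℝ) • (-1 : RealCl m) := by rw [h]; simp
  exact smul_right_injective _ (two_ne_zero) h2

/-- The 1-vectors anticommute up to the bilinear form. -/
lemma vec_mul_vec_add_swap {m : ℕ} (v w : Fin m → ℂ) :
    vec v * vec w + vec w * vec v = (-2 * ∑ j, v j * w j : ℂ) • (1 : ComplexCl m) := by
  have h1 : vec v * vec w = ∑ i, ∑ j, (v i * w j) ⊗ₜ[ℝ] (e i * e j) := by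
    simp [vec, Finset.sum_mul_sum]
  have h2 : vec w * vec v = ∑ i, ∑ j, (v i * w j) ⊗ₜ[ℝ] (e j * e i) := by
    rw [Finset.sum_comm]
    simp [vec, Finset.sum_mul_sum, mul_comm]
  rw [h1, h2, ← Finset.sum_add_distrib]
  simp_rw [← Finset.sum_add_distrib, ← TensorProduct.tmul_add, e_mul_e_add_swap]
  rw [Finset.mul_sum, Finset.sum_smul]
  refine Finset.sum_congr rfl fun i _ => ?_
  rw [Finset.sum_eq_single i]
  · rw [if_pos rfl, Algebra.algebraMap_eq_smul_one, TensorProduct.tmul_smul,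
      Algebra.TensorProduct.one_def, TensorProduct.smul_tmul', TensorProduct.smul_tmul']
    simp
  · intro j _ hj
    rw [if_neg (Ne.symm hj)]; simp
  · simp

lemma vec_add {m : ℕ} (v w : Fin m → ℂ) : vec (v + w) = vec v + vec w := by
  simp [vec, TensorProduct.add_tmul, Finset.sum_add_distrib]

lemma vec_smul {m : ℕ} (c : ℂ) (w : Fin m → ℂ) : vec (c • w) = c • vec w := by
  simp [vec, TensorProduct.smul_tmul', Finset.smul_sum]

lemma vec_neg {m : ℕ} (w : Fin m → ℂ) : vec (-w) = -vec w := by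
  simp [vec, TensorProduct.neg_tmul]

lemma vec_mul_self {m : ℕ} (v : Fin m → ℂ) :
    vec v * vec v = (-∑ j, v j * v j : ℂ) • (1 : ComplexCl m) := by
  have h := vec_mul_vec_add_swap v v
  rw [← two_smul ℂ (vec v * vec v)] at h
  refine smul_right_injective _ (two_ne_zero (α := ℂ)) ?_
  simp only [h, smul_smul]
  congr 1; ring

/-! ### Hermitian conjugation -/

@[simp] lemma dagger_tmul {m : ℕ} (z : ℂ) (a : RealCl m) :
    dagger m (z ⊗ₜ[ℝ] a) =
      (starRingEnd ℂ z) ⊗ₜ[ℝ] CliffordAlgebra.reverse (CliffordAlgebra.involute a) := by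
  simp [dagger]

lemma dagger_mul {m : ℕ} (a b : ComplexCl m) : dagger m (a * b) = dagger m b * dagger m a := by
  induction a using TensorProduct.induction_on with
  | zero => simp
  | add x y hx hy => rw [add_mul, map_add, map_add, hx, hy, mul_add]
  | tmul z x =>
    induction b using TensorProduct.induction_on with
    | zero => simp
    | add p q hp hq => rw [mul_add, map_add, map_add, hp, hq, add_mul]
    | tmul w y => simp [CliffordAlgebra.reverse.map_mul, mul_comm]

lemma dagger_smul {m : ℕ} (c : ℂ) (a : ComplexCl m) :
    dagger m (c • a) = (starRingEnd ℂ c) • dagger m a := by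
  induction a using TensorProduct.induction_on with
  | zero => simp
  | add x y hx hy => rw [smul_add, map_add, map_add, hx, hy, smul_add]
  | tmul z x => simp [TensorProduct.smul_tmul']

lemma dagger_dagger {m : ℕ} (a : ComplexCl m) : dagger m (dagger m a) = a := by
  induction a using TensorProduct.induction_on with
  | zero => simp
  | add x y hx hy => rw [map_add, map_add, hx, hy]
  | tmul z x => simp [CliffordAlgebra.reverse_involute]

@[simp] lemma dagger_one {m : ℕ} : dagger m 1 = 1 := by
  simp [Algebra.TensorProduct.one_def]

lemma dagger_vec {m : ℕ} (w : Fin m → ℂ) :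
    dagger m (vec w) = vec (fun j => -(starRingEnd ℂ (w j))) := by
  simp [vec, e, TensorProduct.neg_tmul, TensorProduct.tmul_neg]

/-! ### The Dirac operator on Clifford-valued polynomials -/

section Poly

variable {m : ℕ}

@[simp] lemma dirac_tmul (p : MvPolynomial (Fin m) ℂ) (a : RealCl m) :
    dirac m (p ⊗ₜ[ℝ] a) = ∑ j, (MvPolynomial.pderiv j p) ⊗ₜ[ℝ] (e j * a) := by
  simp [dirac]

lemma dirac_smul (c : ℂ) (P : ClPoly m) : dirac m (c • P) = c • dirac m P := by
  induction P using TensorProduct.induction_on with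
  | zero => simp
  | add x y hx hy => rw [smul_add, map_add, map_add, hx, hy, smul_add]
  | tmul p a => simp [TensorProduct.smul_tmul', Finset.smul_sum]

@[simp] lemma constPoly_tmul (z : ℂ) (a : RealCl m) :
    constPoly m (z ⊗ₜ[ℝ] a) = (MvPolynomial.C z) ⊗ₜ[ℝ] a := by
  simp [constPoly, Algebra.ofId_apply, MvPolynomial.algebraMap_eq]

lemma constPoly_smul (c : ℂ) (a : ComplexCl m) : constPoly m (c • a) = c • constPoly m a := by
  induction a using TensorProduct.induction_on with
  | zero => simp
  | add x y hx hy => rw [smul_add, map_add, map_add, hx, hy, smul_add]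
  | tmul p a => simp [TensorProduct.smul_tmul', MvPolynomial.smul_eq_C_mul]

@[simp] lemma evalAt_tmul (z : Fin m → ℂ) (p : MvPolynomial (Fin m) ℂ) (a : RealCl m) :
    evalAt z (p ⊗ₜ[ℝ] a) = (MvPolynomial.aeval z p) ⊗ₜ[ℝ] a := by
  simp [evalAt]

lemma evalAt_smul (z : Fin m → ℂ) (c : ℂ) (P : ClPoly m) :
    evalAt z (c • P) = c • evalAt z P := by
  induction P using TensorProduct.induction_on with
  | zero => simp
  | add x y hx hy => rw [smul_add, map_add, map_add, hx, hy, smul_add]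
  | tmul p a => simp [TensorProduct.smul_tmul']

@[simp] lemma evalAt_constPoly (z : Fin m → ℂ) (a : ComplexCl m) :
    evalAt z (constPoly m a) = a := by
  induction a using TensorProduct.induction_on with
  | zero => simp
  | add x y hx hy => rw [map_add, map_add, hx, hy]
  | tmul p a => simp

lemma evalAt_scalarPoly (z : Fin m → ℂ) (p : MvPolynomial (Fin m) ℂ) :
    evalAt z (scalarPoly p) = (MvPolynomial.eval z p) • (1 : ComplexCl m) := by
  simp [scalarPoly, Algebra.TensorProduct.one_def, TensorProduct.smul_tmul',
    MvPolynomial.aeval_eq_eval]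

lemma evalAt_vecVar (z : Fin m → ℂ) : evalAt z (vecVar m) = vec z := by
  simp [vecVar, vec]

lemma scalarPoly_mul (p q : MvPolynomial (Fin m) ℂ) :
    scalarPoly (p * q) = scalarPoly p * scalarPoly q := by
  simp [scalarPoly]

lemma scalarPoly_pow (p : MvPolynomial (Fin m) ℂ) (k : ℕ) :
    scalarPoly (p ^ k) = scalarPoly p ^ k := by
  simp [scalarPoly, Algebra.TensorProduct.tmul_pow]

lemma scalarPoly_sub (p q : MvPolynomial (Fin m) ℂ) :
    scalarPoly (p - q) = scalarPoly p - scalarPoly q := by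
  simp [scalarPoly, TensorProduct.sub_tmul]

/-- Scalar polynomials are central. -/
lemma scalarPoly_comm (p : MvPolynomial (Fin m) ℂ) (P : ClPoly m) :
    P * scalarPoly p = scalarPoly p * P := by
  induction P using TensorProduct.induction_on with
  | zero => simp
  | add x y hx hy => rw [add_mul, mul_add, hx, hy]
  | tmul q a => simp [scalarPoly, mul_comm]

/-- The Dirac operator acts from the left, so it commutes with constants on the right. -/
lemma dirac_mul_constPoly (P : ClPoly m) (a : ComplexCl m) :
    dirac m (P * constPoly m a) = dirac m P * constPoly m a := by
  induction P using TensorProduct.induction_on with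
  | zero => simp
  | add x y hx hy => rw [add_mul, map_add, map_add, hx, hy, add_mul]
  | tmul q b =>
    induction a using TensorProduct.induction_on with
    | zero => simp
    | add x y hx hy => rw [map_add, mul_add, map_add, mul_add, hx, hy]
    | tmul z c =>
      simp [Finset.sum_mul, mul_assoc, mul_comm]

lemma tmul_mem_homogPoly {n : ℕ} {p : MvPolynomial (Fin m) ℂ} (hp : p.IsHomogeneous n)
    (a : RealCl m) : p ⊗ₜ[ℝ] a ∈ homogPoly m n :=
  Submodule.subset_span ⟨p, a, hp, rfl⟩

lemma homogPoly_induction {n : ℕ} {C : (P : ClPoly m) → P ∈ homogPoly m n → Prop}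
    (tmul : ∀ (p : MvPolynomial (Fin m) ℂ) (a : RealCl m) (hp : p.IsHomogeneous n),
      C (p ⊗ₜ[ℝ] a) (tmul_mem_homogPoly hp a))
    (zero : C 0 (zero_mem _))
    (add : ∀ P Q hP hQ, C P hP → C Q hQ → C (P + Q) (add_mem hP hQ))
    {P : ClPoly m} (hP : P ∈ homogPoly m n) : C P hP := by
  have key : ∀ P ∈ homogPoly m n, ∀ c : ℝ, ∃ h, C (c • P) h := by
    intro P hP
    induction hP using Submodule.span_induction with
    | mem x hx =>
      obtain ⟨p, a, hp, rfl⟩ := hx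
      intro c
      rw [← TensorProduct.tmul_smul]
      exact ⟨_, tmul p _ hp⟩
    | zero => intro c; rw [smul_zero]; exact ⟨_, zero⟩
    | add x y _ _ hx hy =>
      intro c
      obtain ⟨h1, h1'⟩ := hx c
      obtain ⟨h2, h2'⟩ := hy c
      rw [smul_add]
      exact ⟨_, add _ _ _ _ h1' h2'⟩
    | smul d x _ h => intro c; rw [smul_smul]; exact h _
  obtain ⟨h, h'⟩ := key P hP 1
  simpa only [one_smul] using h'

lemma mul_mem_homogPoly {k n : ℕ} {P Q : ClPoly m} (hP : P ∈ homogPoly m k)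
    (hQ : Q ∈ homogPoly m n) : P * Q ∈ homogPoly m (k + n) := by
  induction hP using homogPoly_induction with
  | zero => simp
  | add x y _ _ hx hy => rw [add_mul]; exact add_mem hx hy
  | tmul p a hp =>
    induction hQ using homogPoly_induction with
    | zero => simp
    | add x y _ _ hx hy => rw [mul_add]; exact add_mem hx hy
    | tmul q b hq =>
      rw [Algebra.TensorProduct.tmul_mul_tmul]
      exact tmul_mem_homogPoly (hp.mul hq) _

lemma vecVar_mem_homogPoly : vecVar m ∈ homogPoly m 1 :=
  Submodule.sum_mem _ fun j _ => tmul_mem_homogPoly (MvPolynomial.isHomogeneous_X _ j) _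

lemma constPoly_mem_homogPoly (a : ComplexCl m) : constPoly m a ∈ homogPoly m 0 := by
  induction a using TensorProduct.induction_on with
  | zero => simp
  | add x y hx hy => rw [map_add]; exact add_mem hx hy
  | tmul z a => rw [constPoly_tmul]; exact tmul_mem_homogPoly (MvPolynomial.isHomogeneous_C _ z) _

lemma scalarPoly_mem_homogPoly {n : ℕ} {p : MvPolynomial (Fin m) ℂ} (hp : p.IsHomogeneous n) :
    scalarPoly p ∈ homogPoly m n :=
  tmul_mem_homogPoly hp _

lemma dirac_mem_homogPoly {n : ℕ} {P : ClPoly m} (hP : P ∈ homogPoly m n) :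
    dirac m P ∈ homogPoly m (n - 1) := by
  induction hP using homogPoly_induction with
  | zero => simp
  | add x y _ _ hx hy => rw [map_add]; exact add_mem hx hy
  | tmul p a hp =>
    rw [dirac_tmul]
    exact Submodule.sum_mem _ fun j _ => tmul_mem_homogPoly hp.pderiv _

lemma dirac_eq_zero_of_mem_homogPoly_zero {P : ClPoly m} (hP : P ∈ homogPoly m 0) :
    dirac m P = 0 := by
  induction hP using homogPoly_induction with
  | zero => simp
  | add x y _ _ hx hy => rw [map_add, hx, hy, add_zero]
  | tmul p a hp =>
    rw [dirac_tmul]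
    refine Finset.sum_eq_zero fun j _ => ?_
    rw [MvPolynomial.totalDegree_eq_zero_iff_eq_C.1 (Nat.le_zero.1 hp.totalDegree_le)]
    simp

/-- The commutation relation between the Dirac operator and multiplication by the vector variable,
which comes from Euler's identity. -/
lemma dirac_vecVar_mul {l : ℕ} {Q : ClPoly m} (hQ : Q ∈ homogPoly m l) :
    dirac m (vecVar m * Q) = -((m : ℝ) + 2 * l) • Q - vecVar m * dirac m Q := by
  induction hQ using homogPoly_induction with
  | zero => simp
  | add x y _ _ hx hy => rw [mul_add, map_add, map_add, hx, hy, smul_add, mul_add]; abel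
  | tmul p a hp =>
    have h1 : dirac m (vecVar m * p ⊗ₜ[ℝ] a) =
        ∑ i, ∑ j, ((MvPolynomial.pderiv i (MvPolynomial.X j) * p) ⊗ₜ[ℝ] (e i * (e j * a)) +
          (MvPolynomial.X j * MvPolynomial.pderiv i p) ⊗ₜ[ℝ] (e i * (e j * a))) := by
      simp only [vecVar, Finset.sum_mul, Algebra.TensorProduct.tmul_mul_tmul, map_sum, dirac_tmul,
        Derivation.leibniz, smul_eq_mul]
      rw [Finset.sum_comm]
      refine Finset.sum_congr rfl fun i _ => Finset.sum_congr rfl fun j _ => ?_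
      rw [← TensorProduct.add_tmul]
      congr 1
      ring
    have h2 : vecVar m * dirac m (p ⊗ₜ[ℝ] a) =
        ∑ i, ∑ j, (MvPolynomial.X j * MvPolynomial.pderiv i p) ⊗ₜ[ℝ] (e j * (e i * a)) := by
      rw [dirac_tmul, vecVar, Finset.sum_mul_sum, Finset.sum_comm]
      simp only [Algebra.TensorProduct.tmul_mul_tmul]
    have h3 : ∑ i, ∑ j, (MvPolynomial.pderiv i (MvPolynomial.X j) * p) ⊗ₜ[ℝ] (e i * (e j * a)) =
        -(m : ℝ) • (p ⊗ₜ[ℝ] a) := by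
      have : ∀ i : Fin m, ∑ j, (MvPolynomial.pderiv i (MvPolynomial.X j : MvPolynomial (Fin m) ℂ) * p)
          ⊗ₜ[ℝ] (e i * (e j * a)) = -(p ⊗ₜ[ℝ] a) := by
        intro i
        rw [Finset.sum_eq_single i]
        · rw [MvPolynomial.pderiv_X_self, one_mul, ← mul_assoc, e_mul_self, neg_one_mul,
            TensorProduct.tmul_neg]
        · intro j _ hj
          rw [MvPolynomial.pderiv_X_of_ne hj]; simp
        · simp
      rw [Finset.sum_congr rfl fun i _ => this i]
      simp only [Finset.sum_neg_distrib, Finset.sum_const, Finset.card_univ, Fintype.card_fin]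
      rw [← Nat.cast_smul_eq_nsmul ℝ]
      exact (neg_smul _ _).symm
    have h4 : ∑ i, ∑ j, (MvPolynomial.X j * MvPolynomial.pderiv i p) ⊗ₜ[ℝ] (e i * (e j * a)) +
        vecVar m * dirac m (p ⊗ₜ[ℝ] a) = -(2 * (l : ℝ)) • (p ⊗ₜ[ℝ] a) := by
      rw [h2, ← Finset.sum_add_distrib]
      have : ∀ i : Fin m, (∑ j, (MvPolynomial.X j * MvPolynomial.pderiv i p) ⊗ₜ[ℝ] (e i * (e j * a)) +
          ∑ j, (MvPolynomial.X j * MvPolynomial.pderiv i p) ⊗ₜ[ℝ] (e j * (e i * a))) =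
          (-2 : ℝ) • ((MvPolynomial.X i * MvPolynomial.pderiv i p) ⊗ₜ[ℝ] a) := by
        intro i
        rw [← Finset.sum_add_distrib]
        simp_rw [← TensorProduct.tmul_add, ← mul_assoc, ← add_mul, e_mul_e_add_swap]
        rw [Finset.sum_eq_single i]
        · rw [if_pos rfl, ← Algebra.smul_def, TensorProduct.tmul_smul]
        · intro j _ hj
          rw [if_neg (Ne.symm hj)]; simp
        · simp
      rw [Finset.sum_congr rfl fun i _ => this i, ← Finset.smul_sum, ← TensorProduct.sum_tmul,
        hp.sum_X_mul_pderiv, ← TensorProduct.smul_tmul', ← Nat.cast_smul_eq_nsmul ℝ, smul_smul]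
      congr 1; ring
    simp_rw [Finset.sum_add_distrib] at h1
    rw [h1, h3, ← sub_eq_zero, ← sub_eq_zero.2 h4]
    module

end Poly

/-! ### The monogenic projection -/

section Fischer

variable {m : ℕ}

lemma dirac_pow_succ_apply (j : ℕ) (P : ClPoly m) :
    (dirac m ^ (j + 1)) P = dirac m ((dirac m ^ j) P) := by
  rw [pow_succ', Module.End.mul_apply]

lemma dirac_pow_mem_homogPoly {n : ℕ} {P : ClPoly m} (hP : P ∈ homogPoly m n) (j : ℕ) :
    (dirac m ^ j) P ∈ homogPoly m (n - j) := by
  induction j with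
  | zero => simpa using hP
  | succ j ih => rw [dirac_pow_succ_apply, ← Nat.sub_sub]; exact dirac_mem_homogPoly ih

lemma dirac_pow_eq_zero {n j : ℕ} {P : ClPoly m} (hP : P ∈ homogPoly m n) (h : n < j) :
    (dirac m ^ j) P = 0 := by
  induction j, (Nat.succ_le_of_lt h) using Nat.le_induction with
  | base =>
    rw [dirac_pow_succ_apply]
    apply dirac_eq_zero_of_mem_homogPoly_zero
    simpa using dirac_pow_mem_homogPoly hP n
  | succ k hk ih => rw [dirac_pow_succ_apply, ih (by omega), map_zero]

lemma vecVar_pow_mul_mem_homogPoly {l : ℕ} {Q : ClPoly m} (hQ : Q ∈ homogPoly m l) (j : ℕ) :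
    vecVar m ^ j * Q ∈ homogPoly m (j + l) := by
  induction j with
  | zero => simpa using hQ
  | succ j ih =>
    rw [pow_succ', mul_assoc, show j + 1 + l = 1 + (j + l) by ring]
    exact mul_mem_homogPoly vecVar_mem_homogPoly ih

lemma dirac_vecVar_pow_mul {l : ℕ} {Q : ClPoly m} (hQ : Q ∈ homogPoly m l) (j : ℕ) :
    dirac m (vecVar m ^ (j + 1) * Q) =
      -(if Even j then (m : ℝ) + 2 * l + j else j + 1) • (vecVar m ^ j * Q) +
        (-1 : ℝ) ^ (j + 1) • (vecVar m ^ (j + 1) * dirac m Q) := by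
  induction j with
  | zero => simp [dirac_vecVar_mul hQ, sub_eq_add_neg]; module
  | succ j ih =>
    rw [pow_succ', mul_assoc, dirac_vecVar_mul (vecVar_pow_mul_mem_homogPoly hQ (j + 1)), ih,
      mul_add, mul_smul_comm, mul_smul_comm, ← mul_assoc, ← mul_assoc, ← pow_succ', ← pow_succ',
      pow_succ (-1 : ℝ) (j + 1)]
    by_cases h : Even j
    · have h' : ¬ Even (j + 1) := by simpa [Nat.even_add_one] using h
      rw [if_pos h, if_neg h']
      push_cast
      module
    · have h' : Even (j + 1) := by simpa [Nat.even_add_one] using h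
      rw [if_neg h, if_pos h']
      push_cast
      module

lemma dirac_pow_vecVar_mul {l : ℕ} {Q : ClPoly m} (hQ : Q ∈ homogPoly m l) (j : ℕ) :
    (dirac m ^ (j + 1)) (vecVar m * Q) =
      -(if Even j then (m : ℝ) + 2 * l - j else j + 1) • (dirac m ^ j) Q +
        (-1 : ℝ) ^ (j + 1) • (vecVar m * (dirac m ^ (j + 1)) Q) := by
  induction j with
  | zero => simp [dirac_vecVar_mul hQ, sub_eq_add_neg]; module
  | succ j ih =>
    have key : dirac m (vecVar m * (dirac m ^ (j + 1)) Q) =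
        -((m : ℝ) + 2 * (l - j - 1)) • (dirac m ^ (j + 1)) Q -
          vecVar m * (dirac m ^ (j + 1 + 1)) Q := by
      rw [dirac_pow_succ_apply (j + 1)]
      rcases le_or_gt (j + 1) l with h | h
      · rw [dirac_vecVar_mul (dirac_pow_mem_homogPoly hQ (j + 1)), Nat.cast_sub h]
        push_cast
        congr 3
        ring
      · rw [dirac_pow_eq_zero hQ h]; simp
    rw [dirac_pow_succ_apply, ih, map_add, map_smul, map_smul, key, ← dirac_pow_succ_apply,
      pow_succ (-1 : ℝ) (j + 1), pow_succ (-1 : ℝ) j]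
    by_cases h : Even j
    · have h' : ¬ Even (j + 1) := by simpa [Nat.even_add_one] using h
      rw [if_pos h, if_neg h', h.neg_one_pow]
      push_cast
      module
    · have h' : Even (j + 1) := by simpa [Nat.even_add_one] using h
      rw [if_neg h, if_pos h', (Nat.not_even_iff_odd.1 h).neg_one_pow]
      push_cast
      module

/-- The coefficients `c_j` in the formula `M[P] = ∑ c_j z^j ∂^j P` for the monogenic projection of
a polynomial `P` that is homogeneous of degree `n`. -/
def fischerCoeff (m n : ℕ) : ℕ → ℝ
  | 0 => 1
  | j + 1 => if Even j then fischerCoeff m n j / (m + 2 * n - 2 - j)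
      else -fischerCoeff m n j / (j + 1)

/-- The operator `P ↦ ∑ c_j z^j ∂^j P`, which is the monogenic projection in degree `n`. All terms
with `j > n` vanish in that degree; the range is chosen even, so that the terms can be paired. -/
def monoProj (m n : ℕ) : ClPoly m →ₗ[ℝ] ClPoly m :=
  ∑ j ∈ Finset.range (2 * (n + 1)),
    fischerCoeff m n j • (LinearMap.mulLeft ℝ (vecVar m ^ j) ∘ₗ (dirac m ^ j))

lemma monoProj_apply (n : ℕ) (P : ClPoly m) :
    monoProj m n P = ∑ j ∈ Finset.range (2 * (n + 1)),
      fischerCoeff m n j • (vecVar m ^ j * (dirac m ^ j) P) := by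
  simp [monoProj]

lemma dirac_pow_smul (c : ℂ) (j : ℕ) (P : ClPoly m) :
    (dirac m ^ j) (c • P) = c • (dirac m ^ j) P := by
  induction j with
  | zero => simp
  | succ j ih => rw [dirac_pow_succ_apply, ih, dirac_smul, ← dirac_pow_succ_apply]

lemma dirac_pow_mul_constPoly (P : ClPoly m) (a : ComplexCl m) (j : ℕ) :
    (dirac m ^ j) (P * constPoly m a) = (dirac m ^ j) P * constPoly m a := by
  induction j with
  | zero => simp
  | succ j ih => rw [dirac_pow_succ_apply, ih, dirac_mul_constPoly, ← dirac_pow_succ_apply]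

lemma monoProj_smul (n : ℕ) (c : ℂ) (P : ClPoly m) :
    monoProj m n (c • P) = c • monoProj m n P := by
  simp_rw [monoProj_apply, dirac_pow_smul, Finset.smul_sum, mul_smul_comm]
  refine Finset.sum_congr rfl fun j _ => smul_comm _ _ _

lemma monoProj_mul_constPoly (n : ℕ) (P : ClPoly m) (a : ComplexCl m) :
    monoProj m n (P * constPoly m a) = monoProj m n P * constPoly m a := by
  simp_rw [monoProj_apply, dirac_pow_mul_constPoly, Finset.sum_mul, smul_mul_assoc, mul_assoc]

lemma neg_one_pow_mul_fischerCoeff {n j : ℕ} (hj : j + 1 ≤ n) (hm : 1 ≤ m) :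
    (-1) ^ j * fischerCoeff m n j =
      fischerCoeff m n (j + 1) * (if Even j then (m : ℝ) + 2 * n - 2 - j else j + 1) := by
  have h1 : (j : ℝ) + 1 ≤ n := by exact_mod_cast hj
  have h2 : (1 : ℝ) ≤ m := by exact_mod_cast hm
  have h3 : (0 : ℝ) ≤ j := j.cast_nonneg
  by_cases h : Even j
  · rw [if_pos h, fischerCoeff, if_pos h, h.neg_one_pow, div_mul_cancel₀]
    · simp
    · nlinarith
  · rw [if_neg h, fischerCoeff, if_neg h, (Nat.not_even_iff_odd.1 h).neg_one_pow,
      div_mul_cancel₀]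
    · simp
    · positivity

/-- `M[P]` is monogenic: the images under `∂` of the terms `c_j z^j ∂^j P` telescope. -/
lemma dirac_monoProj {n : ℕ} (hm : 1 ≤ m) {P : ClPoly m} (hP : P ∈ homogPoly m n) :
    dirac m (monoProj m n P) = 0 := by
  have key : ∀ N, dirac m (∑ j ∈ Finset.range (N + 1),
      fischerCoeff m n j • (vecVar m ^ j * (dirac m ^ j) P)) =
      ((-1) ^ N * fischerCoeff m n N) • (vecVar m ^ N * (dirac m ^ (N + 1)) P) := by
    intro N
    induction N with
    | zero => simp [fischerCoeff]
    | succ N ih =>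
      rw [Finset.sum_range_succ, map_add, ih, map_smul]
      rcases lt_or_ge n (N + 1) with h | h
      · rw [dirac_pow_eq_zero hP h, dirac_pow_eq_zero hP (h.trans (Nat.lt_succ_self _))]; simp
      · rw [dirac_vecVar_pow_mul (dirac_pow_mem_homogPoly hP (N + 1)),
          neg_one_pow_mul_fischerCoeff h hm, ← dirac_pow_succ_apply, Nat.cast_sub h]
        by_cases h' : Even N
        · simp only [if_pos h']
          push_cast
          module
        · simp only [if_neg h']
          module
  rw [monoProj_apply, show 2 * (n + 1) = 2 * n + 1 + 1 by ring, key,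
    dirac_pow_eq_zero hP (by omega)]
  simp

/-- The projection kills the multiples of the vector variable, again by telescoping. -/
lemma monoProj_vecVar_mul {l : ℕ} (hm : 1 ≤ m) {Q : ClPoly m} (hQ : Q ∈ homogPoly m l) :
    monoProj m (l + 1) (vecVar m * Q) = 0 := by
  have key : ∀ N, ∑ j ∈ Finset.range (N + 1),
      fischerCoeff m (l + 1) j • (vecVar m ^ j * (dirac m ^ j) (vecVar m * Q)) =
      ((-1) ^ N * fischerCoeff m (l + 1) N) • (vecVar m ^ (N + 1) * (dirac m ^ N) Q) := by
    intro N
    induction N with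
    | zero => simp [fischerCoeff]
    | succ N ih =>
      rw [Finset.sum_range_succ, ih, dirac_pow_vecVar_mul hQ, mul_add, mul_smul_comm,
        mul_smul_comm, ← mul_assoc, ← pow_succ]
      rcases lt_or_ge l N with h | h
      · rw [dirac_pow_eq_zero hQ h, dirac_pow_eq_zero hQ (h.trans (Nat.lt_succ_self _))]; simp
      · rw [neg_one_pow_mul_fischerCoeff (by omega) hm]
        by_cases h' : Even N
        · simp only [if_pos h']
          push_cast
          module
        · simp only [if_neg h']
          module
  rw [monoProj_apply, show 2 * (l + 1 + 1) = 2 * l + 3 + 1 by ring, key,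
    dirac_pow_eq_zero hQ (by omega)]
  simp

lemma monoProj_eq_self (n : ℕ) {P : ClPoly m} (hP : dirac m P = 0) : monoProj m n P = P := by
  rw [monoProj_apply, Finset.sum_eq_single 0]
  · simp [fischerCoeff]
  · intro j _ hj
    obtain ⟨k, rfl⟩ := Nat.exists_eq_succ_of_ne_zero hj
    rw [Nat.succ_eq_add_one, pow_succ (dirac m) k, Module.End.mul_apply, hP]
    simp
  · simp

lemma monoProj_mem_homogPoly {n : ℕ} {P : ClPoly m} (hP : P ∈ homogPoly m n) :
    monoProj m n P ∈ homogPoly m n := by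
  rw [monoProj_apply]
  refine Submodule.sum_mem _ fun j _ => Submodule.smul_mem _ _ ?_
  rcases lt_or_ge n j with h | h
  · rw [dirac_pow_eq_zero hP h]; simp
  · have := vecVar_pow_mul_mem_homogPoly (dirac_pow_mem_homogPoly hP j) j
    rwa [Nat.add_sub_cancel' h] at this

lemma exists_sub_monoProj_eq_vecVar_mul {n : ℕ} {P : ClPoly m} (hP : P ∈ homogPoly m (n + 1)) :
    ∃ Q ∈ homogPoly m n, P = monoProj m (n + 1) P + vecVar m * Q := by
  refine ⟨(-1 : ℝ) • ∑ j ∈ Finset.range (2 * n + 3),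
    fischerCoeff m (n + 1) (j + 1) • (vecVar m ^ j * (dirac m ^ (j + 1)) P), ?_, ?_⟩
  · refine Submodule.smul_mem _ _ (Submodule.sum_mem _ fun j _ => Submodule.smul_mem _ _ ?_)
    rcases lt_or_ge (n + 1) (j + 1) with h | h
    · rw [dirac_pow_eq_zero hP h]; simp
    · have := vecVar_pow_mul_mem_homogPoly (dirac_pow_mem_homogPoly hP (j + 1)) j
      rwa [Nat.add_sub_add_right, Nat.add_sub_cancel' (by omega)] at this
  · rw [monoProj_apply, show 2 * (n + 1 + 1) = 2 * n + 3 + 1 by ring, Finset.sum_range_succ',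
      mul_smul_comm, Finset.mul_sum]
    simp_rw [mul_smul_comm, ← mul_assoc, ← pow_succ']
    rw [fischerCoeff, pow_zero, pow_zero, one_mul, Module.End.one_apply]
    module

/-- The Fischer decomposition is obtained by splitting off the monogenic projection repeatedly. -/
lemma isMonogenicPart_monoProj (hm : 1 ≤ m) {n : ℕ} {P : ClPoly m} (hP : P ∈ homogPoly m n) :
    IsMonogenicPart n P (monoProj m n P) := by
  induction n generalizing P with
  | zero =>
    refine ⟨fun _ => P, ?_, ?_, ?_⟩
    · intro j hj
      obtain rfl : j = 0 := by omega
      exact ⟨hP, dirac_eq_zero_of_mem_homogPoly_zero hP⟩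
    · simp
    · exact monoProj_eq_self 0 (dirac_eq_zero_of_mem_homogPoly_zero hP)
  | succ n ih =>
    obtain ⟨Q, hQ, hPQ⟩ := exists_sub_monoProj_eq_vecVar_mul hP
    obtain ⟨N, hN, hQN, -⟩ := ih hQ
    refine ⟨fun j => if j ≤ n then N j else monoProj m (n + 1) P, ?_, ?_, ?_⟩
    · intro j hj
      by_cases h : j ≤ n
      · simp only [if_pos h]; exact hN j h
      · obtain rfl : j = n + 1 := by omega
        simp only [if_neg h]
        exact ⟨monoProj_mem_homogPoly hP, dirac_monoProj hm hP⟩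
    · rw [Finset.sum_range_succ']
      conv_lhs => rw [hPQ, hQN]
      rw [add_comm, Finset.mul_sum]
      congr 1
      · refine Finset.sum_congr rfl fun j _ => ?_
        beta_reduce
        rw [if_pos (by omega), pow_succ', mul_assoc, Nat.add_sub_add_right]
      · simp
    · simp

lemma IsMonogenicPart.eq_monoProj (hm : 1 ≤ m) {n : ℕ} {P M : ClPoly m}
    (h : IsMonogenicPart n P M) : M = monoProj m n P := by
  obtain ⟨N, hN, hP, rfl⟩ := h
  rw [hP, Finset.sum_range_succ', map_add, map_sum, Finset.sum_eq_zero, zero_add]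
  · simp [monoProj_eq_self n (hN n le_rfl).2]
  · intro j hj
    have hj' : j + 1 ≤ n := by simpa using hj
    have h1 := vecVar_pow_mul_mem_homogPoly (hN (n - (j + 1)) (by omega)).1 j
    obtain ⟨k, rfl⟩ : ∃ k, n = k + 1 := ⟨n - 1, by omega⟩
    rw [pow_succ', mul_assoc]
    apply monoProj_vecVar_mul hm
    rw [Nat.add_sub_add_right] at h1 ⊢
    rwa [Nat.add_sub_cancel' (by omega)] at h1

/-- The monogenic projection that is defined through the Fischer decomposition is the explicit
operator. -/
lemma monogenicProj_eq (hm : 1 ≤ m) {n : ℕ} {P : ClPoly m} (hP : P ∈ homogPoly m n) :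
    monogenicProj n P = monoProj m n P := by
  have h : ∃ M, IsMonogenicPart n P M := ⟨_, isMonogenicPart_monoProj hm hP⟩
  rw [monogenicProj, dif_pos h]
  exact h.choose_spec.eq_monoProj hm

end Fischer

/-! ### Isometry invariance of the surface measure -/

section Sphere

variable {V W : Type*} [NormedAddCommGroup V] [InnerProductSpace ℝ V] [FiniteDimensional ℝ V]
  [MeasurableSpace V] [BorelSpace V] [NormedAddCommGroup W] [InnerProductSpace ℝ W]
  [FiniteDimensional ℝ W] [MeasurableSpace W] [BorelSpace W]

/-- The homeomorphism of unit spheres induced by a linear isometry. -/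
def sphereHomeomorph (T : V ≃ₗᵢ[ℝ] W) : Metric.sphere (0 : V) 1 ≃ₜ Metric.sphere (0 : W) 1 where
  toFun s := ⟨T s, by simp⟩
  invFun s := ⟨T.symm s, by simp⟩
  left_inv s := by simp
  right_inv s := by simp
  continuous_toFun := by fun_prop
  continuous_invFun := by fun_prop

lemma measurePreserving_sphereHomeomorph (T : V ≃ₗᵢ[ℝ] W) :
    MeasurePreserving (sphereHomeomorph T) (surfaceMeasure V) (surfaceMeasure W) := by
  refine ⟨(sphereHomeomorph T).continuous.measurable, ?_⟩
  ext s hs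
  have hs' := (sphereHomeomorph T).continuous.measurable hs
  rw [Measure.map_apply (sphereHomeomorph T).continuous.measurable hs, surfaceMeasure,
    surfaceMeasure, Measure.toSphere_apply' _ hs, Measure.toSphere_apply' _ hs',
    T.toLinearEquiv.finrank_eq, ← T.measurePreserving.measure_preimage_equiv (f := T.toMeasurableEquiv)]
  congr 2
  ext v
  simp only [Set.mem_smul, Set.mem_image, Set.mem_preimage, Subtype.exists, mem_sphere_zero_iff_norm]
  constructor
  · rintro ⟨r, hr, _, ⟨w, hw, hws, rfl⟩, rfl⟩
    exact ⟨r, hr, T w, ⟨T w, by simpa using hw, hws, rfl⟩, by simp⟩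
  · rintro ⟨r, hr, _, ⟨w, hw, hws, rfl⟩, h⟩
    refine ⟨r, hr, T.symm w, ⟨T.symm w, by simpa using hw, ?_, rfl⟩, ?_⟩
    · simpa [sphereHomeomorph] using hws
    · apply T.injective
      simpa using h

lemma integral_sphere_comp (T : V ≃ₗᵢ[ℝ] W) (f : Metric.sphere (0 : W) 1 → ℂ) :
    ∫ s, f (sphereHomeomorph T s) ∂surfaceMeasure V = ∫ s, f s ∂surfaceMeasure W :=
  (measurePreserving_sphereHomeomorph T).integral_comp
    (sphereHomeomorph T).toMeasurableEquiv.measurableEmbedding f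

lemma integrable_sphere_comp (T : V ≃ₗᵢ[ℝ] W) (f : Metric.sphere (0 : W) 1 → ℂ) :
    Integrable (fun s => f (sphereHomeomorph T s)) (surfaceMeasure V) ↔
      Integrable f (surfaceMeasure W) :=
  (measurePreserving_sphereHomeomorph T).integrable_comp_emb
    (sphereHomeomorph T).toMeasurableEquiv.measurableEmbedding

instance : IsFiniteMeasure (surfaceMeasure V) := by
  unfold surfaceMeasure; infer_instance

lemma surfaceMeasure_real_univ [Nontrivial V] :
    (surfaceMeasure V).real Set.univ = sphereArea (Module.finrank ℝ V) := by
  have hd : (0 : ℝ) < Module.finrank ℝ V := by exact_mod_cast Module.finrank_pos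
  rw [surfaceMeasure, Measure.toSphere_real_apply_univ, measureReal_def,
    InnerProductSpace.volume_ball, ENNReal.ofReal_one, one_pow, one_mul, ENNReal.toReal_ofReal,
    sphereArea, Real.Gamma_add_one (by positivity), Real.rpow_div_two_eq_sqrt _ Real.pi_pos.le,
    Real.rpow_natCast]
  · field_simp
  · positivity

end Sphere

/-! ### Integrals over the Stiefel manifold -/

section Stiefel

variable {m : ℕ}

/-- The isometry between the orthogonal complements of `t` and of `g t`. -/
def perpEquiv (g : EuclideanSpace ℝ (Fin m) ≃ₗᵢ[ℝ] EuclideanSpace ℝ (Fin m))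
    {t t' : EuclideanSpace ℝ (Fin m)} (h : g t = t') : Perp t ≃ₗᵢ[ℝ] Perp t' :=
  (g.submoduleMap (Perp t)).trans (LinearIsometryEquiv.ofEq _ _ (by
    subst h
    have := Submodule.map_orthogonal_equiv (Submodule.span ℝ {t}) g
    rw [Submodule.map_span, Set.image_singleton] at this
    exact this))

variable {V W : Type*} [AddCommGroup V] [Module ℂ V] [AddCommGroup W] [Module ℂ W]

/-- `HasStiefelIntegral` for functions with values in an arbitrary complex vector space. The
integral is not normalized; it is taken after every linear functional, so it is automatically
compatible with linear maps. -/
def HasMean (F : EuclideanSpace ℝ (Fin m) → EuclideanSpace ℝ (Fin m) → V) (I : V) : Prop :=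
  ∀ φ : V →ₗ[ℂ] ℂ,
    (∀ t : Metric.sphere (0 : EuclideanSpace ℝ (Fin m)) 1,
      Integrable (fun s : Metric.sphere (0 : Perp t.1) 1 => φ (F t.1 (s.1 : Perp t.1)))
        (surfaceMeasure (Perp t.1))) ∧
    Integrable
      (fun t : Metric.sphere (0 : EuclideanSpace ℝ (Fin m)) 1 =>
        ∫ s : Metric.sphere (0 : Perp t.1) 1, φ (F t.1 (s.1 : Perp t.1))
          ∂surfaceMeasure (Perp t.1))
      (surfaceMeasure (EuclideanSpace ℝ (Fin m))) ∧
    ∫ t : Metric.sphere (0 : EuclideanSpace ℝ (Fin m)) 1,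
        ∫ s : Metric.sphere (0 : Perp t.1) 1, φ (F t.1 (s.1 : Perp t.1))
          ∂surfaceMeasure (Perp t.1)
      ∂surfaceMeasure (EuclideanSpace ℝ (Fin m)) = φ I

variable {F G : EuclideanSpace ℝ (Fin m) → EuclideanSpace ℝ (Fin m) → V} {I J : V}

lemma HasMean.map (h : HasMean F I) (L : V →ₗ[ℂ] W) : HasMean (fun t s => L (F t s)) (L I) :=
  fun φ => h (φ ∘ₗ L)

lemma HasMean.unique (h : HasMean F I) (h' : HasMean F J) : I = J := by
  rw [← sub_eq_zero, ← Module.forall_dual_apply_eq_zero_iff ℂ]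
  intro φ
  rw [map_sub, ← (h φ).2.2, ← (h' φ).2.2, sub_self]

/-- Only the values on orthonormal pairs matter. -/
lemma HasMean.congr (h : HasMean F I)
    (hFG : ∀ t s, ‖t‖ = 1 → ‖s‖ = 1 → inner ℝ t s = 0 → F t s = G t s) : HasMean G I := by
  have : ∀ (t : Metric.sphere (0 : EuclideanSpace ℝ (Fin m)) 1)
      (s : Metric.sphere (0 : Perp t.1) 1),
      F t.1 (s.1 : Perp t.1) = G t.1 (s.1 : Perp t.1) := by
    intro t s
    apply hFG
    · exact mem_sphere_zero_iff_norm.1 t.2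
    · exact mem_sphere_zero_iff_norm.1 s.2
    · exact Submodule.mem_orthogonal_singleton_iff_inner_right.1 s.1.2
  intro φ
  simpa only [this] using h φ

lemma HasMean.add (hF : HasMean F I) (hG : HasMean G J) :
    HasMean (fun t s => F t s + G t s) (I + J) := by
  intro φ
  obtain ⟨f1, f2, f3⟩ := hF φ
  obtain ⟨g1, g2, g3⟩ := hG φ
  simp only [map_add]
  simp only [fun t => integral_add (f1 t) (g1 t)]
  refine ⟨fun t => (f1 t).add (g1 t), f2.add g2, ?_⟩
  rw [integral_add f2 g2, f3, g3]

lemma hasMean_zero : HasMean (fun (_ _ : EuclideanSpace ℝ (Fin m)) => (0 : V)) 0 := by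
  intro φ
  simp

lemma HasMean.smul (h : HasMean F I) (c : ℂ) : HasMean (fun t s => c • F t s) (c • I) :=
  h.map (LinearMap.lsmul ℂ V c)

lemma HasMean.sum {ι : Type*} (S : Finset ι)
    {F : ι → EuclideanSpace ℝ (Fin m) → EuclideanSpace ℝ (Fin m) → V} {I : ι → V}
    (h : ∀ i ∈ S, HasMean (F i) (I i)) :
    HasMean (fun t s => ∑ i ∈ S, F i t s) (∑ i ∈ S, I i) := by
  classical
  induction S using Finset.induction_on with
  | empty => simpa using hasMean_zero
  | insert i S hi ih =>
    simp only [Finset.sum_insert hi]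
    exact (h i (by simp)).add (ih fun j hj => h j (by simp [hj]))

lemma HasMean.comp_isometry (h : HasMean F I)
    (g : EuclideanSpace ℝ (Fin m) ≃ₗᵢ[ℝ] EuclideanSpace ℝ (Fin m)) :
    HasMean (fun t s => F (g t) (g s)) I := by
  intro φ
  obtain ⟨h1, h2, h3⟩ := h φ
  have key : ∀ t : Metric.sphere (0 : EuclideanSpace ℝ (Fin m)) 1,
      ∫ s : Metric.sphere (0 : Perp t.1) 1, φ (F (g t.1) (g (s.1 : Perp t.1)))
        ∂surfaceMeasure (Perp t.1) =
      ∫ s : Metric.sphere (0 : Perp (sphereHomeomorph g t).1) 1,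
        φ (F (sphereHomeomorph g t).1 (s.1 : Perp _)) ∂surfaceMeasure (Perp _) := fun t =>
    integral_sphere_comp (perpEquiv g (t := t.1) (t' := (sphereHomeomorph g t).1) rfl)
      (fun s => φ (F (sphereHomeomorph g t).1 s.1))
  refine ⟨fun t => ?_, ?_, ?_⟩
  · exact (integrable_sphere_comp
      (perpEquiv g (t := t.1) (t' := (sphereHomeomorph g t).1) rfl)
      (fun s => φ (F (sphereHomeomorph g t).1 s.1))).2 (h1 _)
  · simp only [key]
    exact (integrable_sphere_comp g _).2 h2
  · simp only [key]
    rw [← h3]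
    exact integral_sphere_comp g (fun t => ∫ s : Metric.sphere (0 : Perp t.1) 1,
      φ (F t.1 (s.1 : Perp t.1)) ∂surfaceMeasure (Perp t.1))

lemma HasMean.comp_neg (h : HasMean F I) : HasMean (fun t s => F t (-s)) I := by
  intro φ
  obtain ⟨h1, h2, h3⟩ := h φ
  have key : ∀ t : Metric.sphere (0 : EuclideanSpace ℝ (Fin m)) 1,
      ∫ s : Metric.sphere (0 : Perp t.1) 1, φ (F t.1 (-(s.1 : Perp t.1)))
        ∂surfaceMeasure (Perp t.1) =
      ∫ s : Metric.sphere (0 : Perp t.1) 1, φ (F t.1 (s.1 : Perp t.1))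
        ∂surfaceMeasure (Perp t.1) := fun t =>
    integral_sphere_comp (LinearIsometryEquiv.neg ℝ)
      (fun s : Metric.sphere (0 : Perp t.1) 1 => φ (F t.1 (s.1 : Perp t.1)))
  refine ⟨fun t => ?_, ?_, ?_⟩
  · exact (integrable_sphere_comp (LinearIsometryEquiv.neg ℝ)
      (fun s : Metric.sphere (0 : Perp t.1) 1 => φ (F t.1 (s.1 : Perp t.1)))).2 (h1 _)
  · simpa only [key] using h2
  · simpa only [key] using h3

lemma HasMean.dagger {F : EuclideanSpace ℝ (Fin m) → EuclideanSpace ℝ (Fin m) → ComplexCl m}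
    {I : ComplexCl m} (h : HasMean F I) :
    HasMean (fun t s => dagger m (F t s)) (dagger m I) := by
  intro φ
  let ψ : ComplexCl m →ₗ[ℂ] ℂ :=
    { toFun := fun a => starRingEnd ℂ (φ (HuaRadon.dagger m a))
      map_add' := fun a b => by simp
      map_smul' := fun c a => by simp [dagger_smul] }
  have hψ : ∀ a, φ (HuaRadon.dagger m a) = starRingEnd ℂ (ψ a) := fun a => by simp [ψ]
  obtain ⟨h1, h2, h3⟩ := h ψ
  simp only [hψ, integral_conj, h3]
  exact ⟨fun t => Complex.conjLIE.integrable_comp_iff.2 (h1 t),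
    Complex.conjLIE.integrable_comp_iff.2 h2, trivial⟩

/-- Continuous functions can be integrated over the Stiefel manifold. For the measurability of the
inner integral, the spheres in the hyperplanes `t^⊥` are identified with a fixed one, by the
reflection that maps a fixed unit vector to `t`. -/
lemma exists_hasMean_of_continuous (hm : 1 ≤ m)
    (f : EuclideanSpace ℝ (Fin m) → EuclideanSpace ℝ (Fin m) → ℂ)
    (hf : Continuous (Function.uncurry f)) : ∃ c : ℂ, HasMean f c := by
  obtain ⟨C, hC⟩ : ∃ C, ∀ t s : EuclideanSpace ℝ (Fin m), ‖t‖ = 1 → ‖s‖ = 1 → ‖f t s‖ ≤ C := by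
    have hK : IsCompact (Metric.sphere (0 : EuclideanSpace ℝ (Fin m)) 1 ×ˢ
        Metric.sphere (0 : EuclideanSpace ℝ (Fin m)) 1) :=
      (isCompact_sphere _ _).prod (isCompact_sphere _ _)
    obtain ⟨C, hC⟩ := hK.exists_bound_of_continuousOn hf.continuousOn
    exact ⟨C, fun t s ht hs => hC (t, s) ⟨by simpa using ht, by simpa using hs⟩⟩
  have h1 : ∀ t : Metric.sphere (0 : EuclideanSpace ℝ (Fin m)) 1,
      Integrable (fun s : Metric.sphere (0 : Perp t.1) 1 => f t.1 (s.1 : Perp t.1))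
        (surfaceMeasure (Perp t.1)) := by
    intro t
    refine Integrable.of_bound (C := C) ?_ (Filter.Eventually.of_forall fun s => ?_)
    · refine Continuous.aestronglyMeasurable ?_
      exact hf.comp (by fun_prop : Continuous fun s : Metric.sphere (0 : Perp t.1) 1 =>
        (t.1, ((s.1 : Perp t.1) : EuclideanSpace ℝ (Fin m))))
    · exact hC _ _ (mem_sphere_zero_iff_norm.1 t.2) (mem_sphere_zero_iff_norm.1 s.2)
  have h2 : Integrable
      (fun t : Metric.sphere (0 : EuclideanSpace ℝ (Fin m)) 1 =>
        ∫ s : Metric.sphere (0 : Perp t.1) 1, f t.1 (s.1 : Perp t.1) ∂surfaceMeasure (Perp t.1))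
      (surfaceMeasure (EuclideanSpace ℝ (Fin m))) := by
    let e0 : EuclideanSpace ℝ (Fin m) := EuclideanSpace.single ⟨0, hm⟩ 1
    have he0 : ‖e0‖ = 1 := by simp [e0]
    let g : EuclideanSpace ℝ (Fin m) → EuclideanSpace ℝ (Fin m) ≃ₗᵢ[ℝ] EuclideanSpace ℝ (Fin m) :=
      fun t => (Submodule.span ℝ {e0 - t})ᗮ.reflection
    have hg : ∀ t s, g t s = s - (2 * (inner ℝ (e0 - t) s / ‖e0 - t‖ ^ 2)) • (e0 - t) := by
      intro t s
      rw [Submodule.reflection_orthogonal_apply, Submodule.reflection_singleton_apply]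
      simp only [RCLike.ofReal_real_eq_id, id_eq]
      module
    have hgt : ∀ t : Metric.sphere (0 : EuclideanSpace ℝ (Fin m)) 1, g t.1 e0 = t.1 := fun t =>
      Submodule.reflection_sub (by rw [he0, mem_sphere_zero_iff_norm.1 t.2])
    have key : ∀ t : Metric.sphere (0 : EuclideanSpace ℝ (Fin m)) 1,
        ∫ s : Metric.sphere (0 : Perp t.1) 1, f t.1 (s.1 : Perp t.1) ∂surfaceMeasure (Perp t.1) =
        ∫ s : Metric.sphere (0 : Perp e0) 1, f t.1 (g t.1 (s.1 : Perp e0))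
          ∂surfaceMeasure (Perp e0) := fun t =>
      (integral_sphere_comp (perpEquiv (g t.1) (hgt t)) (fun s => f t.1 s.1)).symm
    simp only [key]
    have hmeas : StronglyMeasurable
        (fun z : Metric.sphere (0 : EuclideanSpace ℝ (Fin m)) 1 ×
          Metric.sphere (0 : Perp e0) 1 => f z.1.1 (g z.1.1 (z.2.1 : Perp e0))) := by
      refine Measurable.stronglyMeasurable ?_
      refine hf.measurable.comp (Measurable.prodMk (by fun_prop) ?_)
      simp only [hg]
      fun_prop
    refine Integrable.of_bound (C := C * (surfaceMeasure (Perp e0)).real Set.univ)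
      hmeas.integral_prod_right'.aestronglyMeasurable (Filter.Eventually.of_forall fun t => ?_)
    refine norm_integral_le_of_norm_le_const (Filter.Eventually.of_forall fun s => ?_)
    refine hC _ _ (mem_sphere_zero_iff_norm.1 t.2) ?_
    rw [LinearIsometryEquiv.norm_map]
    exact mem_sphere_zero_iff_norm.1 s.2
  refine ⟨∫ t : Metric.sphere (0 : EuclideanSpace ℝ (Fin m)) 1,
    ∫ s : Metric.sphere (0 : Perp t.1) 1, f t.1 (s.1 : Perp t.1) ∂surfaceMeasure (Perp t.1)
      ∂surfaceMeasure (EuclideanSpace ℝ (Fin m)), fun φ => ?_⟩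
  obtain ⟨d, hφ⟩ : ∃ d, ∀ z, φ z = z * d := ⟨φ 1, fun z => by
    rw [← smul_eq_mul, ← map_smul, smul_eq_mul, mul_one]⟩
  simp only [hφ, integral_mul_const]
  exact ⟨fun t => (h1 t).mul_const _, h2.mul_const _, trivial⟩

lemma hasMean_one (hm : 2 ≤ m) :
    HasMean (fun _ _ : EuclideanSpace ℝ (Fin m) => (1 : ℂ))
      ((sphereArea m * sphereArea (m - 1) : ℝ) : ℂ) := by
  have hn : Nontrivial (EuclideanSpace ℝ (Fin m)) :=
    Module.nontrivial_of_finrank_pos (R := ℝ) (by simp; omega)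
  have key : ∀ t : Metric.sphere (0 : EuclideanSpace ℝ (Fin m)) 1,
      (surfaceMeasure (Perp t.1)).real Set.univ = sphereArea (m - 1) := by
    intro t
    have ht : t.1 ≠ 0 := fun h => by simpa [h] using t.2
    have hd : Module.finrank ℝ (Perp t.1) = m - 1 := by
      have := (Submodule.span ℝ {t.1}).finrank_add_finrank_orthogonal
      rw [finrank_span_singleton ht, finrank_euclideanSpace, Fintype.card_fin] at this
      change 1 + Module.finrank ℝ (Perp t.1) = m at this
      omega
    have : Nontrivial (Perp t.1) := Module.nontrivial_of_finrank_pos (R := ℝ) (by omega)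
    rw [surfaceMeasure_real_univ, hd]
  intro φ
  simp only [integral_const, key]
  refine ⟨fun t => integrable_const _, integrable_const _, ?_⟩
  rw [surfaceMeasure_real_univ, finrank_euclideanSpace, Fintype.card_fin, smul_smul,
    Complex.real_smul, ← smul_eq_mul, ← map_smul, smul_eq_mul, mul_one]

/-- The `V`-valued functions on pairs of vectors that are finite sums `∑ f_i v_i` with continuous
scalar functions `f_i` and constant vectors `v_i`. -/
def contFun (m : ℕ) (V : Type*) [AddCommGroup V] [Module ℂ V] :
    Submodule ℂ (EuclideanSpace ℝ (Fin m) → EuclideanSpace ℝ (Fin m) → V) :=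
  Submodule.span ℂ {F | ∃ f : EuclideanSpace ℝ (Fin m) → EuclideanSpace ℝ (Fin m) → ℂ,
    Continuous (Function.uncurry f) ∧ ∃ v : V, F = fun t s => f t s • v}

lemma smul_mem_contFun {f : EuclideanSpace ℝ (Fin m) → EuclideanSpace ℝ (Fin m) → ℂ}
    (hf : Continuous (Function.uncurry f)) (v : V) : (fun t s => f t s • v) ∈ contFun m V :=
  Submodule.subset_span ⟨f, hf, v, rfl⟩

lemma const_mem_contFun (v : V) : (fun _ _ => v) ∈ contFun m V := by
  have := smul_mem_contFun (m := m) (f := fun _ _ => 1) (by exact continuous_const) v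
  simpa using this

lemma HasMean.smul_const {f : EuclideanSpace ℝ (Fin m) → EuclideanSpace ℝ (Fin m) → ℂ} {c : ℂ}
    (h : HasMean f c) (v : V) : HasMean (fun t s => f t s • v) (c • v) :=
  h.map (LinearMap.toSpanSingleton ℂ V v)

lemma exists_hasMean (hm : 1 ≤ m) (hF : F ∈ contFun m V) : ∃ I, HasMean F I := by
  induction hF using Submodule.span_induction with
  | mem x hx =>
    obtain ⟨f, hf, v, rfl⟩ := hx
    obtain ⟨c, hc⟩ := exists_hasMean_of_continuous hm f hf
    exact ⟨_, hc.smul_const v⟩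
  | zero => exact ⟨0, hasMean_zero⟩
  | add x y _ _ hx hy =>
    obtain ⟨I, hI⟩ := hx
    obtain ⟨J, hJ⟩ := hy
    exact ⟨_, hI.add hJ⟩
  | smul c x _ hx =>
    obtain ⟨I, hI⟩ := hx
    exact ⟨_, hI.smul c⟩

lemma mul_mem_contFun {A : Type*} [Ring A] [Algebra ℂ A]
    {F G : EuclideanSpace ℝ (Fin m) → EuclideanSpace ℝ (Fin m) → A}
    (hF : F ∈ contFun m A) (hG : G ∈ contFun m A) :
    (fun t s => F t s * G t s) ∈ contFun m A := by
  change F * G ∈ contFun m A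
  induction hF using Submodule.span_induction with
  | mem x hx =>
    obtain ⟨f, hf, v, rfl⟩ := hx
    induction hG using Submodule.span_induction with
    | mem y hy =>
      obtain ⟨g, hg, w, rfl⟩ := hy
      have := smul_mem_contFun (m := m) (f := fun t s => f t s * g t s) (hf.mul hg) (v * w)
      convert this using 1
      ext t s
      simp [smul_smul, mul_comm]
    | zero => simp
    | add x y _ _ hx hy => rw [mul_add]; exact add_mem hx hy
    | smul c x _ hx => rw [mul_smul_comm]; exact Submodule.smul_mem _ _ hx
  | zero => simp
  | add x y _ _ hx hy => rw [add_mul]; exact add_mem hx hy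
  | smul c x _ hx => rw [smul_mul_assoc]; exact Submodule.smul_mem _ _ hx

lemma pow_mem_contFun {A : Type*} [Ring A] [Algebra ℂ A]
    {F : EuclideanSpace ℝ (Fin m) → EuclideanSpace ℝ (Fin m) → A}
    (hF : F ∈ contFun m A) (k : ℕ) : (fun t s => F t s ^ k) ∈ contFun m A := by
  induction k with
  | zero => simpa using const_mem_contFun (1 : A)
  | succ k ih => simpa only [pow_succ] using mul_mem_contFun ih hF

lemma map_mem_contFun (hF : F ∈ contFun m V) (L : V →ₗ[ℂ] W) :
    (fun t s => L (F t s)) ∈ contFun m W := by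
  induction hF using Submodule.span_induction with
  | mem x hx =>
    obtain ⟨f, hf, v, rfl⟩ := hx
    simpa using smul_mem_contFun hf (L v)
  | zero => simpa using const_mem_contFun (0 : W)
  | add x y _ _ hx hy =>
    simp only [Pi.add_apply, map_add]
    exact add_mem hx hy
  | smul c x _ hx =>
    simp only [Pi.smul_apply, map_smul]
    exact Submodule.smul_mem _ c hx

end Stiefel

/-! ### Polynomials in linear forms -/

section Forms

variable {m : ℕ}

/-- A real vector, as a vector with complex coordinates. -/
abbrev toC (x : EuclideanSpace ℝ (Fin m)) : Fin m → ℂ := fun j => (x j : ℂ)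

lemma sum_toC_mul (x y : EuclideanSpace ℝ (Fin m)) :
    ∑ j, toC x j * toC y j = ((inner ℝ x y : ℝ) : ℂ) := by
  simp [PiLp.inner_apply, mul_comm]

lemma ofReal_smul_eq {M : Type*} [AddCommMonoid M] [Module ℝ M] [Module ℂ M] [IsScalarTower ℝ ℂ M]
    (r : ℝ) (x : M) : (r : ℂ) • x = r • x :=
  algebraMap_smul ℂ r x

/-- A Clifford-valued polynomial is determined by its values at the real points. -/
lemma clPoly_ext {P Q : ClPoly m}
    (h : ∀ x : EuclideanSpace ℝ (Fin m), evalAt (toC x) P = evalAt (toC x) Q) : P = Q := by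
  classical
  let b := Module.Basis.ofVectorSpace ℝ (RealCl m)
  let L := TensorProduct.equivFinsuppOfBasisRight (M := MvPolynomial (Fin m) ℂ) b
  let L' := TensorProduct.equivFinsuppOfBasisRight (M := ℂ) b
  have hL : ∀ (z : Fin m → ℂ) (R : ClPoly m) i, L' (evalAt z R) i = MvPolynomial.aeval z (L R i) := by
    intro z R i
    induction R using TensorProduct.induction_on with
    | zero => simp
    | add x y hx hy => simp [hx, hy]
    | tmul p a =>
      simp only [evalAt_tmul, L, L', TensorProduct.equivFinsuppOfBasisRight_apply_tmul_apply]
      rw [← ofReal_smul_eq, ← ofReal_smul_eq, map_smul]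
  apply L.injective
  ext1 i
  refine MvPolynomial.funext_set (fun _ => Set.range ((↑) : ℝ → ℂ))
    (fun _ => Set.infinite_range_of_injective Complex.ofReal_injective) fun z hz => ?_
  choose x hx using fun j => hz j (Set.mem_univ j)
  have hz' : z = toC (WithLp.toLp 2 x) := by ext j; simp [hx]
  rw [← MvPolynomial.aeval_eq_eval, hz', ← hL, ← hL, h]

lemma pairing_isHomogeneous (w : Fin m → ℂ) : (pairing w).IsHomogeneous 1 :=
  MvPolynomial.IsHomogeneous.sum _ _ _ fun j _ => by
    simpa using (MvPolynomial.isHomogeneous_C (Fin m) (w j)).mul (MvPolynomial.isHomogeneous_X ℂ j)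

lemma eval_pairing (w z : Fin m → ℂ) : MvPolynomial.eval z (pairing w) = ∑ j, w j * z j := by
  simp [pairing]

lemma pderiv_pairing (w : Fin m → ℂ) (j : Fin m) :
    MvPolynomial.pderiv j (pairing w) = MvPolynomial.C (w j) := by
  simp only [pairing, map_sum, Derivation.leibniz, MvPolynomial.pderiv_C, smul_eq_mul]
  rw [Finset.sum_eq_single j]
  · simp
  · intro i _ hi; simp [MvPolynomial.pderiv_X_of_ne hi]
  · simp

lemma dirac_pairing_mul (w : Fin m → ℂ) (P : ClPoly m) :
    dirac m (scalarPoly (pairing w) * P) =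
      constPoly m (vec w) * P + scalarPoly (pairing w) * dirac m P := by
  induction P using TensorProduct.induction_on with
  | zero => simp
  | add x y hx hy => rw [mul_add, map_add, hx, hy, map_add, mul_add, mul_add]; abel
  | tmul p a =>
    simp [scalarPoly, vec, pderiv_pairing, TensorProduct.add_tmul, Finset.sum_add_distrib,
      Finset.sum_mul, Finset.mul_sum, mul_comm]

lemma dirac_pairing_pow_mul (w : Fin m → ℂ) (k : ℕ) (P : ClPoly m) :
    dirac m (scalarPoly (pairing w) ^ k * P) =
      (k : ℝ) • (scalarPoly (pairing w) ^ (k - 1) * (constPoly m (vec w) * P)) +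
        scalarPoly (pairing w) ^ k * dirac m P := by
  induction k with
  | zero => simp
  | succ k ih =>
    rw [pow_succ', mul_assoc, dirac_pairing_mul, ih, mul_add, mul_smul_comm, Nat.add_sub_cancel,
      ← mul_assoc (constPoly m (vec w)), ← scalarPoly_pow, scalarPoly_comm, scalarPoly_pow]
    rcases Nat.eq_zero_or_pos k with rfl | hk
    · simp
    · rw [← mul_assoc (scalarPoly (pairing w)) (scalarPoly (pairing w) ^ (k - 1)), ← pow_succ',
        Nat.sub_add_cancel hk, mul_assoc, mul_assoc]
      push_cast
      module

/-- The polynomial `⟨z,v⟩^p ⟨z,w⟩^r c` with a constant `c` on the right. -/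
def formProd (v w : Fin m → ℂ) (p r : ℕ) (c : ComplexCl m) : ClPoly m :=
  scalarPoly (pairing v) ^ p * (scalarPoly (pairing w) ^ r * constPoly m c)

lemma formProd_smul (v w : Fin m → ℂ) (p r : ℕ) (a : ℂ) (c : ComplexCl m) :
    formProd v w p r (a • c) = a • formProd v w p r c := by
  simp only [formProd, constPoly_smul, mul_smul_comm]

lemma formProd_rsmul (v w : Fin m → ℂ) (p r : ℕ) (a : ℝ) (c : ComplexCl m) :
    formProd v w p r (a • c) = a • formProd v w p r c := by
  simp only [formProd, map_smul, mul_smul_comm]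

lemma formProd_mul_constPoly (v w : Fin m → ℂ) (p r : ℕ) (c d : ComplexCl m) :
    formProd v w p r c * constPoly m d = formProd v w p r (c * d) := by
  simp [formProd, mul_assoc]

lemma formProd_add (v w : Fin m → ℂ) (p r : ℕ) (c d : ComplexCl m) :
    formProd v w p r (c + d) = formProd v w p r c + formProd v w p r d := by
  simp [formProd, mul_add]

lemma formProd_mem_homogPoly (v w : Fin m → ℂ) (p r : ℕ) (c : ComplexCl m) :
    formProd v w p r c ∈ homogPoly m (p + r) := by
  rw [formProd, ← scalarPoly_pow, ← scalarPoly_pow]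
  have h1 := scalarPoly_mem_homogPoly ((pairing_isHomogeneous v).pow p)
  have h2 := scalarPoly_mem_homogPoly ((pairing_isHomogeneous w).pow r)
  simpa using mul_mem_homogPoly h1 (mul_mem_homogPoly h2 (constPoly_mem_homogPoly c))

lemma evalAt_formProd (z v w : Fin m → ℂ) (p r : ℕ) (c : ComplexCl m) :
    evalAt z (formProd v w p r c) = ((∑ j, v j * z j) ^ p * (∑ j, w j * z j) ^ r) • c := by
  simp [formProd, evalAt_scalarPoly, eval_pairing, smul_pow, smul_smul]

lemma dirac_formProd (v w : Fin m → ℂ) (p r : ℕ) (c : ComplexCl m) :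
    dirac m (formProd v w p r c) =
      (p : ℝ) • formProd v w (p - 1) r (vec v * c) +
        (r : ℝ) • formProd v w p (r - 1) (vec w * c) := by
  have h0 : dirac m (constPoly m c) = 0 :=
    dirac_eq_zero_of_mem_homogPoly_zero (constPoly_mem_homogPoly c)
  rw [formProd, dirac_pairing_pow_mul, dirac_pairing_pow_mul, h0, mul_zero, add_zero,
    mul_smul_comm, formProd, formProd, map_mul, map_mul, ← mul_assoc (constPoly m (vec v)),
    ← scalarPoly_pow (pairing w) r, scalarPoly_comm, mul_assoc]

variable {v w : Fin m → ℂ}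

/-- If `v` and `w` are null vectors with `⟨v,w⟩ = -2`, then `∂² (⟨z,v⟩^p ⟨z,w⟩^r)` is, up to the
factor `4pr`, a polynomial of the same form. -/
lemma dirac_dirac_formProd (hv : vec v * vec v = 0) (hw : vec w * vec w = 0)
    (hvw : vec v * vec w + vec w * vec v = (4 : ℝ) • (1 : ComplexCl m)) (p r : ℕ)
    (c : ComplexCl m) :
    dirac m (dirac m (formProd v w p r c)) =
      (4 * p * r : ℝ) • formProd v w (p - 1) (r - 1) c := by
  have h : formProd v w (p - 1) (r - 1) (vec w * (vec v * c)) +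
      formProd v w (p - 1) (r - 1) (vec v * (vec w * c)) =
      (4 : ℝ) • formProd v w (p - 1) (r - 1) c := by
    rw [← formProd_add, ← mul_assoc, ← mul_assoc, ← add_mul, add_comm, hvw, smul_mul_assoc,
      one_mul, formProd_rsmul]
  have h0 : ∀ p r, formProd v w p r (0 : ComplexCl m) = 0 := fun p r => by simp [formProd]
  rw [dirac_formProd, map_add, map_smul, map_smul, dirac_formProd, dirac_formProd,
    ← mul_assoc (vec v) (vec v), ← mul_assoc (vec w) (vec w), hv, hw, zero_mul, h0, h0,
    show (4 * p * r : ℝ) = (p * r : ℝ) * 4 by ring, mul_smul, ← h]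
  module

lemma dirac_pow_two_mul_formProd (hv : vec v * vec v = 0) (hw : vec w * vec w = 0)
    (hvw : vec v * vec w + vec w * vec v = (4 : ℝ) • (1 : ComplexCl m)) (p r i : ℕ)
    (c : ComplexCl m) :
    (dirac m ^ (2 * i)) (formProd v w p r c) =
      (4 ^ i * p.descFactorial i * r.descFactorial i : ℝ) • formProd v w (p - i) (r - i) c := by
  induction i with
  | zero => simp
  | succ i ih =>
    rw [show 2 * (i + 1) = 2 * i + 1 + 1 by ring, dirac_pow_succ_apply, dirac_pow_succ_apply, ih,
      map_smul, map_smul, dirac_dirac_formProd hv hw hvw, smul_smul, Nat.descFactorial_succ,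
      Nat.descFactorial_succ, Nat.sub_sub, Nat.sub_sub]
    congr 1
    push_cast
    ring

lemma dirac_pow_two_mul_add_one_formProd (hv : vec v * vec v = 0) (hw : vec w * vec w = 0)
    (hvw : vec v * vec w + vec w * vec v = (4 : ℝ) • (1 : ComplexCl m)) (p r i : ℕ) :
    (dirac m ^ (2 * i + 1)) (formProd v w p r (vec v)) =
      (4 ^ i * p.descFactorial i * r.descFactorial (i + 1) : ℝ) •
        formProd v w (p - i) (r - (i + 1)) (vec w * vec v) := by
  rw [dirac_pow_succ_apply, dirac_pow_two_mul_formProd hv hw hvw, map_smul, dirac_formProd, hv,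
    Nat.descFactorial_succ, Nat.sub_sub]
  have h0 : ∀ p r, formProd v w p r (0 : ComplexCl m) = 0 := fun p r => by simp [formProd]
  rw [h0, smul_zero, zero_add, smul_smul]
  congr 1
  push_cast
  ring

/-! ### Monogenic projection modulo multiples of the vector variable -/

/-- The polynomial `∑ X_j²`. -/
def normSqPoly (m : ℕ) : MvPolynomial (Fin m) ℂ := ∑ j, MvPolynomial.X j ^ 2

lemma normSqPoly_isHomogeneous : (normSqPoly m).IsHomogeneous 2 :=
  MvPolynomial.IsHomogeneous.sum _ _ _ fun j _ => by
    simpa using (MvPolynomial.isHomogeneous_X ℂ j).pow 2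

lemma eval_normSqPoly (x : EuclideanSpace ℝ (Fin m)) :
    MvPolynomial.eval (toC x) (normSqPoly m) = ((‖x‖ ^ 2 : ℝ) : ℂ) := by
  rw [← real_inner_self_eq_norm_sq, ← sum_toC_mul]
  simp [normSqPoly, pow_two]

lemma scalarPoly_normSqPoly : scalarPoly (normSqPoly m) = (-1 : ℝ) • (vecVar m * vecVar m) := by
  apply clPoly_ext
  intro x
  rw [evalAt_scalarPoly, eval_normSqPoly, map_smul, map_mul, evalAt_vecVar, vec_mul_self,
    sum_toC_mul, real_inner_self_eq_norm_sq, ← ofReal_smul_eq, smul_smul]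
  simp

lemma constPoly_vec_mul_vecVar (w : Fin m → ℂ) :
    constPoly m (vec w) * vecVar m =
      (-1 : ℝ) • (vecVar m * constPoly m (vec w)) - (2 : ℝ) • scalarPoly (pairing w) := by
  apply clPoly_ext
  intro x
  have h := vec_mul_vec_add_swap w (toC x)
  rw [map_mul, evalAt_constPoly, evalAt_vecVar, map_sub, map_smul, map_smul, map_mul,
    evalAt_constPoly, evalAt_vecVar, evalAt_scalarPoly, eval_pairing, eq_sub_of_add_eq h]
  module

lemma monoProj_normSqPoly_mul (hm : 1 ≤ m) {n : ℕ} {q : MvPolynomial (Fin m) ℂ}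
    (hq : q.IsHomogeneous n) : monoProj m (n + 2) (scalarPoly (normSqPoly m * q)) = 0 := by
  rw [scalarPoly_mul, scalarPoly_normSqPoly, smul_mul_assoc, map_smul, mul_assoc,
    monoProj_vecVar_mul (l := n + 1) hm, smul_zero]
  rw [add_comm n 1]
  exact mul_mem_homogPoly vecVar_mem_homogPoly (scalarPoly_mem_homogPoly hq)

/-- Under the monogenic projection, `|z|² - ⟨z,w⟩²` acts as `-⟨z,w⟩²`. -/
lemma monoProj_pairing_pow_mul (hm : 1 ≤ m) (w : Fin m → ℂ) (l k : ℕ) :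
    monoProj m (l + 2 * k)
      (scalarPoly (pairing w ^ l * (normSqPoly m - pairing w ^ 2) ^ k)) =
      ((-1) ^ k : ℝ) • monoProj m (l + 2 * k) (scalarPoly (pairing w ^ (l + 2 * k))) := by
  induction k generalizing l with
  | zero => simp
  | succ k ih =>
    have hq : (pairing w ^ l * (normSqPoly m - pairing w ^ 2) ^ k).IsHomogeneous (l + 2 * k) := by
      have h1 := (pairing_isHomogeneous w).pow l
      have h2 := (normSqPoly_isHomogeneous.sub ((pairing_isHomogeneous w).pow 2)).pow k
      simpa using h1.mul h2
    rw [show pairing w ^ l * (normSqPoly m - pairing w ^ 2) ^ (k + 1) =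
      normSqPoly m * (pairing w ^ l * (normSqPoly m - pairing w ^ 2) ^ k) -
        pairing w ^ (l + 2) * (normSqPoly m - pairing w ^ 2) ^ k by ring, scalarPoly_sub, map_sub,
      show l + 2 * (k + 1) = l + 2 * k + 2 by ring, monoProj_normSqPoly_mul hm hq,
      show l + 2 * k + 2 = l + 2 + 2 * k by ring, ih, pow_succ]
    module

lemma monoProj_pairing_pow_mul_vecVar (hm : 1 ≤ m) (w : Fin m → ℂ)
    (hw : vec w * vec w = (-1 : ℝ) • (1 : ComplexCl m)) (l k : ℕ) :
    monoProj m (l + (2 * k + 1))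
      (scalarPoly (pairing w ^ l * (normSqPoly m - pairing w ^ 2) ^ k) *
        (constPoly m (vec w) * (vecVar m - scalarPoly (pairing w) * constPoly m (vec w)))) =
      (-(-1) ^ k : ℝ) •
        monoProj m (l + (2 * k + 1)) (scalarPoly (pairing w ^ (l + (2 * k + 1)))) := by
  have hq : (pairing w ^ l * (normSqPoly m - pairing w ^ 2) ^ k).IsHomogeneous (l + 2 * k) := by
    have h1 := (pairing_isHomogeneous w).pow l
    have h2 := (normSqPoly_isHomogeneous.sub ((pairing_isHomogeneous w).pow 2)).pow k
    simpa using h1.mul h2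
  have h1 : constPoly m (vec w) * (vecVar m - scalarPoly (pairing w) * constPoly m (vec w)) =
      (-1 : ℝ) • (vecVar m * constPoly m (vec w)) - scalarPoly (pairing w) := by
    rw [mul_sub, constPoly_vec_mul_vecVar, ← mul_assoc, scalarPoly_comm, mul_assoc, ← map_mul, hw,
      map_smul, map_one, mul_smul_comm, mul_one]
    module
  rw [h1, mul_sub, ← scalarPoly_mul, mul_smul_comm, ← mul_assoc, ← scalarPoly_comm, mul_assoc,
    map_sub, map_smul, show l + (2 * k + 1) = l + 2 * k + 1 by ring, monoProj_vecVar_mul hm,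
    show pairing w ^ l * (normSqPoly m - pairing w ^ 2) ^ k * pairing w =
      pairing w ^ (l + 1) * (normSqPoly m - pairing w ^ 2) ^ k by ring,
    show l + 2 * k + 1 = l + 1 + 2 * k by ring, monoProj_pairing_pow_mul hm]
  · module
  · simpa using mul_mem_homogPoly (scalarPoly_mem_homogPoly hq) (constPoly_mem_homogPoly (vec w))

end Forms

/-! ### The null vectors `τ` and `τ†` -/

section Frames

variable {m : ℕ}

/-- Real vectors as elements of `ℂ_m`. -/
def realVec (m : ℕ) : EuclideanSpace ℝ (Fin m) →ₗ[ℝ] ComplexCl m where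
  toFun x := vec (toC x)
  map_add' x y := by
    rw [← vec_add]; congr 1; ext j; simp [toC]
  map_smul' c x := by
    rw [RingHom.id_apply, ← ofReal_smul_eq c (vec (toC x)), ← vec_smul]; congr 1; ext j; simp [toC]

lemma vec_toC (x : EuclideanSpace ℝ (Fin m)) : vec (toC x) = realVec m x := rfl

lemma realVec_mul_add_swap (x y : EuclideanSpace ℝ (Fin m)) :
    realVec m x * realVec m y + realVec m y * realVec m x =
      (-2 * inner ℝ x y : ℝ) • (1 : ComplexCl m) := by
  rw [← vec_toC, ← vec_toC, vec_mul_vec_add_swap, sum_toC_mul, ← ofReal_smul_eq]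
  push_cast; rfl

lemma realVec_mul_self (x : EuclideanSpace ℝ (Fin m)) :
    realVec m x * realVec m x = (-‖x‖ ^ 2 : ℝ) • (1 : ComplexCl m) := by
  rw [← vec_toC, vec_mul_self, sum_toC_mul, real_inner_self_eq_norm_sq, ← ofReal_smul_eq]
  push_cast; rfl

lemma realVec_mul_swap {x y : EuclideanSpace ℝ (Fin m)} (h : inner ℝ x y = 0) :
    realVec m y * realVec m x = (-1 : ℝ) • (realVec m x * realVec m y) := by
  have := realVec_mul_add_swap x y
  rw [h, mul_zero, zero_smul] at this
  rw [eq_comm, ← sub_eq_zero, ← neg_eq_zero, ← this]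
  module

/-- `⟨x, τ⟩` for `τ = t + i s`. -/
def tauForm (x t s : EuclideanSpace ℝ (Fin m)) : ℂ :=
  ((inner ℝ x t : ℝ) : ℂ) + Complex.I * ((inner ℝ x s : ℝ) : ℂ)

/-- `⟨x, τ†⟩` for `τ† = -t + i s`. -/
def tauDagForm (x t s : EuclideanSpace ℝ (Fin m)) : ℂ :=
  -((inner ℝ x t : ℝ) : ℂ) + Complex.I * ((inner ℝ x s : ℝ) : ℂ)

lemma conj_tauForm (x t s : EuclideanSpace ℝ (Fin m)) :
    starRingEnd ℂ (tauForm x t s) = -tauDagForm x t s := by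
  simp [tauForm, tauDagForm]; ring

lemma conj_tauDagForm (x t s : EuclideanSpace ℝ (Fin m)) :
    starRingEnd ℂ (tauDagForm x t s) = -tauForm x t s := by
  simp [tauForm, tauDagForm]; ring

@[fun_prop] lemma continuous_tauForm (x : EuclideanSpace ℝ (Fin m)) :
    Continuous (fun z : EuclideanSpace ℝ (Fin m) × EuclideanSpace ℝ (Fin m) =>
      tauForm x z.1 z.2) := by
  unfold tauForm; fun_prop

@[fun_prop] lemma continuous_tauDagForm (x : EuclideanSpace ℝ (Fin m)) :
    Continuous (fun z : EuclideanSpace ℝ (Fin m) × EuclideanSpace ℝ (Fin m) =>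
      tauDagForm x z.1 z.2) := by
  unfold tauDagForm; fun_prop

lemma tau_eq (t s : EuclideanSpace ℝ (Fin m)) : tau t s = toC t + Complex.I • toC s := by
  ext j; simp [tau]

lemma tauDag_eq (t s : EuclideanSpace ℝ (Fin m)) :
    tauDag t s = (-1 : ℂ) • toC t + Complex.I • toC s := by
  ext j; simp [tauDag]

lemma sum_tau_mul (x t s : EuclideanSpace ℝ (Fin m)) :
    ∑ j, tau t s j * toC x j = tauForm x t s := by
  rw [tauForm, ← sum_toC_mul, ← sum_toC_mul, Finset.mul_sum, ← Finset.sum_add_distrib]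
  refine Finset.sum_congr rfl fun j _ => ?_
  rw [tau_eq]; simp; ring

lemma sum_tauDag_mul (x t s : EuclideanSpace ℝ (Fin m)) :
    ∑ j, tauDag t s j * toC x j = tauDagForm x t s := by
  rw [tauDagForm, ← sum_toC_mul, ← sum_toC_mul, Finset.mul_sum, ← Finset.sum_neg_distrib,
    ← Finset.sum_add_distrib]
  refine Finset.sum_congr rfl fun j _ => ?_
  rw [tauDag_eq]; simp; ring

lemma vec_tau (t s : EuclideanSpace ℝ (Fin m)) :
    vec (tau t s) = realVec m t + Complex.I • realVec m s := by
  rw [tau_eq, vec_add, vec_smul, vec_toC, vec_toC]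

lemma vec_tauDag (t s : EuclideanSpace ℝ (Fin m)) :
    vec (tauDag t s) = (-1 : ℂ) • realVec m t + Complex.I • realVec m s := by
  rw [tauDag_eq, vec_add, vec_smul, vec_smul, vec_toC, vec_toC]

lemma dagger_vec_tau (t s : EuclideanSpace ℝ (Fin m)) :
    dagger m (vec (tau t s)) = vec (tauDag t s) := by
  rw [dagger_vec]
  congr 1
  ext j
  simp [tau, tauDag]; ring

lemma dagger_vec_tauDag (t s : EuclideanSpace ℝ (Fin m)) :
    dagger m (vec (tauDag t s)) = vec (tau t s) := by
  rw [← dagger_vec_tau, dagger_dagger]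

variable {t s : EuclideanSpace ℝ (Fin m)}

lemma vec_tau_mul_self (ht : ‖t‖ = 1) (hs : ‖s‖ = 1) (hts : inner ℝ t s = 0) :
    vec (tau t s) * vec (tau t s) = 0 := by
  have h : ∑ j, tau t s j * tau t s j = tauForm t t s + Complex.I * tauForm s t s := by
    rw [← sum_tau_mul, ← sum_tau_mul, Finset.mul_sum, ← Finset.sum_add_distrib]
    refine Finset.sum_congr rfl fun j _ => ?_
    nth_rw 2 [tau_eq]
    simp; ring
  rw [vec_mul_self, h, tauForm, tauForm, real_inner_comm t s, hts, real_inner_self_eq_norm_sq,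
    real_inner_self_eq_norm_sq, ht, hs]
  simp

lemma vec_tauDag_mul_self (ht : ‖t‖ = 1) (hs : ‖s‖ = 1) (hts : inner ℝ t s = 0) :
    vec (tauDag t s) * vec (tauDag t s) = 0 := by
  have h := congrArg (dagger m) (vec_tau_mul_self ht hs hts)
  rwa [dagger_mul, dagger_vec_tau, map_zero] at h

lemma vec_tau_mul_vec_tauDag (ht : ‖t‖ = 1) (hs : ‖s‖ = 1) (hts : inner ℝ t s = 0) :
    vec (tau t s) * vec (tauDag t s) =
      (2 : ℂ) • (1 : ComplexCl m) + (2 * Complex.I) • (realVec m t * realVec m s) := by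
  rw [vec_tau, vec_tauDag]
  simp only [mul_add, add_mul, smul_mul_assoc, mul_smul_comm, realVec_mul_self, ht, hs,
    realVec_mul_swap hts, smul_smul, ← ofReal_smul_eq]
  push_cast
  match_scalars
  · linear_combination -Complex.I_sq
  · ring

lemma vec_tau_mul_add_swap (ht : ‖t‖ = 1) (hs : ‖s‖ = 1) (hts : inner ℝ t s = 0) :
    vec (tau t s) * vec (tauDag t s) + vec (tauDag t s) * vec (tau t s) =
      (4 : ℝ) • (1 : ComplexCl m) := by
  rw [vec_tau, vec_tauDag]
  simp only [mul_add, add_mul, smul_mul_assoc, mul_smul_comm, realVec_mul_self, ht, hs,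
    realVec_mul_swap hts, smul_smul, ← ofReal_smul_eq]
  push_cast
  match_scalars
  · linear_combination -2 * Complex.I_sq
  · ring

/-! ### Consequences of invariance under reflections -/

/-- The reflection in the hyperplane orthogonal to `w`. -/
abbrev hypRefl (w : EuclideanSpace ℝ (Fin m)) :
    EuclideanSpace ℝ (Fin m) ≃ₗᵢ[ℝ] EuclideanSpace ℝ (Fin m) :=
  (Submodule.span ℝ {w})ᗮ.reflection

lemma inner_hypRefl (w x y : EuclideanSpace ℝ (Fin m)) :
    inner ℝ x (hypRefl w y) = inner ℝ (hypRefl w x) y := by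
  conv_lhs => rw [← (hypRefl w).inner_map_map, Submodule.reflection_reflection]

lemma hypRefl_of_inner_eq_zero {w x : EuclideanSpace ℝ (Fin m)} (h : inner ℝ w x = 0) :
    hypRefl w x = x :=
  Submodule.reflection_mem_subspace_eq_self (Submodule.mem_orthogonal_singleton_iff_inner_right.2 h)

lemma hypRefl_self (w : EuclideanSpace ℝ (Fin m)) : hypRefl w w = -w :=
  Submodule.reflection_orthogonalComplement_singleton_eq_neg w

/-- A function that changes sign under an isometry has mean zero. -/
lemma HasMean.eq_zero_of_neg {f : EuclideanSpace ℝ (Fin m) → EuclideanSpace ℝ (Fin m) → ℂ} {c : ℂ}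
    (h : HasMean f c) (g : EuclideanSpace ℝ (Fin m) ≃ₗᵢ[ℝ] EuclideanSpace ℝ (Fin m))
    (hg : ∀ t s, f (g t) (g s) = -f t s) : c = 0 := by
  have h1 := h.comp_isometry g
  simp only [hg] at h1
  have h2 : HasMean (fun t s => -f t s) (-c) := by simpa using h.smul (-1)
  have := h1.unique h2
  exact self_eq_neg.1 this

lemma exists_orthonormalBasis_pair {u e : EuclideanSpace ℝ (Fin m)} (hu : ‖u‖ = 1) (he : ‖e‖ = 1)
    (hue : inner ℝ u e = 0) :
    ∃ (b : OrthonormalBasis (Fin m) ℝ (EuclideanSpace ℝ (Fin m))) (i j : Fin m),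
      i ≠ j ∧ b i = u ∧ b j = e := by
  have hne : u ≠ e := by
    rintro rfl
    rw [real_inner_self_eq_norm_sq, hu] at hue
    norm_num at hue
  have ho : Orthonormal ℝ (Subtype.val : ({u, e} : Set (EuclideanSpace ℝ (Fin m))) → EuclideanSpace ℝ (Fin m)) := by
    constructor
    · rintro ⟨x, rfl | rfl⟩ <;> assumption
    · rintro ⟨x, rfl | rfl⟩ ⟨y, rfl | rfl⟩ hxy
      · exact absurd rfl hxy
      · exact hue
      · rw [real_inner_comm]; exact hue
      · exact absurd rfl hxy
  obtain ⟨S, b, hS, hb⟩ := ho.exists_orthonormalBasis_extension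
  have hcard : Fintype.card S = Fintype.card (Fin m) := by
    rw [← Module.finrank_eq_card_basis b.toBasis, finrank_euclideanSpace]
  let ε := Fintype.equivOfCardEq hcard
  refine ⟨b.reindex ε, ε ⟨u, hS (by simp)⟩, ε ⟨e, hS (by simp)⟩, ?_, ?_, ?_⟩
  · simpa using hne
  · simp [hb]
  · simp [hb]

lemma realVec_eq_sum (b : OrthonormalBasis (Fin m) ℝ (EuclideanSpace ℝ (Fin m)))
    (x : EuclideanSpace ℝ (Fin m)) :
    realVec m x = ∑ i, ((inner ℝ (b i) x : ℝ) : ℂ) • realVec m (b i) := by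
  conv_lhs => rw [← b.sum_repr' x, map_sum]
  simp only [map_smul, ofReal_smul_eq]

lemma hypRefl_basis_ne (b : OrthonormalBasis (Fin m) ℝ (EuclideanSpace ℝ (Fin m))) {i j : Fin m}
    (h : i ≠ j) : hypRefl (b i) (b j) = b j :=
  hypRefl_of_inner_eq_zero (b.orthonormal.2 h)

/-- The mean of a bivector-valued function `f(t,s) t s`, where `f` is invariant under the
reflections that fix `u` and `e`, is a multiple of the bivector `u e`. -/
lemma hasMean_smul_bivector (hm : 1 ≤ m) {u e : EuclideanSpace ℝ (Fin m)} (hu : ‖u‖ = 1)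
    (he : ‖e‖ = 1) (hue : inner ℝ u e = 0)
    {f : EuclideanSpace ℝ (Fin m) → EuclideanSpace ℝ (Fin m) → ℂ}
    (hf : Continuous (Function.uncurry f))
    (hinv : ∀ w, inner ℝ w u = 0 → inner ℝ w e = 0 → ∀ t s, f (hypRefl w t) (hypRefl w s) = f t s)
    {D : ℂ} (hD : HasMean (fun t s => f t s *
      (inner ℝ u t * inner ℝ e s - inner ℝ e t * inner ℝ u s : ℝ)) D) :
    HasMean (fun t s => f t s • (realVec m t * realVec m s)) (D • (realVec m u * realVec m e)) := by
  obtain ⟨b, i0, i1, h01, rfl, rfl⟩ := exists_orthonormalBasis_pair hu he hue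
  have hcont : ∀ i j, Continuous (Function.uncurry fun t s =>
      f t s * (inner ℝ (b i) t * inner ℝ (b j) s : ℝ)) := by
    intro i j
    refine hf.mul ?_
    fun_prop
  choose Y hY using fun i j => exists_hasMean_of_continuous hm _ (hcont i j)
  have hY0 : ∀ i j, i ≠ j → ¬ (i = i0 ∧ j = i1) → ¬ (i = i1 ∧ j = i0) → Y i j = 0 := by
    intro i j hij h1 h2
    -- one of the two indices is neither `i0` nor `i1`, and it occurs once
    by_cases hi : i = i0 ∨ i = i1
    · have hj0 : j ≠ i0 := by rintro rfl; rcases hi with rfl | rfl <;> simp_all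
      have hj1 : j ≠ i1 := by rintro rfl; rcases hi with rfl | rfl <;> simp_all
      refine (hY i j).eq_zero_of_neg (hypRefl (b j)) fun t s => ?_
      rw [hinv _ (b.orthonormal.2 hj0) (b.orthonormal.2 hj1), inner_hypRefl, inner_hypRefl,
        hypRefl_self, hypRefl_basis_ne b hij.symm, inner_neg_left]
      push_cast; ring
    · push Not at hi
      refine (hY i j).eq_zero_of_neg (hypRefl (b i)) fun t s => ?_
      rw [hinv _ (b.orthonormal.2 hi.1) (b.orthonormal.2 hi.2), inner_hypRefl, inner_hypRefl,
        hypRefl_self, hypRefl_basis_ne b hij, inner_neg_left]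
      push_cast; ring
  have hDY : D = Y i0 i1 - Y i1 i0 := by
    refine hD.unique ?_
    have := (hY i0 i1).add ((hY i1 i0).smul (-1))
    refine (by simpa [sub_eq_add_neg] using this : HasMean _ (Y i0 i1 - Y i1 i0)).congr ?_
    intro t s _ _ _
    push_cast; ring
  have hsum := HasMean.sum Finset.univ fun i _ => HasMean.sum Finset.univ fun j _ =>
    ((hY i j).smul_const (if i = j then 0 else realVec m (b i) * realVec m (b j)))
  have hval : ∑ i, ∑ j, Y i j • (if i = j then (0 : ComplexCl m)
      else realVec m (b i) * realVec m (b j)) = D • (realVec m (b i0) * realVec m (b i1)) := by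
    rw [Finset.sum_eq_add i0 i1 h01]
    · rw [Finset.sum_eq_single i1, Finset.sum_eq_single i0, if_neg h01, if_neg h01.symm,
        realVec_mul_swap (b.orthonormal.2 h01), hDY, ← ofReal_smul_eq]
      · push_cast; module
      · intro j _ hj
        by_cases h : i1 = j
        · simp [h]
        · rw [hY0 i1 j h (by simp [h01.symm]) (by simp [hj]), zero_smul]
      · simp
      · intro j _ hj
        by_cases h : i0 = j
        · simp [h]
        · rw [hY0 i0 j h (by simp [hj]) (by simp [h01]), zero_smul]
      · simp
    · rintro i - ⟨hi0, hi1⟩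
      refine Finset.sum_eq_zero fun j _ => ?_
      by_cases h : i = j
      · simp [h]
      · rw [hY0 i j h (by simp [hi0]) (by simp [hi1]), zero_smul]
    · simp
    · simp
  rw [hval] at hsum
  refine hsum.congr fun t s _ _ hts => ?_
  -- the diagonal terms add up to a multiple of `⟨t, s⟩ = 0`
  have hdiag : ∑ i, (f t s * (inner ℝ (b i) t * inner ℝ (b i) s : ℝ)) •
      (realVec m (b i) * realVec m (b i)) = 0 := by
    have h1 : ∀ i, realVec m (b i) * realVec m (b i) = (-1 : ℂ) • (1 : ComplexCl m) := by
      intro i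
      rw [realVec_mul_self, b.orthonormal.1 i, ← ofReal_smul_eq]
      norm_num
    simp only [h1, ← Finset.sum_smul, ← Finset.mul_sum, ← Complex.ofReal_sum]
    have h2 : ∑ i, inner ℝ (b i) t * inner ℝ (b i) s = inner ℝ t s := by
      rw [← b.sum_inner_mul_inner t s]
      exact Finset.sum_congr rfl fun i _ => by rw [real_inner_comm]
    rw [h2, hts]
    simp
  suffices h : f t s • (realVec m t * realVec m s) =
      ∑ i, ∑ j, (f t s * (inner ℝ (b i) t * inner ℝ (b j) s : ℝ)) •
        (if i = j then 0 else realVec m (b i) * realVec m (b j)) +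
      ∑ i, (f t s * (inner ℝ (b i) t * inner ℝ (b i) s : ℝ)) •
        (realVec m (b i) * realVec m (b i)) by
    rw [h, hdiag, add_zero]
  rw [realVec_eq_sum b t, realVec_eq_sum b s, Finset.sum_mul_sum, Finset.smul_sum,
    ← Finset.sum_add_distrib]
  refine Finset.sum_congr rfl fun i _ => ?_
  have h3 : ∑ j, (f t s * (inner ℝ (b i) t * inner ℝ (b j) s : ℝ)) •
      (if i = j then (realVec m (b i) * realVec m (b j)) else 0) =
      (f t s * (inner ℝ (b i) t * inner ℝ (b i) s : ℝ)) • (realVec m (b i) * realVec m (b i)) := by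
    rw [Finset.sum_eq_single i]
    · simp
    · intro j _ hj; simp [Ne.symm hj]
    · simp
  rw [← h3, ← Finset.sum_add_distrib, Finset.smul_sum]
  refine Finset.sum_congr rfl fun j _ => ?_
  rw [← smul_add, smul_mul_assoc, mul_smul_comm, smul_smul, smul_smul]
  push_cast
  rw [mul_assoc]
  congr 1
  split_ifs <;> simp

/-- The mean of a vector-valued function `f(t,s) (c t + d s)`, where `f` is invariant under the
reflections that fix `u`, is a multiple of `u`. -/
lemma hasMean_smul_vector (hm : 1 ≤ m) {u : EuclideanSpace ℝ (Fin m)} (hu : ‖u‖ = 1)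
    {f : EuclideanSpace ℝ (Fin m) → EuclideanSpace ℝ (Fin m) → ℂ}
    (hf : Continuous (Function.uncurry f))
    (hinv : ∀ w, inner ℝ w u = 0 → ∀ t s, f (hypRefl w t) (hypRefl w s) = f t s) (c d : ℂ)
    {D : ℂ} (hD : HasMean (fun t s => f t s *
      (c * (inner ℝ u t : ℝ) + d * (inner ℝ u s : ℝ))) D) :
    HasMean (fun t s => f t s • (c • realVec m t + d • realVec m s)) (D • realVec m u) := by
  obtain ⟨b, i0, rfl⟩ : ∃ (b : OrthonormalBasis (Fin m) ℝ (EuclideanSpace ℝ (Fin m))) (i : Fin m),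
      b i = u := by
    have i0 : Fin m := ⟨0, hm⟩
    obtain ⟨b, hb⟩ := Orthonormal.exists_orthonormalBasis_extension_of_card_eq
      (𝕜 := ℝ) (E := EuclideanSpace ℝ (Fin m)) (ι := Fin m) (by simp) (v := fun _ => u) (s := {i0})
      ⟨fun _ => hu, fun i j hij => absurd (Subsingleton.elim i j) hij⟩
    exact ⟨b, i0, hb i0 rfl⟩
  have hcont : ∀ i, Continuous (Function.uncurry fun t s =>
      f t s * (c * (inner ℝ (b i) t : ℝ) + d * (inner ℝ (b i) s : ℝ))) := by
    intro i
    refine hf.mul ?_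
    fun_prop
  choose Y hY using fun i => exists_hasMean_of_continuous hm _ (hcont i)
  have hY0 : ∀ i, i ≠ i0 → Y i = 0 := by
    intro i hi
    refine (hY i).eq_zero_of_neg (hypRefl (b i)) fun t s => ?_
    rw [hinv _ (b.orthonormal.2 hi), inner_hypRefl, inner_hypRefl, hypRefl_self, inner_neg_left,
      inner_neg_left]
    push_cast; ring
  have hsum := HasMean.sum Finset.univ fun i _ => ((hY i).smul_const (realVec m (b i)))
  rw [Finset.sum_eq_single i0 (fun i _ hi => by rw [hY0 i hi, zero_smul]) (by simp),
    ← hD.unique (hY i0)] at hsum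
  refine hsum.congr fun t s _ _ _ => ?_
  rw [realVec_eq_sum b t, realVec_eq_sum b s, Finset.smul_sum, Finset.smul_sum,
    ← Finset.sum_add_distrib, Finset.smul_sum]
  refine Finset.sum_congr rfl fun i _ => ?_
  module

end Frames

/-! ### Means of zonal integrands -/

section Zonal

variable {m : ℕ}

lemma tauForm_hypRefl (w x t s : EuclideanSpace ℝ (Fin m)) :
    tauForm x (hypRefl w t) (hypRefl w s) = tauForm (hypRefl w x) t s := by
  simp only [tauForm, inner_hypRefl]

lemma tauDagForm_hypRefl (w x t s : EuclideanSpace ℝ (Fin m)) :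
    tauDagForm x (hypRefl w t) (hypRefl w s) = tauDagForm (hypRefl w x) t s := by
  simp only [tauDagForm, inner_hypRefl]

lemma tauForm_combo (a b : ℝ) (x y t s : EuclideanSpace ℝ (Fin m)) :
    tauForm (a • x + b • y) t s = a * tauForm x t s + b * tauForm y t s := by
  simp only [tauForm, inner_add_left, real_inner_smul_left]; push_cast; ring

lemma tauDagForm_combo (a b : ℝ) (x y t s : EuclideanSpace ℝ (Fin m)) :
    tauDagForm (a • x + b • y) t s = a * tauDagForm x t s + b * tauDagForm y t s := by
  simp only [tauDagForm, inner_add_left, real_inner_smul_left]; push_cast; ring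

lemma tauForm_neg (x t s : EuclideanSpace ℝ (Fin m)) : tauForm (-x) t s = -tauForm x t s := by
  simp only [tauForm, inner_neg_left]; push_cast; ring

lemma tauDagForm_neg (x t s : EuclideanSpace ℝ (Fin m)) :
    tauDagForm (-x) t s = -tauDagForm x t s := by
  simp only [tauDagForm, inner_neg_left]; push_cast; ring

/-- Functions of `(t, s)` that are continuous and invariant under the reflections that fix `u`. -/
structure IsZonal (u : EuclideanSpace ℝ (Fin m))
    (W : EuclideanSpace ℝ (Fin m) → EuclideanSpace ℝ (Fin m) → ℂ) : Prop where
  continuous : Continuous (Function.uncurry W)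
  invariant : ∀ w, inner ℝ w u = 0 → ∀ t s, W (hypRefl w t) (hypRefl w s) = W t s

lemma IsZonal.mul {u : EuclideanSpace ℝ (Fin m)}
    {W W' : EuclideanSpace ℝ (Fin m) → EuclideanSpace ℝ (Fin m) → ℂ} (h : IsZonal u W)
    (h' : IsZonal u W') : IsZonal u (fun t s => W t s * W' t s) :=
  ⟨h.continuous.mul h'.continuous, fun w hw t s => by rw [h.invariant w hw, h'.invariant w hw]⟩

lemma isZonal_const (u : EuclideanSpace ℝ (Fin m)) (c : ℂ) : IsZonal u (fun _ _ => c) :=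
  ⟨continuous_const, fun _ _ _ _ => rfl⟩

lemma IsZonal.pow {u : EuclideanSpace ℝ (Fin m)}
    {W : EuclideanSpace ℝ (Fin m) → EuclideanSpace ℝ (Fin m) → ℂ} (h : IsZonal u W) (k : ℕ) :
    IsZonal u (fun t s => W t s ^ k) :=
  ⟨h.continuous.pow k, fun w hw t s => by rw [h.invariant w hw]⟩

lemma isZonal_tauForm (u : EuclideanSpace ℝ (Fin m)) : IsZonal u (tauForm u) :=
  ⟨continuous_tauForm u, fun w hw t s => by rw [tauForm_hypRefl, hypRefl_of_inner_eq_zero hw]⟩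

lemma isZonal_tauDagForm (u : EuclideanSpace ℝ (Fin m)) : IsZonal u (tauDagForm u) :=
  ⟨continuous_tauDagForm u, fun w hw t s => by
    rw [tauDagForm_hypRefl, hypRefl_of_inner_eq_zero hw]⟩

lemma exists_unit_perp (hm : 2 ≤ m) (u : EuclideanSpace ℝ (Fin m)) :
    ∃ e : EuclideanSpace ℝ (Fin m), ‖e‖ = 1 ∧ inner ℝ u e = 0 := by
  have h1 := (Submodule.span ℝ {u}).finrank_add_finrank_orthogonal
  rw [finrank_euclideanSpace, Fintype.card_fin] at h1
  have h2 : Module.finrank ℝ (Submodule.span ℝ {u}) ≤ 1 := by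
    simpa using finrank_span_le_card (R := ℝ) ({u} : Set (EuclideanSpace ℝ (Fin m)))
  have : Nontrivial (Perp u) := Module.nontrivial_of_finrank_pos (R := ℝ) (by
    change _ + Module.finrank ℝ (Perp u) = m at h1; omega)
  obtain ⟨e, he⟩ := exists_norm_eq (Perp u) zero_le_one
  exact ⟨e, he, Submodule.mem_orthogonal_singleton_iff_inner_right.1 e.2⟩

lemma exists_plane_decomp (hm : 2 ≤ m) {u : EuclideanSpace ℝ (Fin m)} (hu : ‖u‖ = 1)
    (x : EuclideanSpace ℝ (Fin m)) :
    ∃ (e : EuclideanSpace ℝ (Fin m)) (c : ℝ), ‖e‖ = 1 ∧ inner ℝ u e = 0 ∧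
      x = inner ℝ u x • u + c • e := by
  by_cases h : x - inner ℝ u x • u = 0
  · obtain ⟨e, he, hue⟩ := exists_unit_perp hm u
    exact ⟨e, 0, he, hue, by rw [zero_smul, add_zero]; exact sub_eq_zero.1 h⟩
  · have h' : ‖x - inner ℝ u x • u‖ ≠ 0 := norm_ne_zero_iff.2 h
    refine ⟨‖x - inner ℝ u x • u‖⁻¹ • (x - inner ℝ u x • u), ‖x - inner ℝ u x • u‖, ?_, ?_, ?_⟩
    · rw [norm_smul, norm_inv, norm_norm, inv_mul_cancel₀ h']
    · rw [real_inner_smul_right, inner_sub_right, real_inner_smul_right,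
        real_inner_self_eq_norm_sq, hu]
      simp
    · rw [smul_smul, mul_inv_cancel₀ h', one_smul]
      abel

/-- The product of a zonal function with a monomial in `⟨e, τ⟩` and `⟨e, τ†⟩`. -/
def frameTerm (W : EuclideanSpace ℝ (Fin m) → EuclideanSpace ℝ (Fin m) → ℂ)
    (e : EuclideanSpace ℝ (Fin m)) (i l : ℕ) (t s : EuclideanSpace ℝ (Fin m)) : ℂ :=
  W t s * (tauForm e t s ^ i * tauDagForm e t s ^ l)

variable {u : EuclideanSpace ℝ (Fin m)}
  {W : EuclideanSpace ℝ (Fin m) → EuclideanSpace ℝ (Fin m) → ℂ}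

lemma continuous_frameTerm (hW : IsZonal u W) (e : EuclideanSpace ℝ (Fin m)) (i l : ℕ) :
    Continuous (Function.uncurry (frameTerm W e i l)) :=
  hW.continuous.mul (((continuous_tauForm e).pow i).mul ((continuous_tauDagForm e).pow l))

lemma frameTerm_hypRefl (hW : IsZonal u W) (e : EuclideanSpace ℝ (Fin m)) (i l : ℕ)
    {w : EuclideanSpace ℝ (Fin m)} (hw : inner ℝ w u = 0) (t s : EuclideanSpace ℝ (Fin m)) :
    frameTerm W e i l (hypRefl w t) (hypRefl w s) = frameTerm W (hypRefl w e) i l t s := by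
  rw [frameTerm, hW.invariant w hw, tauForm_hypRefl, tauDagForm_hypRefl, frameTerm]

lemma frameTerm_neg (e : EuclideanSpace ℝ (Fin m)) (i l : ℕ) (t s : EuclideanSpace ℝ (Fin m)) :
    frameTerm W (-e) i l t s = (-1) ^ (i + l) * frameTerm W e i l t s := by
  rw [frameTerm, tauForm_neg, tauDagForm_neg, neg_pow, neg_pow (tauDagForm e t s), frameTerm,
    pow_add]
  ring

/-- The mean of a frame term does not depend on the unit vector `e` orthogonal to `u`, because
the reflections that fix `u` act transitively on these vectors; it vanishes in odd degree. -/
lemma exists_hasMean_frameTerm (hm : 2 ≤ m) (hW : IsZonal u W) (i l : ℕ) :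
    ∃ c : ℂ, (¬ Even (i + l) → c = 0) ∧
      ∀ e, ‖e‖ = 1 → inner ℝ u e = 0 → HasMean (frameTerm W e i l) c := by
  obtain ⟨e0, he0, hue0⟩ := exists_unit_perp hm u
  obtain ⟨c, hc⟩ := exists_hasMean_of_continuous (by omega) _ (continuous_frameTerm hW e0 i l)
  refine ⟨c, fun h => hc.eq_zero_of_neg (hypRefl e0) fun t s => ?_, fun e he hue => ?_⟩
  · rw [frameTerm_hypRefl hW _ _ _ (by rwa [real_inner_comm]), hypRefl_self, frameTerm_neg,
      (Nat.not_even_iff_odd.1 h).neg_one_pow, neg_one_mul]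
  · refine (hc.comp_isometry (hypRefl (e0 - e))).congr fun t s _ _ _ => ?_
    rw [frameTerm_hypRefl hW _ _ _ (by rw [inner_sub_left, real_inner_comm, hue0,
      real_inner_comm, hue, sub_zero]), hypRefl, Submodule.reflection_sub (by rw [he0, he])]

lemma exists_hasMean_frameTerm_bivector (hm : 2 ≤ m) (hu : ‖u‖ = 1) (hW : IsZonal u W) (i l : ℕ) :
    ∃ d : ℂ, (Even (i + l) → d = 0) ∧ ∀ e, ‖e‖ = 1 → inner ℝ u e = 0 →
      HasMean (fun t s => frameTerm W e i l t s • (realVec m t * realVec m s))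
        (d • (realVec m u * realVec m e)) := by
  obtain ⟨e0, he0, hue0⟩ := exists_unit_perp hm u
  have hcont : Continuous (Function.uncurry fun t s => frameTerm W e0 i l t s *
      (inner ℝ u t * inner ℝ e0 s - inner ℝ e0 t * inner ℝ u s : ℝ)) := by
    refine (continuous_frameTerm hW e0 i l).mul ?_
    fun_prop
  obtain ⟨d, hd⟩ := exists_hasMean_of_continuous (by omega) _ hcont
  refine ⟨d, fun h => hd.eq_zero_of_neg (hypRefl e0) fun t s => ?_, fun e he hue => ?_⟩
  · rw [frameTerm_hypRefl hW _ _ _ (by rwa [real_inner_comm]), hypRefl_self, frameTerm_neg,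
      h.neg_one_pow, one_mul, inner_hypRefl, inner_hypRefl, inner_hypRefl, inner_hypRefl,
      hypRefl_self, hypRefl_of_inner_eq_zero (by rwa [real_inner_comm]), inner_neg_left,
      inner_neg_left]
    push_cast; ring
  · have hperp : inner ℝ (e0 - e) u = 0 := by
      rw [inner_sub_left, real_inner_comm, hue0, real_inner_comm, hue, sub_zero]
    refine hasMean_smul_bivector (by omega) hu he hue (continuous_frameTerm hW e i l) ?_ ?_
    · intro w hwu hwe t s
      rw [frameTerm_hypRefl hW _ _ _ hwu, hypRefl_of_inner_eq_zero hwe]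
    · refine (hd.comp_isometry (hypRefl (e0 - e))).congr fun t s _ _ _ => ?_
      rw [frameTerm_hypRefl hW _ _ _ hperp, inner_hypRefl, inner_hypRefl, inner_hypRefl,
        inner_hypRefl, hypRefl_of_inner_eq_zero hperp,
        show hypRefl (e0 - e) e0 = e from Submodule.reflection_sub (by rw [he0, he])]

/-- Evaluation at a point, as a complex linear map. -/
def evalLin (z : Fin m → ℂ) : ClPoly m →ₗ[ℂ] ComplexCl m where
  toFun := evalAt z
  map_add' := map_add _
  map_smul' := evalAt_smul z

/-- The monogenic projection, as a complex linear map. -/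
def monoProjLin (m n : ℕ) : ClPoly m →ₗ[ℂ] ClPoly m where
  toFun := monoProj m n
  map_add' := map_add _
  map_smul' := monoProj_smul n

lemma vec_mem_contFun {w : EuclideanSpace ℝ (Fin m) → EuclideanSpace ℝ (Fin m) → Fin m → ℂ}
    (hw : ∀ j, Continuous fun z : EuclideanSpace ℝ (Fin m) × EuclideanSpace ℝ (Fin m) =>
      w z.1 z.2 j) : (fun t s => vec (w t s)) ∈ contFun m (ComplexCl m) := by
  have : (fun t s => vec (w t s)) =
      ∑ j, fun t s => w t s j • ((1 : ℂ) ⊗ₜ[ℝ] e j : ComplexCl m) := by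
    ext1 t; ext1 s
    simp [vec, TensorProduct.smul_tmul']
  rw [this]
  exact Submodule.sum_mem _ fun j _ => smul_mem_contFun (hw j) _

lemma pairing_mem_contFun {w : EuclideanSpace ℝ (Fin m) → EuclideanSpace ℝ (Fin m) → Fin m → ℂ}
    (hw : ∀ j, Continuous fun z : EuclideanSpace ℝ (Fin m) × EuclideanSpace ℝ (Fin m) =>
      w z.1 z.2 j) : (fun t s => scalarPoly (pairing (w t s))) ∈ contFun m (ClPoly m) := by
  have : (fun t s => scalarPoly (pairing (w t s))) =
      ∑ j, fun t s => w t s j • (scalarPoly (MvPolynomial.X j) : ClPoly m) := by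
    ext1 t; ext1 s
    simp [pairing, scalarPoly, TensorProduct.smul_tmul', TensorProduct.sum_tmul,
      MvPolynomial.smul_eq_C_mul]
  rw [this]
  exact Submodule.sum_mem _ fun j _ => smul_mem_contFun (hw j) _

lemma continuous_tau (j : Fin m) :
    Continuous fun z : EuclideanSpace ℝ (Fin m) × EuclideanSpace ℝ (Fin m) => tau z.1 z.2 j := by
  unfold tau; fun_prop

lemma continuous_tauDag (j : Fin m) :
    Continuous fun z : EuclideanSpace ℝ (Fin m) × EuclideanSpace ℝ (Fin m) =>
      tauDag z.1 z.2 j := by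
  unfold tauDag; fun_prop

/-- The constant polynomials, as a complex linear map. -/
def constLin (m : ℕ) : ComplexCl m →ₗ[ℂ] ClPoly m where
  toFun := constPoly m
  map_add' := map_add _
  map_smul' := constPoly_smul

lemma formProd_mem_contFun {c : EuclideanSpace ℝ (Fin m) → EuclideanSpace ℝ (Fin m) → ComplexCl m}
    (hc : c ∈ contFun m (ComplexCl m)) (p r : ℕ) :
    (fun t s => formProd (tau t s) (tauDag t s) p r (c t s)) ∈ contFun m (ClPoly m) :=
  mul_mem_contFun (pow_mem_contFun (pairing_mem_contFun continuous_tau) p)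
    (mul_mem_contFun (pow_mem_contFun (pairing_mem_contFun continuous_tauDag) r)
      (map_mem_contFun hc (constLin m)))

lemma evalAt_formProd_tau (x t s : EuclideanSpace ℝ (Fin m)) (p r : ℕ) (c : ComplexCl m) :
    evalAt (toC x) (formProd (tau t s) (tauDag t s) p r c) =
      (tauForm x t s ^ p * tauDagForm x t s ^ r) • c := by
  rw [evalAt_formProd, sum_tau_mul, sum_tauDag_mul]

/-- The mean of `⟨z,τ⟩^p ⟨z,τ†⟩^r τ τ†` against a zonal function has a monogenic projection that is
a multiple of `M[⟨z,u⟩^{p+r}]`. Indeed it is a combination of terms `⟨z,u⟩^a (|z|² - ⟨z,u⟩²)^b` and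
`⟨z,u⟩^a (|z|² - ⟨z,u⟩²)^b u (z - ⟨z,u⟩u)`. -/
lemma monoProj_mean_eq (hm : 2 ≤ m) (hu : ‖u‖ = 1) (hW : IsZonal u W) (p r : ℕ) {v : ClPoly m}
    (hv : HasMean (fun t s => formProd (tau t s) (tauDag t s) p r
      (W t s • (vec (tau t s) * vec (tauDag t s)))) v) :
    ∃ κ : ℂ, monoProj m (p + r) v =
      κ • monoProj m (p + r) (scalarPoly (pairing (toC u) ^ (p + r))) := by
  have hWil : ∀ i l, IsZonal u
      (fun t s => W t s * (tauForm u t s ^ (p - i) * tauDagForm u t s ^ (r - l))) := fun i l =>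
    hW.mul (((isZonal_tauForm u).pow _).mul ((isZonal_tauDagForm u).pow _))
  choose c hc0 hc using fun i l => exists_hasMean_frameTerm hm (hWil i l) i l
  choose d hd0 hd using fun i l => exists_hasMean_frameTerm_bivector hm hu (hWil i l) i l
  let q : ℕ → ℕ → MvPolynomial (Fin m) ℂ := fun i l =>
    pairing (toC u) ^ (p - i + (r - l)) * (normSqPoly m - pairing (toC u) ^ 2) ^ ((i + l) / 2)
  let T : ℕ → ℕ → ClPoly m := fun i l =>
    if Even (i + l) then (2 * c i l) • scalarPoly (q i l)
    else (2 * Complex.I * d i l) • (scalarPoly (q i l) * (constPoly m (vec (toC u)) *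
      (vecVar m - scalarPoly (pairing (toC u)) * constPoly m (vec (toC u)))))
  have huu : vec (toC u) * vec (toC u) = (-1 : ℝ) • (1 : ComplexCl m) := by
    rw [vec_toC, realVec_mul_self, hu]; norm_num
  have hV : v = ∑ i ∈ Finset.range (p + 1), ∑ l ∈ Finset.range (r + 1),
      ((p.choose i : ℂ) * (r.choose l : ℂ)) • T i l := by
    apply clPoly_ext
    intro x
    obtain ⟨e, x2, he, hue, hx⟩ := exists_plane_decomp hm hu x
    set x1 := inner ℝ u x with hx1
    have hxx : ‖x‖ ^ 2 = x1 ^ 2 + x2 ^ 2 := by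
      rw [hx, ← real_inner_self_eq_norm_sq, inner_add_left, inner_add_right, inner_add_right,
        real_inner_smul_left, real_inner_smul_left, real_inner_smul_left, real_inner_smul_left,
        real_inner_smul_right, real_inner_smul_right, real_inner_smul_right, real_inner_smul_right,
        real_inner_comm, hue, real_inner_self_eq_norm_sq, real_inner_self_eq_norm_sq, hu, he]
      rw [real_inner_comm] at hue
      rw [hue]
      ring
    have hq : ∀ i l, MvPolynomial.eval (toC x) (q i l) =
        (x1 : ℂ) ^ (p - i + (r - l)) * ((x2 : ℂ) ^ 2) ^ ((i + l) / 2) := by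
      intro i l
      simp only [q, map_mul, map_pow, map_sub, eval_pairing, sum_toC_mul, eval_normSqPoly, hxx,
        ← hx1]
      push_cast
      ring
    have hT : ∀ i l, evalAt (toC x) (T i l) =
        ((x1 : ℂ) ^ (p - i + (r - l)) * (x2 : ℂ) ^ (i + l)) •
          ((2 * c i l) • (1 : ComplexCl m) +
            (2 * Complex.I) • (d i l • (realVec m u * realVec m e))) := by
      intro i l
      by_cases h : Even (i + l)
      · simp only [T, if_pos h, hd0 i l h, evalAt_smul, evalAt_scalarPoly, hq, ← pow_mul,
          Nat.two_mul_div_two_of_even h]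
        module
      · have h2 : realVec m u * (realVec m x - (x1 : ℂ) • realVec m u) =
            (x2 : ℂ) • (realVec m u * realVec m e) := by
          conv_lhs => rw [hx]
          rw [map_add, map_smul, map_smul, ofReal_smul_eq, ofReal_smul_eq, add_sub_cancel_left,
            mul_smul_comm]
        simp only [T, if_neg h, hc0 i l h, evalAt_smul, map_mul, map_sub, evalAt_constPoly,
          evalAt_scalarPoly, evalAt_vecVar, hq, eval_pairing, sum_toC_mul, ← hx1, vec_toC,
          smul_mul_assoc, one_mul, h2, ← pow_mul]
        have h3 : (x2 : ℂ) ^ (i + l) = (x2 : ℂ) ^ (2 * ((i + l) / 2)) * x2 := by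
          rw [← pow_succ, Nat.two_mul_div_two_add_one_of_odd (Nat.not_even_iff_odd.1 h)]
        rw [h3]
        module
    have h1 := hv.map (evalLin (toC x))
    refine h1.unique ?_
    have h2 := HasMean.sum (Finset.range (p + 1)) fun i _ => HasMean.sum (Finset.range (r + 1))
      fun l _ => ((((hc i l e he hue).smul_const ((2 : ℂ) • (1 : ComplexCl m))).add
        ((hd i l e he hue).smul (2 * Complex.I))).smul
          ((p.choose i : ℂ) * (r.choose l : ℂ) *
            ((x1 : ℂ) ^ (p - i + (r - l)) * (x2 : ℂ) ^ (i + l))))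
    have h3 : evalAt (toC x) (∑ i ∈ Finset.range (p + 1), ∑ l ∈ Finset.range (r + 1),
        ((p.choose i : ℂ) * (r.choose l : ℂ)) • T i l) =
        ∑ i ∈ Finset.range (p + 1), ∑ l ∈ Finset.range (r + 1),
        ((p.choose i : ℂ) * (r.choose l : ℂ) *
            ((x1 : ℂ) ^ (p - i + (r - l)) * (x2 : ℂ) ^ (i + l))) •
          (c i l • ((2 : ℂ) • (1 : ComplexCl m)) +
            (2 * Complex.I) • (d i l • (realVec m u * realVec m e))) := by
      simp only [map_sum, evalAt_smul, hT]
      refine Finset.sum_congr rfl fun i _ => Finset.sum_congr rfl fun l _ => ?_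
      module
    rw [h3]
    refine h2.congr fun t s ht hs hts => ?_
    change _ = evalAt (toC x) _
    rw [evalAt_formProd_tau, vec_tau_mul_vec_tauDag ht hs hts, hx, tauForm_combo, tauDagForm_combo,
      add_comm ((x1 : ℂ) * tauForm u t s), add_comm ((x1 : ℂ) * tauDagForm u t s), add_pow,
      add_pow, Finset.sum_mul_sum, Finset.sum_smul]
    refine Finset.sum_congr rfl fun i _ => ?_
    rw [Finset.sum_smul]
    refine Finset.sum_congr rfl fun l _ => ?_
    simp only [frameTerm, mul_pow, pow_add]
    module
  have hTκ : ∀ i ≤ p, ∀ l ≤ r, ∃ κ : ℂ, monoProj m (p + r) (T i l) =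
      κ • monoProj m (p + r) (scalarPoly (pairing (toC u) ^ (p + r))) := by
    intro i hi l hl
    by_cases h : Even (i + l)
    · have hn : p + r = p - i + (r - l) + 2 * ((i + l) / 2) := by
        rw [Nat.two_mul_div_two_of_even h]; omega
      refine ⟨(2 * c i l) * ((-1) ^ ((i + l) / 2) : ℝ), ?_⟩
      simp only [T, if_pos h, q, monoProj_smul]
      rw [hn, monoProj_pairing_pow_mul (by omega), ← ofReal_smul_eq, smul_smul]
    · have hn : p + r = p - i + (r - l) + (2 * ((i + l) / 2) + 1) := by
        rw [Nat.two_mul_div_two_add_one_of_odd (Nat.not_even_iff_odd.1 h)]; omega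
      refine ⟨(2 * Complex.I * d i l) * (-(-1) ^ ((i + l) / 2) : ℝ), ?_⟩
      simp only [T, if_neg h, q, monoProj_smul]
      rw [hn, monoProj_pairing_pow_mul_vecVar (by omega) _ huu, ← ofReal_smul_eq, smul_smul]
  choose! κ hκ using hTκ
  refine ⟨∑ i ∈ Finset.range (p + 1), ∑ l ∈ Finset.range (r + 1),
    (p.choose i : ℂ) * (r.choose l : ℂ) * κ i l, ?_⟩
  simp only [hV, map_sum, monoProj_smul, Finset.sum_smul]
  refine Finset.sum_congr rfl fun i hi => Finset.sum_congr rfl fun l hl => ?_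
  rw [hκ i (Nat.lt_succ_iff.1 (Finset.mem_range.1 hi)) l (Nat.lt_succ_iff.1 (Finset.mem_range.1 hl)),
    smul_smul]

end Zonal

/-! ### Zonal spherical monogenics as monogenic projections -/

section ZonalMonogenic

/-- The rising factorial `(x)_k`. -/
abbrev rise (x : ℝ) (k : ℕ) : ℝ := (ascPochhammer ℝ k).eval x

lemma rise_zero (x : ℝ) : rise x 0 = 1 := by simp [rise]

lemma rise_succ (x : ℝ) (k : ℕ) : rise x (k + 1) = rise x k * (x + k) :=
  ascPochhammer_succ_eval k x

lemma rise_succ_left (x : ℝ) (k : ℕ) : rise x (k + 1) = x * rise (x + 1) k := by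
  induction k with
  | zero => rw [rise_succ, rise_zero, rise_zero]; simp
  | succ k ih => rw [rise_succ, ih, rise_succ]; push_cast; ring

lemma rise_pos {x : ℝ} (hx : 0 < x) (k : ℕ) : 0 < rise x k := ascPochhammer_pos k x hx

variable {m : ℕ}

lemma fischerCoeff_two_mul_add_one (n i : ℕ) :
    fischerCoeff m n (2 * i + 1) = fischerCoeff m n (2 * i) / (2 * ((m : ℝ) / 2 + n - 1 - i)) := by
  rw [fischerCoeff, if_pos (by simp)]
  congr 1
  push_cast
  ring

lemma fischerCoeff_two_mul (hm : 3 ≤ m) {n i : ℕ} (hi : i ≤ n) :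
    fischerCoeff m n (2 * i) = (-1) ^ i * rise ((m : ℝ) / 2) (n - i) /
      (4 ^ i * i.factorial * rise ((m : ℝ) / 2) n) := by
  have hm' : (3 : ℝ) ≤ m := by exact_mod_cast hm
  have h0 := rise_pos (x := (m : ℝ) / 2) (by positivity)
  induction i with
  | zero => simp [fischerCoeff, (h0 n).ne']
  | succ i ih =>
    have hin : ((n - (i + 1) : ℕ) : ℝ) = n - i - 1 := by
      rw [Nat.cast_sub hi]; push_cast; ring
    have h1 : rise ((m : ℝ) / 2) (n - i) =
        rise ((m : ℝ) / 2) (n - (i + 1)) * ((m : ℝ) / 2 + n - 1 - i) := by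
      rw [show n - i = n - (i + 1) + 1 by omega, rise_succ, hin]
      ring
    have h2 : (m : ℝ) / 2 + n - 1 - i ≠ 0 := by
      have : (i : ℝ) + 1 ≤ n := by exact_mod_cast hi
      nlinarith
    have h3 := (h0 n).ne'
    rw [show 2 * (i + 1) = 2 * i + 1 + 1 by ring, fischerCoeff, if_neg (by simp),
      fischerCoeff_two_mul_add_one, ih (by omega), h1, Nat.factorial_succ, pow_succ, pow_succ]
    generalize (m : ℝ) / 2 + n - 1 - i = D at *
    push_cast
    field_simp
    ring

lemma sum_range_two_mul {M : Type*} [AddCommMonoid M] (f : ℕ → M) (k : ℕ) :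
    ∑ j ∈ Finset.range (2 * k), f j = ∑ i ∈ Finset.range k, (f (2 * i) + f (2 * i + 1)) := by
  induction k with
  | zero => simp
  | succ k ih =>
    rw [show 2 * (k + 1) = 2 * k + 1 + 1 by ring, Finset.sum_range_succ, Finset.sum_range_succ, ih,
      Finset.sum_range_succ, add_assoc]

/-- The value at `x` of the monogenic projection of `⟨z, y⟩^n`. -/
def zonalKernel (n : ℕ) (x y : EuclideanSpace ℝ (Fin m)) : ComplexCl m :=
  evalAt (toC x) (monoProj m n (scalarPoly (pairing (toC y) ^ n)))

lemma dirac_pairing_pow_mul_const (w : Fin m → ℂ) (n : ℕ) (c : ComplexCl m) :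
    dirac m (scalarPoly (pairing w) ^ n * constPoly m c) =
      (n : ℝ) • (scalarPoly (pairing w) ^ (n - 1) * constPoly m (vec w * c)) := by
  rw [dirac_pairing_pow_mul, dirac_eq_zero_of_mem_homogPoly_zero (constPoly_mem_homogPoly c),
    mul_zero, add_zero, map_mul]

lemma dirac_pow_two_mul_pairing_pow (y : EuclideanSpace ℝ (Fin m)) (n i : ℕ) :
    (dirac m ^ (2 * i)) (scalarPoly (pairing (toC y)) ^ n) =
      ((-‖y‖ ^ 2) ^ i * n.descFactorial (2 * i) : ℝ) •
        (scalarPoly (pairing (toC y)) ^ (n - 2 * i)) := by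
  have key : ∀ k : ℕ, dirac m (dirac m (scalarPoly (pairing (toC y)) ^ k)) =
      ((k : ℝ) * (k - 1 : ℕ) * (-‖y‖ ^ 2)) • (scalarPoly (pairing (toC y)) ^ (k - 2)) := by
    intro k
    have h1 := dirac_pairing_pow_mul_const (toC y) k 1
    rw [map_one, mul_one] at h1
    rw [h1, map_smul, mul_one, dirac_pairing_pow_mul_const, vec_toC, realVec_mul_self, map_smul,
      map_one, mul_smul_comm, mul_one, smul_smul, smul_smul, Nat.sub_sub]
  induction i with
  | zero => simp
  | succ i ih =>
    rw [show 2 * (i + 1) = 2 * i + 1 + 1 by ring, dirac_pow_succ_apply, dirac_pow_succ_apply, ih,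
      map_smul, map_smul, key, smul_smul, Nat.descFactorial_succ, Nat.descFactorial_succ,
      Nat.sub_sub n (2 * i) 2, Nat.sub_sub]
    congr 1
    push_cast
    ring

lemma dirac_pow_two_mul_add_one_pairing_pow (y : EuclideanSpace ℝ (Fin m)) (n i : ℕ) :
    (dirac m ^ (2 * i + 1)) (scalarPoly (pairing (toC y)) ^ n) =
      ((-‖y‖ ^ 2) ^ i * n.descFactorial (2 * i + 1) : ℝ) •
        (scalarPoly (pairing (toC y)) ^ (n - (2 * i + 1)) * constPoly m (vec (toC y))) := by
  have h1 := dirac_pairing_pow_mul_const (toC y) (n - 2 * i) 1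
  rw [map_one, mul_one, mul_one] at h1
  rw [dirac_pow_succ_apply, dirac_pow_two_mul_pairing_pow, map_smul, h1, smul_smul, Nat.sub_sub,
    Nat.descFactorial_succ]
  congr 1
  push_cast
  ring

lemma evalAt_vecVar_pow_two_mul (x : EuclideanSpace ℝ (Fin m)) (i : ℕ) :
    evalAt (toC x) (vecVar m ^ (2 * i)) = ((-‖x‖ ^ 2) ^ i : ℝ) • (1 : ComplexCl m) := by
  rw [map_pow, evalAt_vecVar, pow_mul, pow_two, vec_toC, realVec_mul_self, smul_pow, one_pow]

lemma zonalKernel_eq (n : ℕ) (x y : EuclideanSpace ℝ (Fin m)) :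
    zonalKernel n x y = ∑ i ∈ Finset.range (n + 1),
      ((fischerCoeff m n (2 * i) * n.descFactorial (2 * i) * (‖x‖ * ‖y‖) ^ (2 * i) *
          inner ℝ x y ^ (n - 2 * i) : ℝ) • (1 : ComplexCl m) +
        (fischerCoeff m n (2 * i + 1) * n.descFactorial (2 * i + 1) * (‖x‖ * ‖y‖) ^ (2 * i) *
          inner ℝ x y ^ (n - (2 * i + 1)) : ℝ) • (realVec m x * realVec m y)) := by
  rw [zonalKernel, monoProj_apply, sum_range_two_mul, map_sum]
  refine Finset.sum_congr rfl fun i _ => ?_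
  have hs : evalAt (toC x) (scalarPoly (pairing (toC y))) =
      (inner ℝ x y : ℝ) • (1 : ComplexCl m) := by
    rw [evalAt_scalarPoly, eval_pairing, sum_toC_mul, ofReal_smul_eq, real_inner_comm]
  rw [scalarPoly_pow, dirac_pow_two_mul_pairing_pow, dirac_pow_two_mul_add_one_pairing_pow, map_add,
    map_smul, map_smul, map_mul, map_mul, map_smul, map_smul, map_pow _ (scalarPoly _), map_mul,
    map_pow _ (scalarPoly _), hs, evalAt_vecVar_pow_two_mul, pow_succ (vecVar m), map_mul,
    evalAt_vecVar_pow_two_mul, evalAt_vecVar, evalAt_constPoly, vec_toC, vec_toC, smul_pow,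
    smul_pow, one_pow, one_pow]
  simp only [mul_smul_comm, smul_mul_assoc, one_mul, mul_one, smul_smul]
  have hxy : (-‖x‖ ^ 2) ^ i * (-‖y‖ ^ 2) ^ i = (‖x‖ * ‖y‖) ^ (2 * i) := by
    rw [← mul_pow, pow_mul]; congr 1; ring
  rw [← hxy]
  congr 2 <;> ring

lemma dagger_realVec (x : EuclideanSpace ℝ (Fin m)) :
    dagger m (realVec m x) = (-1 : ℝ) • realVec m x := by
  rw [← map_smul, ← vec_toC, ← vec_toC, dagger_vec]
  congr 1
  ext j
  simp [toC]

lemma dagger_zonalKernel (n : ℕ) (x y : EuclideanSpace ℝ (Fin m)) :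
    dagger m (zonalKernel n x y) = zonalKernel n y x := by
  rw [zonalKernel_eq, zonalKernel_eq, map_sum]
  refine Finset.sum_congr rfl fun i _ => ?_
  rw [map_add, map_smul, map_smul, dagger_one, dagger_mul, dagger_realVec, dagger_realVec,
    smul_mul_assoc, mul_smul_comm, smul_smul, real_inner_comm x y, mul_comm ‖x‖ ‖y‖]
  norm_num

lemma realVec_eq_tmul (x : EuclideanSpace ℝ (Fin m)) :
    realVec m x = (1 : ℂ) ⊗ₜ[ℝ] ∑ j, x j • (e j : RealCl m) := by
  rw [← vec_toC, vec, TensorProduct.tmul_sum]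
  refine Finset.sum_congr rfl fun j _ => ?_
  rw [TensorProduct.tmul_smul, TensorProduct.smul_tmul', Complex.real_smul, mul_one]

lemma realVec_mul_eq_wedge (x y : EuclideanSpace ℝ (Fin m)) :
    realVec m x * realVec m y = (-inner ℝ x y : ℝ) • (1 : ComplexCl m) + 1 ⊗ₜ[ℝ] wedge x y := by
  have h : (∑ j, x j • (e j : RealCl m)) * ∑ j, y j • (e j : RealCl m) =
      (-inner ℝ x y : ℝ) • (1 : RealCl m) + wedge x y := by
    have h1 : (∑ j, x j • (e j : RealCl m)) * ∑ j, y j • (e j : RealCl m) =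
        ∑ i, ∑ j, (x i * y j) • (e i * e j : RealCl m) := by
      rw [Finset.sum_mul_sum]
      refine Finset.sum_congr rfl fun i _ => Finset.sum_congr rfl fun j _ => ?_
      rw [smul_mul_assoc, mul_smul_comm, smul_smul]
    have h2 : ∀ i j : Fin m, (x i * y j) • (e i * e j : RealCl m) =
        (if i = j then (-(x i * y j)) • (1 : RealCl m) else 0) +
        (if i < j then (x i * y j) • (e i * e j : RealCl m) else 0) +
        (if j < i then (-(x i * y j)) • (e j * e i : RealCl m) else 0) := by
      intro i j
      rcases lt_trichotomy i j with h | rfl | h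
      · simp [h, h.ne, h.not_gt]
      · simp [e_mul_self]
      · have hs := e_mul_e_add_swap i j
        rw [if_neg h.ne', map_zero] at hs
        rw [if_neg h.ne', if_neg h.not_gt, if_pos h, eq_neg_of_add_eq_zero_left hs]
        simp
    have h3 : ∑ i, ∑ j, (if j < i then (-(x i * y j)) • (e j * e i : RealCl m) else 0) =
        ∑ i, ∑ j, (if i < j then (-(x j * y i)) • (e i * e j : RealCl m) else 0) :=
      Finset.sum_comm
    have h4 : ∑ i, ∑ j, (if i = j then (-(x i * y j)) • (1 : RealCl m) else 0) =
        (-inner ℝ x y : ℝ) • (1 : RealCl m) := by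
      simp only [Finset.sum_ite_eq, Finset.mem_univ, if_true]
      rw [← Finset.sum_smul, Finset.sum_neg_distrib]
      simp only [PiLp.inner_apply, RCLike.inner_apply, conj_trivial, mul_comm]
    rw [h1, Finset.sum_congr rfl fun i _ => Finset.sum_congr rfl fun j _ => h2 i j]
    simp only [Finset.sum_add_distrib]
    rw [h3, h4, add_assoc, ← Finset.sum_add_distrib, wedge]
    congr 1
    refine Finset.sum_congr rfl fun i _ => ?_
    rw [← Finset.sum_add_distrib]
    refine Finset.sum_congr rfl fun j _ => ?_
    by_cases hij : i < j
    · simp only [if_pos hij]; module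
    · simp [if_neg hij]
  rw [realVec_eq_tmul, realVec_eq_tmul, Algebra.TensorProduct.tmul_mul_tmul, one_mul, h,
    TensorProduct.tmul_add, TensorProduct.tmul_smul, ← Algebra.TensorProduct.one_def]

lemma zonal_scalar_coeff (hm : 3 ≤ m) {n i : ℕ} (hi : 2 * i ≤ n) :
    2 ^ n * rise ((m : ℝ) / 2) n / n.factorial *
      (fischerCoeff m n (2 * i) * n.descFactorial (2 * i) -
        fischerCoeff m n (2 * i + 1) * n.descFactorial (2 * i + 1)) =
    ((n : ℝ) + m - 2) / (m - 2) * ((-1) ^ i * rise ((m : ℝ) / 2 - 1) (n - i) /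
      (i.factorial * (n - 2 * i).factorial) * 2 ^ (n - 2 * i)) := by
  have hm' : (3 : ℝ) ≤ m := by exact_mod_cast hm
  have hi' : 2 * (i : ℝ) ≤ n := by exact_mod_cast hi
  have hi0 : (0 : ℝ) ≤ i := i.cast_nonneg
  have h0 := (rise_pos (x := (m : ℝ) / 2) (by positivity) n).ne'
  have hfac : (n.factorial : ℝ) = (n - 2 * i).factorial * n.descFactorial (2 * i) := by
    exact_mod_cast (Nat.factorial_mul_descFactorial hi).symm
  have hf0 : ((n - 2 * i).factorial : ℝ) ≠ 0 := by positivity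
  have hd0 : (n.descFactorial (2 * i) : ℝ) ≠ 0 := by
    intro h; rw [h, mul_zero] at hfac; exact (by positivity : (n.factorial : ℝ) ≠ 0) hfac
  have hpow : (2 : ℝ) ^ n = 2 ^ (n - 2 * i) * 4 ^ i := by
    rw [show (4 : ℝ) = 2 ^ 2 by norm_num, ← pow_mul, ← pow_add, Nat.sub_add_cancel hi]
  have hrise : rise ((m : ℝ) / 2) (n - i) * ((m : ℝ) / 2 - 1) =
      rise ((m : ℝ) / 2 - 1) (n - i) * ((m : ℝ) / 2 + n - 1 - i) := by
    have h1 := rise_succ_left ((m : ℝ) / 2 - 1) (n - i)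
    rw [rise_succ, Nat.cast_sub (by omega)] at h1
    rw [sub_add_cancel] at h1
    linarith
  have h2 : (m : ℝ) / 2 + n - 1 - i ≠ 0 := by nlinarith
  have h3 : (m : ℝ) - 2 ≠ 0 := by linarith
  have hr : rise ((m : ℝ) / 2) (n - i) = 2 * (rise ((m : ℝ) / 2 - 1) (n - i) *
      ((m : ℝ) / 2 + n - 1 - i)) / (m - 2) := by
    rw [eq_div_iff h3, ← hrise]; ring
  rw [fischerCoeff_two_mul_add_one, fischerCoeff_two_mul hm (by omega), Nat.descFactorial_succ, hfac,
    hpow, hr, Nat.cast_mul, Nat.cast_sub hi]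
  push_cast
  generalize rise ((m : ℝ) / 2) n = R at *
  generalize rise ((m : ℝ) / 2 - 1) (n - i) = R' at *
  have h5 : 2 * ((m : ℝ) / 2 + n - 1 - i) ≠ 0 := mul_ne_zero two_ne_zero h2
  generalize hD : (m : ℝ) / 2 + n - 1 - i = D at *
  have hn : (n : ℝ) = D - m / 2 + 1 + i := by linarith
  rw [hn]
  field_simp
  ring

lemma zonal_bivector_coeff (hm : 3 ≤ m) {n i : ℕ} (hi : 2 * i + 1 ≤ n) :
    2 ^ n * rise ((m : ℝ) / 2) n / n.factorial *
      (fischerCoeff m n (2 * i + 1) * n.descFactorial (2 * i + 1)) =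
    (-1) ^ i * rise ((m : ℝ) / 2) (n - 1 - i) /
      (i.factorial * (n - 1 - 2 * i).factorial) * 2 ^ (n - 1 - 2 * i) := by
  have hm' : (3 : ℝ) ≤ m := by exact_mod_cast hm
  have hi' : 2 * (i : ℝ) + 1 ≤ n := by exact_mod_cast hi
  have hi0 : (0 : ℝ) ≤ i := i.cast_nonneg
  have h0 := (rise_pos (x := (m : ℝ) / 2) (by positivity) n).ne'
  have hsub : n - 1 - 2 * i = n - (2 * i + 1) := by omega
  have hfac : (n.factorial : ℝ) = (n - (2 * i + 1)).factorial * n.descFactorial (2 * i + 1) := by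
    exact_mod_cast (Nat.factorial_mul_descFactorial hi).symm
  have hd0 : (n.descFactorial (2 * i + 1) : ℝ) ≠ 0 := by
    intro h; rw [h, mul_zero] at hfac; exact (by positivity : (n.factorial : ℝ) ≠ 0) hfac
  have hpow : (2 : ℝ) ^ n = 2 ^ (n - (2 * i + 1)) * (4 ^ i * 2) := by
    rw [show (4 : ℝ) = 2 ^ 2 by norm_num, ← pow_mul, ← pow_succ, ← pow_add, Nat.sub_add_cancel hi]
  have h2 : (m : ℝ) / 2 + n - 1 - i ≠ 0 := by nlinarith
  have hr : rise ((m : ℝ) / 2) (n - i) =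
      rise ((m : ℝ) / 2) (n - 1 - i) * ((m : ℝ) / 2 + n - 1 - i) := by
    rw [show n - i = n - 1 - i + 1 by omega, rise_succ, Nat.sub_sub, Nat.cast_sub (by omega)]
    push_cast; ring
  rw [fischerCoeff_two_mul_add_one, fischerCoeff_two_mul hm (by omega), hsub, hfac, hpow, hr]
  generalize (m : ℝ) / 2 + n - 1 - i = D at *
  field_simp

/-- The zonal spherical monogenic is a multiple of the monogenic projection of `⟨z, y⟩^n`. -/
lemma one_tmul_zonal (hm : 3 ≤ m) (n : ℕ) (x y : EuclideanSpace ℝ (Fin m)) :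
    (1 : ℂ) ⊗ₜ[ℝ] zonal n x y =
      (2 ^ n * rise ((m : ℝ) / 2) n / n.factorial : ℝ) • zonalKernel n x y := by
  have hm' : (3 : ℝ) ≤ m := by exact_mod_cast hm
  have h3 : (m : ℝ) - 2 ≠ 0 := by linarith
  rcases Nat.eq_zero_or_pos n with rfl | hn
  · have h1 : zonal 0 x y = 1 := by
      have hg : ∀ l v, gegenbauer 0 l v = 1 := fun l v => by simp [gegenbauer]
      rw [zonal, hg, gegenbauerPred, if_pos rfl, mul_zero, zero_smul, add_zero,
        Algebra.algebraMap_eq_smul_one, smul_smul, pow_zero]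
      push_cast
      rw [zero_add, mul_one, one_div, inv_mul_cancel₀ h3, one_smul]
    rw [h1, zonalKernel_eq]
    simp [fischerCoeff, Algebra.TensorProduct.one_def, rise_zero]
  by_cases hP : ‖x‖ * ‖y‖ = 0
  · have hxy : inner ℝ x y = 0 := by
      rcases mul_eq_zero.1 hP with h | h
      · rw [norm_eq_zero.1 h, inner_zero_left]
      · rw [norm_eq_zero.1 h, inner_zero_right]
    have hxy' : realVec m x * realVec m y = 0 := by
      rcases mul_eq_zero.1 hP with h | h
      · rw [norm_eq_zero.1 h, map_zero, zero_mul]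
      · rw [norm_eq_zero.1 h, map_zero, mul_zero]
    rw [zonal, hP, zero_pow hn.ne', zero_div, zero_smul, TensorProduct.tmul_zero, zonalKernel_eq,
      Finset.sum_eq_zero, smul_zero]
    intro i _
    rw [hP, hxy, hxy', smul_zero, add_zero]
    rcases Nat.eq_zero_or_pos i with rfl | hi
    · simp [hn.ne']
    · rw [zero_pow (by omega : 2 * i ≠ 0)]; simp
  set P := ‖x‖ * ‖y‖ with hPdef
  set σ : ℝ := inner ℝ x y with hσ
  have hwedge : (1 : ℂ) ⊗ₜ[ℝ] wedge x y = realVec m x * realVec m y + σ • (1 : ComplexCl m) := by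
    rw [realVec_mul_eq_wedge, ← hσ]; module
  set ρ : ℝ := 2 ^ n * rise ((m : ℝ) / 2) n / n.factorial with hρ
  set c := fischerCoeff m n with hc
  -- the coefficients of the scalar part and of the bivector part
  have hS : P ^ n / ((m : ℝ) - 2) * (((n : ℝ) + m - 2) * gegenbauer n ((m : ℝ) / 2 - 1) (σ / P)) =
      ρ * ∑ i ∈ Finset.range (n + 1), (c (2 * i) * n.descFactorial (2 * i) -
        c (2 * i + 1) * n.descFactorial (2 * i + 1)) * P ^ (2 * i) * σ ^ (n - 2 * i) := by
    have hsub : Finset.range (n / 2 + 1) ⊆ Finset.range (n + 1) := by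
      apply Finset.range_mono; omega
    rw [← Finset.sum_subset hsub, gegenbauer, Finset.mul_sum, Finset.mul_sum, Finset.mul_sum]
    · refine Finset.sum_congr rfl fun i hi => ?_
      have hi' : 2 * i ≤ n := by have := Finset.mem_range.1 hi; omega
      have h := zonal_scalar_coeff hm hi'
      rw [← hρ, ← hc] at h
      have hpow : P ^ n * (2 * (σ / P)) ^ (n - 2 * i) =
          2 ^ (n - 2 * i) * P ^ (2 * i) * σ ^ (n - 2 * i) := by
        rw [mul_pow 2, div_pow]
        have : P ^ n = P ^ (n - 2 * i) * P ^ (2 * i) := by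
          rw [← pow_add, Nat.sub_add_cancel hi']
        rw [this]
        field_simp
      calc _ = ((n : ℝ) + m - 2) / (m - 2) * ((-1) ^ i * rise ((m : ℝ) / 2 - 1) (n - i) /
            (i.factorial * (n - 2 * i).factorial)) * (P ^ n * (2 * (σ / P)) ^ (n - 2 * i)) := by
            ring
        _ = _ := by
            rw [hpow, ← mul_assoc ρ, ← mul_assoc ρ, h]; ring
    · intro i _ hi
      have hi' : n < 2 * i := by simp at hi; omega
      rw [Nat.descFactorial_of_lt hi', Nat.descFactorial_of_lt (by omega)]
      simp
  have hB : P ^ n / ((m : ℝ) - 2) * (((m : ℝ) - 2) / P *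
      gegenbauerPred n ((m : ℝ) / 2) (σ / P)) =
      ρ * ∑ i ∈ Finset.range (n + 1),
        c (2 * i + 1) * n.descFactorial (2 * i + 1) * P ^ (2 * i) * σ ^ (n - (2 * i + 1)) := by
    have hsub : Finset.range ((n - 1) / 2 + 1) ⊆ Finset.range (n + 1) := by
      apply Finset.range_mono; omega
    rw [← Finset.sum_subset hsub, gegenbauerPred, if_neg hn.ne', gegenbauer, Finset.mul_sum,
      Finset.mul_sum, Finset.mul_sum]
    · refine Finset.sum_congr rfl fun i hi => ?_
      have hi' : 2 * i + 1 ≤ n := by have := Finset.mem_range.1 hi; omega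
      have h := zonal_bivector_coeff hm hi'
      rw [← hρ, ← hc] at h
      have hpow : P ^ n / P * (2 * (σ / P)) ^ (n - 1 - 2 * i) =
          2 ^ (n - 1 - 2 * i) * P ^ (2 * i) * σ ^ (n - (2 * i + 1)) := by
        rw [mul_pow 2, div_pow, show n - (2 * i + 1) = n - 1 - 2 * i by omega]
        have : P ^ n = P ^ (n - 1 - 2 * i) * P ^ (2 * i) * P := by
          rw [← pow_add, ← pow_succ]; congr 1; omega
        rw [this]
        field_simp
      calc _ = ((-1) ^ i * rise ((m : ℝ) / 2) (n - 1 - i) /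
            (i.factorial * (n - 1 - 2 * i).factorial)) *
              (P ^ n / P * (2 * (σ / P)) ^ (n - 1 - 2 * i)) := by
            rw [← mul_assoc, show P ^ n / ((m : ℝ) - 2) * (((m : ℝ) - 2) / P) = P ^ n / P by
              field_simp]
            ring
        _ = _ := by
            rw [hpow, ← mul_assoc ρ, ← mul_assoc ρ, h]; ring
    · intro i _ hi
      have hi' : n < 2 * i + 1 := by simp at hi; omega
      rw [Nat.descFactorial_of_lt hi']
      simp
  have hz : (1 : ℂ) ⊗ₜ[ℝ] zonal n x y =
      (P ^ n / ((m : ℝ) - 2) * (((n : ℝ) + m - 2) *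
        gegenbauer n ((m : ℝ) / 2 - 1) (σ / P))) • (1 : ComplexCl m) +
      (P ^ n / ((m : ℝ) - 2) * (((m : ℝ) - 2) / P *
        gegenbauerPred n ((m : ℝ) / 2) (σ / P))) • ((1 : ℂ) ⊗ₜ[ℝ] wedge x y) := by
    rw [zonal, TensorProduct.tmul_smul, TensorProduct.tmul_add, TensorProduct.tmul_smul, smul_add,
      smul_smul, Algebra.algebraMap_eq_smul_one, TensorProduct.tmul_smul, smul_smul,
      Algebra.TensorProduct.one_def]
  rw [hz, hS, hB, hwedge, zonalKernel_eq, smul_add, smul_smul, add_comm (_ • (_ * _)), ← add_assoc,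
    ← add_smul, Finset.sum_add_distrib, ← Finset.sum_smul, ← Finset.sum_smul, smul_add, smul_smul,
    smul_smul, mul_assoc, ← mul_add, Finset.sum_mul, ← Finset.sum_add_distrib]
  congr 3
  refine Finset.sum_congr rfl fun i _ => ?_
  rcases lt_or_ge n (2 * i + 1) with h | h
  · rw [Nat.descFactorial_of_lt h]; ring
  · rw [show n - 2 * i = n - (2 * i + 1) + 1 by omega, pow_succ]; ring

end ZonalMonogenic

/-! ### Hypergeometric sums -/

section Sums

lemma alternating_choose_succ_sum (r : ℕ) (f : ℕ → ℝ) :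
    ∑ i ∈ Finset.range (r + 2), (-1) ^ i * ((r + 1).choose i : ℝ) * f i =
      ∑ i ∈ Finset.range (r + 1), (-1) ^ i * (r.choose i : ℝ) * (f i - f (i + 1)) := by
  have h1 : ∑ i ∈ Finset.range (r + 1), (-1) ^ i * (r.choose i : ℝ) * f i =
      ∑ i ∈ Finset.range (r + 1), (-1) ^ (i + 1) * (r.choose (i + 1) : ℝ) * f (i + 1) + f 0 := by
    have : ∑ i ∈ Finset.range (r + 2), (-1) ^ i * (r.choose i : ℝ) * f i =
        ∑ i ∈ Finset.range (r + 1), (-1) ^ i * (r.choose i : ℝ) * f i := by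
      rw [Finset.sum_range_succ, Nat.choose_succ_self]; simp
    rw [← this, Finset.sum_range_succ']
    simp
  simp only [mul_sub, Finset.sum_sub_distrib]
  rw [h1, Finset.sum_range_succ', ← sub_eq_zero]
  simp only [pow_zero, Nat.choose_zero_right, Nat.cast_one, mul_one, one_mul]
  have h2 : ∑ i ∈ Finset.range (r + 1), (-1) ^ (i + 1) * ((r + 1).choose (i + 1) : ℝ) * f (i + 1) =
      ∑ i ∈ Finset.range (r + 1), (-1) ^ (i + 1) * (r.choose (i + 1) : ℝ) * f (i + 1) -
      ∑ i ∈ Finset.range (r + 1), (-1) ^ i * (r.choose i : ℝ) * f (i + 1) := by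
    rw [← Finset.sum_sub_distrib]
    refine Finset.sum_congr rfl fun i _ => ?_
    rw [Nat.choose_succ_succ, pow_succ]
    push_cast; ring
  rw [h2]; ring

/-- A terminating hypergeometric sum, i.e. the partial fraction expansion of its right-hand side.
It follows by induction on `r` from the recursion `S_{r+1}(x) = (x + r) S_r(x) - x S_r(x + 1)`. -/
lemma sum_partial_fractions (r p : ℕ) {x : ℝ} (hx : 0 < x) :
    ∑ i ∈ Finset.range (r + 1), (-1) ^ i * (r.choose i : ℝ) *
      ((p.descFactorial i * (p + r - i).factorial : ℝ) / (x + p + r - i)) =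
    p.factorial * r.factorial * rise x r * rise x p / rise x (p + r + 1) := by
  induction r generalizing x with
  | zero =>
    have := (rise_pos hx p).ne'
    have h2 : x + p ≠ 0 := by positivity
    simp [rise_zero, rise_succ]
    field_simp
  | succ r ih =>
    rw [alternating_choose_succ_sum]
    have hterm : ∀ i ∈ Finset.range (r + 1), (-1) ^ i * (r.choose i : ℝ) *
        ((p.descFactorial i * (p + (r + 1) - i).factorial : ℝ) / (x + p + (r + 1 : ℕ) - i) -
        (p.descFactorial (i + 1) * (p + (r + 1) - (i + 1)).factorial : ℝ) /
          (x + p + (r + 1 : ℕ) - (i + 1 : ℕ))) =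
        (x + r) * ((-1) ^ i * (r.choose i : ℝ) *
          ((p.descFactorial i * (p + r - i).factorial : ℝ) / (x + p + r - i))) -
        x * ((-1) ^ i * (r.choose i : ℝ) *
          ((p.descFactorial i * (p + r - i).factorial : ℝ) / (x + 1 + p + r - i))) := by
      intro i hi
      have hir : i ≤ r := Nat.lt_succ_iff.1 (Finset.mem_range.1 hi)
      have hir' : (i : ℝ) ≤ r := by exact_mod_cast hir
      have h1 : (p + (r + 1) - i).factorial = (p + r + 1 - i) * (p + r - i).factorial := by
        rw [show p + (r + 1) - i = p + r - i + 1 by omega, Nat.factorial_succ]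
        congr 1; omega
      have h2 : (p.descFactorial (i + 1) : ℝ) = (p - i) * p.descFactorial i := by
        rw [Nat.descFactorial_succ]
        rcases le_or_gt i p with h | h
        · push_cast [Nat.cast_sub h]; ring
        · rw [Nat.descFactorial_of_lt h]; simp
      have hp : (0 : ℝ) ≤ p := p.cast_nonneg
      have h3 : x + p + r - i ≠ 0 := by nlinarith
      have h4 : x + 1 + p + r - i ≠ 0 := by nlinarith
      rw [h1, h2, show p + (r + 1) - (i + 1) = p + r - i by omega, Nat.cast_mul,
        Nat.cast_sub (by omega)]
      push_cast
      rw [show x + p + (r + 1) - (i + 1) = x + p + r - i by ring,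
        show x + p + (r + 1) - i = x + 1 + p + r - i by ring]
      field_simp
      ring
    rw [Finset.sum_congr rfl hterm, Finset.sum_sub_distrib, ← Finset.mul_sum, ← Finset.mul_sum,
      ih hx, ih (x := x + 1) (by positivity)]
    have e1 : rise (x + 1) r = rise x r * (x + r) / x := by
      rw [eq_div_iff hx.ne', ← rise_succ, rise_succ_left x r, mul_comm]
    have e2 : rise (x + 1) p = rise x p * (x + p) / x := by
      rw [eq_div_iff hx.ne', ← rise_succ, rise_succ_left x p, mul_comm]
    have e3 : rise (x + 1) (p + r + 1) = rise x (p + r + 1) * (x + (p + r + 1 : ℕ)) / x := by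
      rw [eq_div_iff hx.ne', ← rise_succ, rise_succ_left x (p + r + 1), mul_comm]
    have e4 := (rise_pos hx (p + r + 1)).ne'
    have e5 : x + p + r + 1 ≠ 0 := by positivity
    rw [e1, e2, e3, show p + (r + 1) + 1 = p + r + 1 + 1 by ring, rise_succ x (p + r + 1),
      rise_succ x r, Nat.factorial_succ]
    push_cast
    rw [show x + ((p : ℝ) + r + 1) = x + p + r + 1 by ring]
    field_simp
    ring

/-- The value of a Gegenbauer polynomial at `1`. -/
lemma gegenbauer_one (n : ℕ) (l : ℝ) : gegenbauer n l 1 = rise (2 * l) n / n.factorial := by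
  let a : ℕ → ℝ → ℕ → ℝ := fun n l j =>
    (-1) ^ j * rise l (n - j) / (j.factorial * (n - 2 * j).factorial) * (2 * 1) ^ (n - 2 * j)
  have ha : ∀ n l, gegenbauer n l 1 = ∑ j ∈ Finset.range (n / 2 + 1), a n l j := fun _ _ => rfl
  induction n using Nat.strong_induction_on generalizing l with
  | _ n ih =>
    match n, ih with
    | 0, _ => simp [gegenbauer, rise_zero]
    | 1, _ => simp [gegenbauer, rise]; ring
    | n + 2, ih =>
      have h1 : ∑ j ∈ Finset.range ((n + 2) / 2 + 1), ((n + 2 - 2 * j : ℕ) : ℝ) * a (n + 2) l j =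
          2 * l * gegenbauer (n + 1) (l + 1) 1 := by
        have hsub : Finset.range ((n + 1) / 2 + 1) ⊆ Finset.range ((n + 2) / 2 + 1) := by
          apply Finset.range_mono; omega
        rw [ha, Finset.mul_sum, ← Finset.sum_subset hsub]
        · refine Finset.sum_congr rfl fun j hj => ?_
          have hj' : 2 * j ≤ n + 1 := by have := Finset.mem_range.1 hj; omega
          have e1 : n + 2 - 2 * j = n + 1 - 2 * j + 1 := by omega
          have e2 : n + 2 - j = n + 1 - j + 1 := by omega
          simp only [a]
          rw [e1, e2, rise_succ_left, Nat.factorial_succ, pow_succ (2 * (1 : ℝ))]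
          have e3 : ((n + 1 - 2 * j + 1 : ℕ) : ℝ) ≠ 0 := by positivity
          rw [Nat.cast_mul]
          field_simp
        · intro j hj hj'
          rw [Finset.mem_range] at hj hj'
          rw [show n + 2 - 2 * j = 0 by omega]; simp
      have h2 : ∑ j ∈ Finset.range ((n + 2) / 2 + 1), (2 * (j : ℝ)) * a (n + 2) l j =
          -(2 * l * gegenbauer n (l + 1) 1) := by
        rw [ha, show (n + 2) / 2 + 1 = (n / 2 + 1) + 1 by omega, Finset.sum_range_succ',
          Finset.mul_sum, ← Finset.sum_neg_distrib, Nat.cast_zero, mul_zero, zero_mul, add_zero]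
        refine Finset.sum_congr rfl fun j hj => ?_
        have hj' : 2 * j ≤ n := by have := Finset.mem_range.1 hj; omega
        simp only [a]
        rw [show n + 2 - 2 * (j + 1) = n - 2 * j by omega,
          show n + 2 - (j + 1) = n - j + 1 by omega, rise_succ_left, Nat.factorial_succ, pow_succ]
        push_cast
        field_simp
      have h3 : ((n : ℝ) + 2) * gegenbauer (n + 2) l 1 =
          2 * l * gegenbauer (n + 1) (l + 1) 1 - 2 * l * gegenbauer n (l + 1) 1 := by
        rw [sub_eq_add_neg, ← h1, ← h2, ← Finset.sum_add_distrib, ha, Finset.mul_sum]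
        refine Finset.sum_congr rfl fun j hj => ?_
        have hj' : 2 * j ≤ n + 2 := by have := Finset.mem_range.1 hj; omega
        rw [Nat.cast_sub hj']
        push_cast; ring
      have h4 : (n : ℝ) + 2 ≠ 0 := by positivity
      have e1 := rise_succ_left (2 * l) (n + 1)
      have e2 := rise_succ_left (2 * l + 1) n
      rw [ih (n + 1) (by omega), ih n (by omega), show 2 * (l + 1) = 2 * l + 1 + 1 by ring,
        rise_succ (2 * l + 1 + 1) n, Nat.factorial_succ] at h3
      rw [← mul_right_inj' h4, h3, e1, e2, Nat.factorial_succ, Nat.factorial_succ]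
      push_cast
      field_simp
      ring

variable {m : ℕ}

lemma zonalKernel_self (hm : 3 ≤ m) (n : ℕ) {u : EuclideanSpace ℝ (Fin m)} (hu : ‖u‖ = 1) :
    zonalKernel n u u =
      (rise ((m : ℝ) - 1) n / (2 ^ n * rise ((m : ℝ) / 2) n)) • (1 : ComplexCl m) := by
  have hm' : (3 : ℝ) ≤ m := by exact_mod_cast hm
  have h3 : (m : ℝ) - 2 ≠ 0 := by linarith
  have h0 := (rise_pos (x := (m : ℝ) / 2) (by positivity) n).ne'
  have hw : wedge u u = 0 := by
    refine Finset.sum_eq_zero fun i _ => Finset.sum_eq_zero fun j _ => ?_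
    rw [mul_comm (u j), sub_self, zero_smul, ite_self]
  have hz : (1 : ℂ) ⊗ₜ[ℝ] zonal n u u =
      (rise ((m : ℝ) - 1) n / n.factorial) • (1 : ComplexCl m) := by
    rw [zonal, hw, smul_zero, add_zero, hu, real_inner_self_eq_norm_sq, hu,
      Algebra.algebraMap_eq_smul_one, smul_smul, TensorProduct.tmul_smul,
      ← Algebra.TensorProduct.one_def]
    congr 1
    have e1 := rise_succ_left ((m : ℝ) - 2) n
    rw [rise_succ, show (m : ℝ) - 2 + 1 = m - 1 by ring] at e1
    rw [show (1 : ℝ) ^ 2 / (1 * 1) = 1 by norm_num, gegenbauer_one,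
      show 2 * ((m : ℝ) / 2 - 1) = m - 2 by ring, mul_one, one_pow]
    field_simp
    linarith
  rw [one_tmul_zonal hm] at hz
  have h5 : (2 ^ n * rise ((m : ℝ) / 2) n / n.factorial : ℝ) ≠ 0 := by positivity
  refine smul_right_injective _ h5 ?_
  simp only [hz, smul_smul]
  congr 1
  field_simp

end Sums

/-! ### The constant -/

section Constant

variable {m : ℕ}

lemma smul_one_injective : Function.Injective fun c : ℂ => c • (1 : ComplexCl m) := by
  have : Nontrivial (ComplexCl m) := inferInstance
  exact smul_left_injective ℂ one_ne_zero

/-- The Dirac operator, as a complex linear map. -/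
def diracLin (m : ℕ) : ClPoly m →ₗ[ℂ] ClPoly m where
  toFun := dirac m
  map_add' := map_add _
  map_smul' := dirac_smul

lemma dirac_dirac_vecVar_pow (N : ℕ) :
    dirac m (dirac m (vecVar m ^ (2 * (N + 1)))) =
      (2 * (N + 1) * (m + 2 * N) : ℝ) • vecVar m ^ (2 * N) := by
  have h1 : (1 : ClPoly m) ∈ homogPoly m 0 := by
    simpa using constPoly_mem_homogPoly (1 : ComplexCl m)
  have h2 := dirac_vecVar_pow_mul h1 (2 * N + 1)
  have h3 := dirac_vecVar_pow_mul h1 (2 * N)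
  rw [dirac_eq_zero_of_mem_homogPoly_zero h1, mul_zero, smul_zero, add_zero, mul_one, mul_one,
    if_neg (by simp)] at h2
  rw [dirac_eq_zero_of_mem_homogPoly_zero h1, mul_zero, smul_zero, add_zero, mul_one, mul_one,
    if_pos (by simp)] at h3
  rw [show 2 * (N + 1) = 2 * N + 1 + 1 by ring, h2, map_smul, h3, smul_smul]
  congr 1
  push_cast
  ring

/-- The moments of `⟨u,τ⟩⟨u,τ†⟩ = -|⟨u,τ⟩|²` for a unit vector `u`. By invariance, the mean of
`⟨z,τ⟩^N ⟨z,τ†⟩^N` is a multiple of `z^{2N}`; a comparison of the images under `∂²` gives the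
recursion. -/
lemma hasMean_tauForm_pow (hm : 2 ≤ m) (N : ℕ) {u : EuclideanSpace ℝ (Fin m)} (hu : ‖u‖ = 1) :
    HasMean (fun t s => tauForm u t s ^ N * tauDagForm u t s ^ N)
      (((-1) ^ N * (sphereArea m * sphereArea (m - 1) * N.factorial / rise ((m : ℝ) / 2) N) : ℝ) :
        ℂ) := by
  induction N with
  | zero => simpa [rise_zero] using hasMean_one hm
  | succ N ih =>
    obtain ⟨c, hc⟩ := exists_hasMean_of_continuous (m := m) (by omega)
      (fun t s => tauForm u t s ^ (N + 1) * tauDagForm u t s ^ (N + 1))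
      (((continuous_tauForm u).pow _).mul ((continuous_tauDagForm u).pow _))
    obtain ⟨v, hv⟩ := exists_hasMean (m := m) (by omega)
      (formProd_mem_contFun (const_mem_contFun (1 : ComplexCl m)) (N + 1) (N + 1))
    have hV : v = ((-1) ^ (N + 1) * c) • vecVar m ^ (2 * (N + 1)) := by
      apply clPoly_ext
      intro x
      have h1 : ∀ t s, tauForm x t s = ‖x‖ * tauForm u (hypRefl (‖x‖ • u - x) t)
          (hypRefl (‖x‖ • u - x) s) ∧ tauDagForm x t s = ‖x‖ *
          tauDagForm u (hypRefl (‖x‖ • u - x) t) (hypRefl (‖x‖ • u - x) s) := by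
        intro t s
        have h2 : hypRefl (‖x‖ • u - x) (‖x‖ • u) = x :=
          Submodule.reflection_sub (by rw [norm_smul, hu]; simp)
        have h3 := tauForm_combo ‖x‖ 0 u 0 (hypRefl (‖x‖ • u - x) t) (hypRefl (‖x‖ • u - x) s)
        have h4 := tauDagForm_combo ‖x‖ 0 u 0 (hypRefl (‖x‖ • u - x) t) (hypRefl (‖x‖ • u - x) s)
        rw [smul_zero, add_zero, tauForm_hypRefl, h2, Complex.ofReal_zero, zero_mul, add_zero] at h3
        rw [smul_zero, add_zero, tauDagForm_hypRefl, h2, Complex.ofReal_zero, zero_mul,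
          add_zero] at h4
        exact ⟨h3, h4⟩
      refine (hv.map (evalLin (toC x))).unique ?_
      rw [evalAt_smul, evalAt_vecVar_pow_two_mul]
      have h5 := (((hc.comp_isometry (hypRefl (‖x‖ • u - x))).smul
        ((‖x‖ : ℂ) ^ (2 * (N + 1)))).smul_const (1 : ComplexCl m))
      have h6 : ((-1) ^ (N + 1) * c) • ((-‖x‖ ^ 2) ^ (N + 1) : ℝ) • (1 : ComplexCl m) =
          ((‖x‖ : ℂ) ^ (2 * (N + 1)) • c) • (1 : ComplexCl m) := by
        rw [← ofReal_smul_eq, smul_smul, smul_eq_mul]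
        congr 1
        push_cast
        rw [neg_pow ((‖x‖ : ℂ) ^ 2), pow_mul]
        have : ((-1 : ℂ) ^ (N + 1)) * (-1) ^ (N + 1) = 1 := by rw [← mul_pow]; simp
        linear_combination ((‖x‖ : ℂ) ^ 2) ^ (N + 1) * c * this
      rw [h6]
      refine h5.congr fun t s _ _ _ => ?_
      change _ = evalAt _ _
      rw [evalAt_formProd_tau, (h1 t s).1, (h1 t s).2, smul_eq_mul]
      congr 1
      ring
    have h1 := ((hv.map (diracLin m)).map (diracLin m)).map (evalLin (toC u))
    have h2 := (ih.smul (4 * (N + 1) * (N + 1))).smul_const (1 : ComplexCl m)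
    have h3 := h2.unique (h1.congr fun t s ht hs hts => by
      change evalAt _ (dirac m (dirac m _)) = _
      rw [dirac_dirac_formProd (vec_tau_mul_self ht hs hts) (vec_tauDag_mul_self ht hs hts)
        (vec_tau_mul_add_swap ht hs hts), ← ofReal_smul_eq, evalAt_smul, evalAt_formProd_tau,
        Nat.add_sub_cancel, smul_smul, smul_eq_mul]
      push_cast
      rfl)
    have h4 : evalAt (toC u) (dirac m (dirac m v)) =
        ((-1) ^ (N + 1) * c * (2 * (N + 1) * (m + 2 * N)) * (-1) ^ N) • (1 : ComplexCl m) := by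
      rw [hV, dirac_smul, dirac_smul, dirac_dirac_vecVar_pow, evalAt_smul, map_smul,
        evalAt_vecVar_pow_two_mul, hu, ← ofReal_smul_eq, ← ofReal_smul_eq, smul_smul, smul_smul]
      congr 1
      push_cast
      ring
    change _ = evalAt (toC u) (dirac m (dirac m v)) at h3
    rw [h4] at h3
    have h5 := smul_one_injective h3
    have h6 : ((-1 : ℂ) ^ N) * (-1) ^ N = 1 := by rw [← mul_pow]; simp
    have hm0 : (0 : ℝ) < m := by exact_mod_cast (by omega : 0 < m)
    have hN : (N : ℂ) + 1 ≠ 0 := by exact_mod_cast Nat.succ_ne_zero N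
    have hmN : (m : ℂ) + 2 * N ≠ 0 := by
      exact_mod_cast (by omega : m + 2 * N ≠ 0)
    have hR : ((rise ((m : ℝ) / 2) N : ℝ) : ℂ) ≠ 0 := by
      exact_mod_cast (rise_pos (by positivity) N).ne'
    have h7 : c = (((-1) ^ (N + 1) * (sphereArea m * sphereArea (m - 1) * (N + 1).factorial /
        rise ((m : ℝ) / 2) (N + 1)) : ℝ) : ℂ) := by
      rw [rise_succ, Nat.factorial_succ]
      rw [smul_eq_mul] at h5
      push_cast at h5 ⊢
      generalize ((rise ((m : ℝ) / 2) N : ℝ) : ℂ) = R at *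
      have h8 : (m : ℂ) / 2 + N = (m + 2 * N) / 2 := by ring
      have h9 : -(2 * (N + 1) * (m + 2 * N) * c) = 4 * ((N : ℂ) + 1) * (N + 1) *
          ((-1) ^ N * (sphereArea m * sphereArea (m - 1) * N.factorial / R)) := by
        rw [h5, pow_succ]
        linear_combination (2 * (N + 1) * (m + 2 * N) * c : ℂ) * h6
      have h10 : c = -(4 * ((N : ℂ) + 1) * (N + 1) *
          ((-1) ^ N * (sphereArea m * sphereArea (m - 1) * N.factorial / R))) /
          (2 * (N + 1) * (m + 2 * N)) := by
        rw [← h9]; field_simp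
      rw [h10, h8, pow_succ]
      field_simp
      ring
    rw [← h7]
    exact hc

end Constant

section Diagonal

variable {m : ℕ}

/-- The explicit value of `M[⟨z,τ⟩^p ⟨z,τ†⟩^r τ]` at a unit vector. -/
lemma evalAt_monoProj_formProd (n p r : ℕ) {u t s : EuclideanSpace ℝ (Fin m)} (hu : ‖u‖ = 1)
    (ht : ‖t‖ = 1) (hs : ‖s‖ = 1) (hts : inner ℝ t s = 0) :
    evalAt (toC u) (monoProj m n (formProd (tau t s) (tauDag t s) p r (vec (tau t s)))) *
        vec (tauDag t s) =
      ∑ i ∈ Finset.range (n + 1),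
        (((-4) ^ i * fischerCoeff m n (2 * i) * p.descFactorial i * r.descFactorial i : ℝ) •
          ((tauForm u t s ^ (p - i) * tauDagForm u t s ^ (r - i)) •
            (vec (tau t s) * vec (tauDag t s))) +
        (4 * (-4) ^ i * fischerCoeff m n (2 * i + 1) * p.descFactorial i *
            r.descFactorial (i + 1) : ℝ) •
          (realVec m u * ((tauForm u t s ^ (p - i) * tauDagForm u t s ^ (r - (i + 1))) •
            vec (tauDag t s)))) := by
  have hv := vec_tau_mul_self ht hs hts
  have hw := vec_tauDag_mul_self ht hs hts
  have hvw := vec_tau_mul_add_swap ht hs hts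
  have h3 : vec (tauDag t s) * vec (tau t s) * vec (tauDag t s) =
      (4 : ℝ) • vec (tauDag t s) := by
    have h := congrArg (fun a => vec (tauDag t s) * a) hvw
    simp only [mul_add] at h
    rwa [← mul_assoc, ← mul_assoc, hw, zero_mul, add_zero, mul_smul_comm, mul_one] at h
  rw [monoProj_apply, sum_range_two_mul, map_sum, Finset.sum_mul]
  refine Finset.sum_congr rfl fun i _ => ?_
  rw [dirac_pow_two_mul_formProd hv hw hvw, dirac_pow_two_mul_add_one_formProd hv hw hvw, map_add,
    map_smul, map_smul, map_mul, map_mul, map_smul, map_smul, evalAt_formProd_tau,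
    evalAt_formProd_tau, evalAt_vecVar_pow_two_mul, pow_succ (vecVar m), map_mul,
    evalAt_vecVar_pow_two_mul, evalAt_vecVar, vec_toC, hu]
  simp only [add_mul, mul_smul_comm, smul_mul_assoc, one_mul]
  rw [mul_assoc (realVec m u), h3]
  simp only [mul_smul_comm, smul_smul, ← ofReal_smul_eq]
  have h4 : (-4 : ℝ) ^ i = (-1 ^ 2) ^ i * 4 ^ i := by rw [← mul_pow]; norm_num
  rw [h4]
  push_cast
  congr 2 <;> ring

/-- The numerical evaluation behind the constants `γ_{α,k}`. -/
lemma sum_fischerCoeff_moments (hm : 3 ≤ m) (p r : ℕ) :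
    ∑ i ∈ Finset.range (p + r + 1), 4 ^ i * (p.descFactorial i : ℝ) *
      (2 * (fischerCoeff m (p + r) (2 * i) * r.descFactorial i) -
        4 * (fischerCoeff m (p + r) (2 * i + 1) * r.descFactorial (i + 1))) *
      ((p + r - i).factorial / rise ((m : ℝ) / 2) (p + r - i)) =
    2 * p.factorial * r.factorial * rise ((m : ℝ) / 2 - 1) r * rise ((m : ℝ) / 2) p /
      rise ((m : ℝ) / 2) (p + r) ^ 2 := by
  have hm' : (3 : ℝ) ≤ m := by exact_mod_cast hm
  have hh : (0 : ℝ) < (m : ℝ) / 2 - 1 := by linarith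
  have hp0 : (0 : ℝ) ≤ p := p.cast_nonneg
  have hr0 : (0 : ℝ) ≤ r := r.cast_nonneg
  have h0 := fun k => (rise_pos (x := (m : ℝ) / 2) (by linarith) k).ne'
  have hterm : ∀ i ∈ Finset.range (p + r + 1), 4 ^ i * (p.descFactorial i : ℝ) *
      (2 * (fischerCoeff m (p + r) (2 * i) * r.descFactorial i) -
        4 * (fischerCoeff m (p + r) (2 * i + 1) * r.descFactorial (i + 1))) *
      ((p + r - i).factorial / rise ((m : ℝ) / 2) (p + r - i)) =
      2 * ((m : ℝ) / 2 + p - 1) / rise ((m : ℝ) / 2) (p + r) * ((-1) ^ i * (r.choose i : ℝ) *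
        ((p.descFactorial i * (p + r - i).factorial : ℝ) / ((m : ℝ) / 2 - 1 + p + r - i))) := by
    intro i hi
    have hi' : i ≤ p + r := Nat.lt_succ_iff.1 (Finset.mem_range.1 hi)
    have hi'' : (i : ℝ) ≤ p + r := by exact_mod_cast hi'
    have h1 : (r.descFactorial (i + 1) : ℝ) = (r - i) * r.descFactorial i := by
      rw [Nat.descFactorial_succ]
      rcases le_or_gt i r with h | h
      · push_cast [Nat.cast_sub h]; ring
      · rw [Nat.descFactorial_of_lt h]; simp
    have h2 : (r.descFactorial i : ℝ) = i.factorial * r.choose i := by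
      exact_mod_cast Nat.descFactorial_eq_factorial_mul_choose r i
    have h3 : (m : ℝ) / 2 - 1 + p + r - i ≠ 0 := by linarith
    have h4 := h0 (p + r)
    have h5 := h0 (p + r - i)
    rw [fischerCoeff_two_mul_add_one, fischerCoeff_two_mul hm hi', h1, h2]
    push_cast
    rw [show (m : ℝ) / 2 + (p + r) - 1 - i = (m : ℝ) / 2 - 1 + p + r - i by ring]
    generalize rise ((m : ℝ) / 2) (p + r) = R at *
    generalize rise ((m : ℝ) / 2) (p + r - i) = R' at *
    generalize hD : (m : ℝ) / 2 - 1 + p + r - i = D at *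
    have hmD : (m : ℝ) / 2 + p - 1 = D - r + i := by linarith
    rw [hmD]
    field_simp
    ring
  rw [Finset.sum_congr rfl hterm, ← Finset.mul_sum]
  have hsub : Finset.range (r + 1) ⊆ Finset.range (p + r + 1) := by
    apply Finset.range_mono; omega
  rw [← Finset.sum_subset hsub, sum_partial_fractions r p hh]
  · have e1 := rise_succ_left ((m : ℝ) / 2 - 1) (p + r)
    have e2 := rise_succ_left ((m : ℝ) / 2 - 1) p
    rw [sub_add_cancel] at e1 e2
    rw [rise_succ] at e2
    have h4 := h0 (p + r)
    have e3 : rise ((m : ℝ) / 2 - 1) p * ((m : ℝ) / 2 + p - 1) =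
        ((m : ℝ) / 2 - 1) * rise ((m : ℝ) / 2) p := by rw [← e2]; ring
    have e4 : ((m : ℝ) / 2 - 1) ≠ 0 := hh.ne'
    rw [e1]
    generalize rise ((m : ℝ) / 2) (p + r) = R at *
    generalize hH : (m : ℝ) / 2 - 1 = H at *
    field_simp
    linear_combination rise H r * 2 * e3
  · intro i _ hi
    rw [Finset.mem_range, not_lt] at hi
    rw [Nat.choose_eq_zero_of_lt hi]
    simp

/-- The mean of `M[ψ](u) ψ(u)†` for `ψ(z) = ⟨z,τ⟩^p ⟨z,τ†⟩^r τ`. The scalar in front is the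
conjugate of `⟨u,τ⟩^p ⟨u,τ†⟩^r`. -/
lemma hasMean_evalAt_monoProj_self (hm : 3 ≤ m) (p r : ℕ) {u : EuclideanSpace ℝ (Fin m)}
    (hu : ‖u‖ = 1) :
    HasMean (fun t s => ((-1) ^ (p + r) * (tauForm u t s ^ r * tauDagForm u t s ^ p)) •
      (evalAt (toC u) (monoProj m (p + r)
        (formProd (tau t s) (tauDag t s) p r (vec (tau t s)))) * vec (tauDag t s)))
      (((sphereArea m * sphereArea (m - 1) * (2 * p.factorial * r.factorial *
        rise ((m : ℝ) / 2 - 1) r * rise ((m : ℝ) / 2) p / rise ((m : ℝ) / 2) (p + r) ^ 2) : ℝ) :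
          ℂ) • (1 : ComplexCl m)) := by
  have hm2 : 2 ≤ m := by omega
  let E : ℕ → ℝ := fun N =>
    (-1) ^ N * (sphereArea m * sphereArea (m - 1) * N.factorial / rise ((m : ℝ) / 2) N)
  have hz : ∀ N, IsZonal u (fun t s => tauForm u t s ^ N * tauDagForm u t s ^ N) := fun N =>
    ((isZonal_tauForm u).pow N).mul ((isZonal_tauDagForm u).pow N)
  have hbiv : ∀ N, HasMean (fun t s => (tauForm u t s ^ N * tauDagForm u t s ^ N) •
      (vec (tau t s) * vec (tauDag t s))) ((2 * (E N : ℂ)) • (1 : ComplexCl m)) := by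
    intro N
    obtain ⟨d, hd0, hd⟩ := exists_hasMean_frameTerm_bivector hm2 hu (hz N) 0 0
    obtain ⟨e, he, hue⟩ := exists_unit_perp hm2 u
    have h1 := (((hasMean_tauForm_pow hm2 N hu).smul 2).smul_const (1 : ComplexCl m)).add
      ((hd e he hue).smul (2 * Complex.I))
    rw [hd0 (by simp), zero_smul, smul_zero, add_zero] at h1
    refine h1.congr fun t s ht hs hts => ?_
    rw [vec_tau_mul_vec_tauDag ht hs hts]
    simp only [frameTerm, pow_zero, mul_one]
    module
  have hvec : ∀ N, HasMean (fun t s => (tauForm u t s ^ (N + 1) * tauDagForm u t s ^ N) •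
      vec (tauDag t s)) ((E (N + 1) : ℂ) • realVec m u) := by
    intro N
    have hzN : IsZonal u (fun t s => tauForm u t s ^ (N + 1) * tauDagForm u t s ^ N) :=
      ((isZonal_tauForm u).pow _).mul ((isZonal_tauDagForm u).pow _)
    refine (hasMean_smul_vector (by omega) hu hzN.continuous hzN.invariant (-1) Complex.I
      ((hasMean_tauForm_pow hm2 (N + 1) hu).congr fun t s _ _ _ => ?_)).congr fun t s _ _ _ => ?_
    · rw [pow_succ (tauDagForm u t s), ← mul_assoc]
      congr 1
      rw [tauDagForm]; ring
    · rw [vec_tauDag]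
  have huu : realVec m u * realVec m u = (-1 : ℝ) • (1 : ComplexCl m) := by
    rw [realVec_mul_self, hu]; norm_num
  -- the two summands belonging to `i`; the falling factorials vanish unless `i ≤ p, r`
  have h1 : ∀ i ∈ Finset.range (p + r + 1), HasMean (fun t s =>
      (p.descFactorial i * r.descFactorial i : ℝ) •
      ((-1 : ℂ) ^ (p + r) * (tauForm u t s ^ r * tauDagForm u t s ^ p)) •
        ((tauForm u t s ^ (p - i) * tauDagForm u t s ^ (r - i)) •
            (vec (tau t s) * vec (tauDag t s))))
      ((p.descFactorial i * r.descFactorial i : ℝ) •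
        ((-1) ^ (p + r) * (2 * (E (p + r - i) : ℂ))) • (1 : ComplexCl m)) := by
    intro i _
    by_cases h : i ≤ p ∧ i ≤ r
    · have h2 := ((hbiv (p + r - i)).smul ((-1) ^ (p + r))).smul
        ((p.descFactorial i * r.descFactorial i : ℝ) : ℂ)
      rw [smul_smul ((-1) ^ (p + r)), ofReal_smul_eq] at h2
      refine h2.congr fun t s _ _ _ => ?_
      rw [ofReal_smul_eq, smul_smul, smul_smul, mul_assoc, mul_mul_mul_comm (tauForm u t s ^ r), ← pow_add, ← pow_add,
        show r + (p - i) = p + r - i by omega, show p + (r - i) = p + r - i by omega]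
    · have h0 : (p.descFactorial i * r.descFactorial i : ℝ) = 0 := by
        rcases not_and_or.1 h with h | h
        · rw [Nat.descFactorial_of_lt (not_le.1 h)]; simp
        · rw [Nat.descFactorial_of_lt (not_le.1 h)]; simp
      simp only [h0, zero_smul]
      exact hasMean_zero
  have h2 : ∀ i ∈ Finset.range (p + r + 1), HasMean (fun t s =>
      (p.descFactorial i * r.descFactorial (i + 1) : ℝ) •
      ((-1 : ℂ) ^ (p + r) * (tauForm u t s ^ r * tauDagForm u t s ^ p)) •
        (realVec m u * ((tauForm u t s ^ (p - i) * tauDagForm u t s ^ (r - (i + 1))) •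
            vec (tauDag t s))))
      ((p.descFactorial i * r.descFactorial (i + 1) : ℝ) •
        ((-1) ^ (p + r) * (-(E (p + r - i) : ℂ))) • (1 : ComplexCl m)) := by
    intro i _
    by_cases h : i ≤ p ∧ i + 1 ≤ r
    · have h2 := (((hvec (p + r - (i + 1))).map (LinearMap.mulLeft ℂ (realVec m u))).smul
        ((-1) ^ (p + r))).smul ((p.descFactorial i * r.descFactorial (i + 1) : ℝ) : ℂ)
      simp only [LinearMap.mulLeft_apply, mul_smul_comm, huu] at h2 ⊢
      rw [show p + r - (i + 1) + 1 = p + r - i by omega] at h2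
      have h3 : (-1 : ℂ) ^ (p + r) • (E (p + r - i) : ℂ) • (-1 : ℝ) • (1 : ComplexCl m) =
          ((-1) ^ (p + r) * (-(E (p + r - i) : ℂ))) • (1 : ComplexCl m) := by
        rw [← ofReal_smul_eq, smul_smul, smul_smul]
        push_cast
        congr 1
        ring
      rw [h3, ofReal_smul_eq] at h2
      refine h2.congr fun t s _ _ _ => ?_
      rw [ofReal_smul_eq, smul_smul, smul_smul, mul_assoc, mul_mul_mul_comm (tauForm u t s ^ r), ← pow_add, ← pow_add,
        show r + (p - i) = p + r - i by omega,
        show p + (r - (i + 1)) = p + r - (i + 1) by omega]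
    · have h0 : (p.descFactorial i * r.descFactorial (i + 1) : ℝ) = 0 := by
        rcases not_and_or.1 h with h | h
        · rw [Nat.descFactorial_of_lt (not_le.1 h)]; simp
        · rw [Nat.descFactorial_of_lt (not_le.1 h)]; simp
      simp only [h0, zero_smul]
      exact hasMean_zero
  have h3 := HasMean.sum (Finset.range (p + r + 1)) fun i hi =>
    ((h1 i hi).smul (((-4) ^ i * fischerCoeff m (p + r) (2 * i) : ℝ) : ℂ)).add
      ((h2 i hi).smul ((4 * (-4) ^ i * fischerCoeff m (p + r) (2 * i + 1) : ℝ) : ℂ))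
  have h4 : ∑ i ∈ Finset.range (p + r + 1),
      ((((-4) ^ i * fischerCoeff m (p + r) (2 * i) : ℝ) : ℂ) •
        ((p.descFactorial i * r.descFactorial i : ℝ) •
        ((-1) ^ (p + r) * (2 * (E (p + r - i) : ℂ))) • (1 : ComplexCl m)) +
      ((4 * (-4) ^ i * fischerCoeff m (p + r) (2 * i + 1) : ℝ) : ℂ) •
        ((p.descFactorial i * r.descFactorial (i + 1) : ℝ) •
        ((-1) ^ (p + r) * (-(E (p + r - i) : ℂ))) • (1 : ComplexCl m))) =
      ((sphereArea m * sphereArea (m - 1) * (2 * p.factorial * r.factorial *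
        rise ((m : ℝ) / 2 - 1) r * rise ((m : ℝ) / 2) p / rise ((m : ℝ) / 2) (p + r) ^ 2) : ℝ) :
          ℂ) • (1 : ComplexCl m) := by
    rw [← sum_fischerCoeff_moments hm, Finset.mul_sum, Complex.ofReal_sum, Finset.sum_smul]
    refine Finset.sum_congr rfl fun i hi => ?_
    have hi' : i ≤ p + r := Nat.lt_succ_iff.1 (Finset.mem_range.1 hi)
    have h5 : (-1 : ℂ) ^ (p + r) * (-1) ^ (p + r - i) * (-4) ^ i = 4 ^ i := by
      obtain ⟨k, hk⟩ := Nat.exists_eq_add_of_le hi'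
      rw [hk, Nat.add_sub_cancel_left, pow_add, neg_pow (4 : ℂ)]
      have h6 : ((-1 : ℂ) ^ k) * (-1) ^ k = 1 := by rw [← mul_pow]; simp
      have h7 : ((-1 : ℂ) ^ i) * (-1) ^ i = 1 := by rw [← mul_pow]; simp
      linear_combination (4 : ℂ) ^ i * (-1) ^ i * (-1) ^ i * h6 + (4 : ℂ) ^ i * h7
    simp only [← ofReal_smul_eq, smul_smul, ← add_smul, E]
    congr 1
    push_cast
    rw [← h5]
    ring
  rw [h4] at h3
  refine h3.congr fun t s ht hs hts => ?_
  rw [evalAt_monoProj_formProd _ _ _ hu ht hs hts, Finset.smul_sum]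
  refine Finset.sum_congr rfl fun i _ => ?_
  simp only [mul_smul_comm, smul_add, smul_smul, ← ofReal_smul_eq]
  push_cast
  congr 2 <;> ring

end Diagonal

/-! ### The mean of the reproducing integrand -/

section Reproducing

variable {m : ℕ}

/-- The value at `x` of the monogenic projection of `⟨z,τ⟩^p ⟨z,τ†⟩^r τ`. -/
def monoTau (p r : ℕ) (t s x : EuclideanSpace ℝ (Fin m)) : ComplexCl m :=
  evalAt (toC x) (monoProj m (p + r) (formProd (tau t s) (tauDag t s) p r (vec (tau t s))))

/-- The factor between the mean of `M[ψ](x) M[ψ](y)†` and `zonalKernel`. -/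
def kernelConst (m p r : ℕ) : ℝ :=
  sphereArea m * sphereArea (m - 1) * (2 * p.factorial * r.factorial *
    rise ((m : ℝ) / 2 - 1) r * rise ((m : ℝ) / 2) p * 2 ^ (p + r) /
      (rise ((m : ℝ) / 2) (p + r) * rise ((m : ℝ) - 1) (p + r)))

/-- The mean of `M[ψ](x) ψ(u)†` for a unit vector `u`, with `ψ(z) = ⟨z,τ⟩^p ⟨z,τ†⟩^r τ`; the
constant is found at `x = u`. -/
lemma hasMean_monoTau_mul_of_norm_eq_one (hm : 3 ≤ m) (p r : ℕ) (x : EuclideanSpace ℝ (Fin m))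
    {u : EuclideanSpace ℝ (Fin m)} (hu : ‖u‖ = 1) :
    HasMean (fun t s => ((-1) ^ (p + r) * (tauForm u t s ^ r * tauDagForm u t s ^ p)) •
      (monoTau p r t s x * vec (tauDag t s)))
      ((kernelConst m p r : ℂ) • zonalKernel (p + r) x u) := by
  let W : EuclideanSpace ℝ (Fin m) → EuclideanSpace ℝ (Fin m) → ℂ := fun t s =>
    (-1) ^ (p + r) * (tauForm u t s ^ r * tauDagForm u t s ^ p)
  have hW : IsZonal u W := (isZonal_const u _).mul
    (((isZonal_tauForm u).pow r).mul ((isZonal_tauDagForm u).pow p))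
  have hc : (fun t s => W t s • (vec (tau t s) * vec (tauDag t s))) ∈
      contFun m (ComplexCl m) := by
    have h1 := mul_mem_contFun (smul_mem_contFun hW.continuous (1 : ComplexCl m))
      (mul_mem_contFun (vec_mem_contFun (m := m) continuous_tau)
        (vec_mem_contFun continuous_tauDag))
    simpa only [smul_mul_assoc, one_mul] using h1
  obtain ⟨v, hv⟩ := exists_hasMean (by omega) (formProd_mem_contFun hc p r)
  obtain ⟨κ, hκ⟩ := monoProj_mean_eq (by omega) hu hW p r hv
  have h : ∀ z, HasMean (fun t s => W t s • (monoTau p r t s z * vec (tauDag t s)))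
      (κ • zonalKernel (p + r) z u) := by
    intro z
    have h1 := (hv.map (monoProjLin m (p + r))).map (evalLin (toC z))
    have h2 : evalLin (toC z) (monoProjLin m (p + r) v) = κ • zonalKernel (p + r) z u := by
      change evalAt (toC z) (monoProj m (p + r) v) = _
      rw [hκ, evalAt_smul, zonalKernel]
    rw [h2] at h1
    refine h1.congr fun t s _ _ _ => ?_
    change evalAt (toC z) (monoProj m (p + r) _) = _
    rw [formProd_smul, ← formProd_mul_constPoly, monoProj_smul, monoProj_mul_constPoly,
      evalAt_smul, map_mul, evalAt_constPoly, monoTau]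
  have h1 := (h u).unique (hasMean_evalAt_monoProj_self hm p r hu)
  rw [zonalKernel_self hm _ hu, ← ofReal_smul_eq, smul_smul] at h1
  have h2 := smul_one_injective h1
  have hm' : (3 : ℝ) ≤ m := by exact_mod_cast hm
  have e1 := (rise_pos (x := (m : ℝ) - 1) (by linarith) (p + r)).ne'
  have e2 := (rise_pos (x := (m : ℝ) / 2) (by linarith) (p + r)).ne'
  have h3 : κ = (kernelConst m p r : ℂ) := by
    have e3 : (((rise ((m : ℝ) - 1) (p + r) / (2 ^ (p + r) * rise ((m : ℝ) / 2) (p + r)) : ℝ)) :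
        ℂ) ≠ 0 := by
      rw [Complex.ofReal_ne_zero]; positivity
    rw [← mul_left_inj' e3, h2, ← Complex.ofReal_mul, kernelConst]
    congr 1
    field_simp
  rw [← h3]
  exact h x

lemma zonalKernel_smul_right (n : ℕ) (c : ℝ) (x u : EuclideanSpace ℝ (Fin m)) :
    zonalKernel n x (c • u) = ((c : ℂ) ^ n) • zonalKernel n x u := by
  have h : scalarPoly (pairing (toC (c • u)) ^ n) =
      ((c : ℂ) ^ n) • scalarPoly (pairing (toC u) ^ n) := by
    apply clPoly_ext
    intro z
    rw [evalAt_smul, evalAt_scalarPoly, evalAt_scalarPoly, map_pow, map_pow, eval_pairing,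
      eval_pairing, sum_toC_mul, sum_toC_mul, real_inner_smul_left, smul_smul, ← mul_pow]
    push_cast
    rfl
  rw [zonalKernel, h, monoProj_smul, evalAt_smul, zonalKernel]

lemma hasMean_monoTau_mul (hm : 3 ≤ m) (p r : ℕ) (x y : EuclideanSpace ℝ (Fin m)) :
    HasMean (fun t s => ((-1) ^ (p + r) * (tauForm y t s ^ r * tauDagForm y t s ^ p)) •
      (monoTau p r t s x * vec (tauDag t s)))
      ((kernelConst m p r : ℂ) • zonalKernel (p + r) x y) := by
  obtain ⟨u, hu, hy⟩ : ∃ u : EuclideanSpace ℝ (Fin m), ‖u‖ = 1 ∧ y = ‖y‖ • u := by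
    by_cases h : y = 0
    · obtain ⟨u, hu, -⟩ := exists_unit_perp (by omega : 2 ≤ m) y
      exact ⟨u, hu, by rw [h, norm_zero, zero_smul]⟩
    · have h' := norm_ne_zero_iff.2 h
      refine ⟨‖y‖⁻¹ • y, ?_, by rw [smul_smul, mul_inv_cancel₀ h', one_smul]⟩
      rw [norm_smul, norm_inv, norm_norm, inv_mul_cancel₀ h']
  have h1 := (hasMean_monoTau_mul_of_norm_eq_one hm p r x hu).smul ((‖y‖ : ℂ) ^ (p + r))
  rw [smul_comm, ← zonalKernel_smul_right, ← hy] at h1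
  refine h1.congr fun t s _ _ _ => ?_
  have h2 := tauForm_combo ‖y‖ 0 u 0 t s
  have h3 := tauDagForm_combo ‖y‖ 0 u 0 t s
  rw [smul_zero, add_zero, ← hy, Complex.ofReal_zero, zero_mul, add_zero] at h2 h3
  rw [h2, h3, smul_smul, mul_pow, mul_pow, pow_add]
  congr 1
  ring

lemma dagger_mem_contFun
    {F : EuclideanSpace ℝ (Fin m) → EuclideanSpace ℝ (Fin m) → ComplexCl m}
    (hF : F ∈ contFun m (ComplexCl m)) :
    (fun t s => dagger m (F t s)) ∈ contFun m (ComplexCl m) := by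
  induction hF using Submodule.span_induction with
  | mem x hx =>
    obtain ⟨f, hf, v, rfl⟩ := hx
    simp only [dagger_smul]
    exact smul_mem_contFun (f := fun t s => starRingEnd ℂ (f t s))
      (Complex.continuous_conj.comp hf) _
  | zero => simpa using const_mem_contFun (0 : ComplexCl m)
  | add x y _ _ hx hy =>
    simp only [Pi.add_apply, map_add]
    exact add_mem hx hy
  | smul c x _ hx =>
    simp only [Pi.smul_apply, dagger_smul]
    exact Submodule.smul_mem _ (starRingEnd ℂ c) hx

/-- The conjugate of the preceding mean is a monogenic polynomial in the second variable, so it is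
unchanged when the integrand is replaced by its monogenic projection in that variable. -/
lemma hasMean_monoTau_mul_dagger (hm : 3 ≤ m) (p r : ℕ) (x y : EuclideanSpace ℝ (Fin m)) :
    HasMean (fun t s => monoTau p r t s x * dagger m (monoTau p r t s y))
      ((kernelConst m p r : ℂ) • zonalKernel (p + r) x y) := by
  have hc : (fun t s => vec (tau t s) * dagger m (monoTau p r t s y)) ∈
      contFun m (ComplexCl m) :=
    mul_mem_contFun (vec_mem_contFun continuous_tau) (dagger_mem_contFun (map_mem_contFun
      (map_mem_contFun (formProd_mem_contFun (vec_mem_contFun continuous_tau) p r)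
        (monoProjLin m (p + r))) (evalLin (toC y))))
  obtain ⟨v, hv⟩ := exists_hasMean (by omega) (formProd_mem_contFun hc p r)
  have hV : v = (kernelConst m p r : ℂ) •
      monoProj m (p + r) (scalarPoly (pairing (toC y) ^ (p + r))) := by
    apply clPoly_ext
    intro z
    refine (hv.map (evalLin (toC z))).unique ?_
    have h1 := (hasMean_monoTau_mul hm p r y z).dagger
    rw [dagger_smul, Complex.conj_ofReal, dagger_zonalKernel, zonalKernel, ← evalAt_smul] at h1
    refine h1.congr fun t s _ _ _ => ?_
    change _ = evalAt (toC z) _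
    rw [evalAt_formProd_tau, dagger_smul, dagger_mul, dagger_vec_tauDag, map_mul, map_mul, map_pow,
      map_pow, map_pow, conj_tauForm, conj_tauDagForm, neg_pow, neg_pow (tauForm z t s), map_neg,
      map_one, pow_add]
    congr 1
    have h6 : ((-1 : ℂ) ^ p) * (-1) ^ p = 1 := by rw [← mul_pow]; simp
    have h7 : ((-1 : ℂ) ^ r) * (-1) ^ r = 1 := by rw [← mul_pow]; simp
    linear_combination (tauForm z t s ^ p * tauDagForm z t s ^ r) * ((-1) ^ r * (-1) ^ r) * h6 +
      (tauForm z t s ^ p * tauDagForm z t s ^ r) * h7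
  have hq : scalarPoly (pairing (toC y) ^ (p + r)) ∈ homogPoly m (p + r) := by
    have := (pairing_isHomogeneous (toC y)).pow (p + r)
    rw [one_mul] at this
    exact scalarPoly_mem_homogPoly this
  have h1 := (hv.map (monoProjLin m (p + r))).map (evalLin (toC x))
  have h2 : evalLin (toC x) (monoProjLin m (p + r) v) =
      (kernelConst m p r : ℂ) • zonalKernel (p + r) x y := by
    change evalAt (toC x) (monoProj m (p + r) v) = _
    rw [hV, monoProj_smul, evalAt_smul,
      monoProj_eq_self _ (dirac_monoProj (by omega) hq), zonalKernel]
  rw [h2] at h1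
  refine h1.congr fun t s _ _ _ => ?_
  change evalAt (toC x) (monoProj m (p + r) _) = _
  rw [← formProd_mul_constPoly, monoProj_mul_constPoly, map_mul, evalAt_constPoly]
  rfl

end Reproducing

/-! ### The constants in terms of the Gamma function -/

section GammaConst

lemma gamma_add_nat {x : ℝ} (hx : 0 < x) (k : ℕ) :
    Real.Gamma (x + k) = rise x k * Real.Gamma x := by
  induction k with
  | zero => simp [rise_zero]
  | succ k ih =>
    rw [Nat.cast_succ, ← add_assoc, Real.Gamma_add_one (by positivity), ih, rise_succ]
    ring

variable {m : ℕ}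

lemma gammaConst_two_mul (hm : 3 ≤ m) (r k : ℕ) :
    sphereArea m * sphereArea (m - 1) * gammaConst m (2 * r) k *
      (2 ^ (2 * r + k) * rise ((m : ℝ) / 2) (2 * r + k) / (2 * r + k).factorial) =
    kernelConst m (r + k) r := by
  have hm' : (3 : ℝ) ≤ m := by exact_mod_cast hm
  have hh : (0 : ℝ) < (m : ℝ) / 2 - 1 := by linarith
  have hh' : (0 : ℝ) < (m : ℝ) / 2 := by linarith
  have hm1 : (0 : ℝ) < (m : ℝ) - 1 := by linarith
  have e1 := gamma_add_nat hh r
  have e2 := gamma_add_nat hh' (r + k)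
  have e3 := gamma_add_nat hh' (2 * r + k)
  have e4 := gamma_add_nat hm1 (2 * r + k)
  have e5 := Real.Gamma_nat_eq_factorial (2 * r + k)
  have e6 := Real.Gamma_add_one hh.ne'
  have p1 := (Real.Gamma_pos_of_pos hh).ne'
  have p2 := (Real.Gamma_pos_of_pos hm1).ne'
  have p3 := (rise_pos hh' (2 * r + k)).ne'
  have p4 := (rise_pos hm1 (2 * r + k)).ne'
  rw [sub_add_cancel] at e6
  push_cast at e1 e2 e3 e4 e5
  simp only [gammaConst, kernelConst]
  rw [if_pos (by simp), Nat.mul_div_cancel_left r (by norm_num : 0 < 2),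
    show (m : ℝ) / 2 + r - 1 = m / 2 - 1 + r by ring, e1, add_assoc ((m : ℝ) / 2) r, e2,
    add_assoc ((m : ℝ) / 2) (2 * r), e3, e5,
    show 2 * (r : ℝ) + k + m - 1 = m - 1 + (2 * r + k) by ring, e4, e6,
    show r + k + r = 2 * r + k by ring, show (m : ℝ) - 2 = 2 * (m / 2 - 1) by ring]
  have p5 : ((2 * r + k).factorial : ℝ) ≠ 0 := by positivity
  generalize (m : ℝ) / 2 - 1 = H at *
  field_simp

lemma gammaConst_two_mul_add_one (hm : 3 ≤ m) (r k : ℕ) :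
    sphereArea m * sphereArea (m - 1) * gammaConst m (2 * r + 1) k *
      (2 ^ (2 * r + 1 + k) * rise ((m : ℝ) / 2) (2 * r + 1 + k) / (2 * r + 1 + k).factorial) =
    4 * kernelConst m r (r + k + 1) := by
  have hm' : (3 : ℝ) ≤ m := by exact_mod_cast hm
  have hh : (0 : ℝ) < (m : ℝ) / 2 - 1 := by linarith
  have hh' : (0 : ℝ) < (m : ℝ) / 2 := by linarith
  have hm1 : (0 : ℝ) < (m : ℝ) - 1 := by linarith
  have e1 := gamma_add_nat hh (r + k + 1)
  have e2 := gamma_add_nat hh' r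
  have e3 := gamma_add_nat hh' (2 * r + 1 + k)
  have e4 := gamma_add_nat hm1 (2 * r + 1 + k)
  have e5 := Real.Gamma_nat_eq_factorial (2 * r + 1 + k)
  have e6 := Real.Gamma_add_one hh.ne'
  have p1 := (Real.Gamma_pos_of_pos hh).ne'
  have p2 := (Real.Gamma_pos_of_pos hm1).ne'
  have p3 := (rise_pos hh' (2 * r + 1 + k)).ne'
  have p4 := (rise_pos hm1 (2 * r + 1 + k)).ne'
  rw [sub_add_cancel] at e6
  push_cast at e1 e2 e3 e4 e5
  simp only [gammaConst, kernelConst]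
  rw [if_neg (by simp), show (2 * r + 1) / 2 = r by omega,
    show (m : ℝ) / 2 + r + k = m / 2 - 1 + (r + k + 1) by ring, e1, e2,
    show (m : ℝ) / 2 + 2 * r + k + 1 = m / 2 + (2 * r + 1 + k) by ring, e3,
    show 2 * (r : ℝ) + k + 2 = 2 * r + 1 + k + 1 by ring, e5,
    show 2 * (r : ℝ) + k + m = m - 1 + (2 * r + 1 + k) by ring, e4, e6,
    show r + (r + k + 1) = 2 * r + 1 + k by ring, show (m : ℝ) - 2 = 2 * (m / 2 - 1) by ring]
  have p5 : ((2 * r + 1 + k).factorial : ℝ) ≠ 0 := by positivity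
  generalize (m : ℝ) / 2 - 1 = H at *
  field_simp

end GammaConst

/-! ### The monogenic parts of `ψ_{τ,α,k}` -/

section Psi

variable {m : ℕ}

lemma constPoly_mul_scalarPoly (v w : Fin m → ℂ) (p r : ℕ) (c : ComplexCl m) :
    constPoly m c * scalarPoly (pairing v ^ p * pairing w ^ r) = formProd v w p r c := by
  rw [scalarPoly_comm, scalarPoly_mul, scalarPoly_pow, scalarPoly_pow, mul_assoc, formProd]

lemma MPsi_two_mul (hm : 1 ≤ m) (t s x : EuclideanSpace ℝ (Fin m)) (r k : ℕ) :
    MPsi t s (2 * r) k x = monoTau (r + k) r t s x := by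
  rw [MPsi, psi, if_pos (by simp), Nat.mul_div_cancel_left r (by norm_num : 0 < 2),
    constPoly_mul_scalarPoly, show 2 * r + k = r + k + r by ring,
    monogenicProj_eq hm (formProd_mem_homogPoly _ _ _ _ _), monoTau]

lemma formProd_swap (v w : Fin m → ℂ) (p r : ℕ) (c : ComplexCl m) :
    formProd w v r p c = formProd v w p r c := by
  rw [← constPoly_mul_scalarPoly, ← constPoly_mul_scalarPoly, mul_comm (pairing w ^ r)]

lemma formProd_neg (v w : Fin m → ℂ) (p r : ℕ) (c : ComplexCl m) :
    formProd (-v) (-w) p r c = ((-1) ^ (p + r) : ℂ) • formProd v w p r c := by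
  apply clPoly_ext
  intro x
  rw [evalAt_smul, evalAt_formProd, evalAt_formProd, smul_smul]
  simp only [Pi.neg_apply, neg_mul, Finset.sum_neg_distrib]
  rw [neg_pow, neg_pow (∑ j, w j * _), pow_add]
  congr 1
  ring

lemma tau_neg_right (t s : EuclideanSpace ℝ (Fin m)) : tau t (-s) = -tauDag t s := by
  ext j; simp [tau, tauDag, add_comm]

lemma tauDag_neg_right (t s : EuclideanSpace ℝ (Fin m)) : tauDag t (-s) = -tau t s := by
  ext j; simp [tau, tauDag, add_comm]

/-- The substitution `s ↦ -s` exchanges `τ` and `-τ†`. -/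
lemma monoTau_neg_right (t s x : EuclideanSpace ℝ (Fin m)) (p r : ℕ) :
    monoTau r p t (-s) x = ((-1) ^ (p + r + 1) : ℂ) •
      (evalAt (toC x) (monoProj m (p + r) (formProd (tau t s) (tauDag t s) p r 1)) *
        vec (tauDag t s)) := by
  rw [monoTau, tau_neg_right, tauDag_neg_right, formProd_neg, vec_neg,
    show -vec (tauDag t s) = (-1 : ℂ) • vec (tauDag t s) by module, formProd_smul, smul_smul,
    formProd_swap, ← one_mul (vec (tauDag t s)), ← formProd_mul_constPoly, monoProj_smul,
    monoProj_mul_constPoly, evalAt_smul, map_mul, evalAt_constPoly, add_comm r p, ← pow_succ]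
  simp

lemma MPsi_two_mul_add_one (hm : 1 ≤ m) (t s x : EuclideanSpace ℝ (Fin m)) (r k : ℕ) :
    MPsi t s (2 * r + 1) k x =
      evalAt (toC x) (monoProj m (r + k + 1 + r)
        (formProd (tau t s) (tauDag t s) (r + k + 1) r 1)) *
        (vec (tauDag t s) * vec (tau t s)) := by
  rw [MPsi, psi, if_neg (by simp), show (2 * r + 1) / 2 = r by omega, constPoly_mul_scalarPoly,
    show 2 * r + 1 + k = r + k + 1 + r by ring,
    monogenicProj_eq hm (formProd_mem_homogPoly _ _ _ _ _),
    ← one_mul (vec (tauDag t s) * vec (tau t s)), ← formProd_mul_constPoly, monoProj_mul_constPoly,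
    map_mul, evalAt_constPoly]
  simp

lemma MPsi_two_mul_add_one_mul_dagger (hm : 1 ≤ m) {t s : EuclideanSpace ℝ (Fin m)}
    (ht : ‖t‖ = 1) (hs : ‖s‖ = 1) (hts : inner ℝ t s = 0) (x y : EuclideanSpace ℝ (Fin m))
    (r k : ℕ) :
    MPsi t s (2 * r + 1) k x * dagger m (MPsi t s (2 * r + 1) k y) =
      (4 : ℂ) • (monoTau r (r + k + 1) t (-s) x *
        dagger m (monoTau r (r + k + 1) t (-s) y)) := by
  have h : vec (tauDag t s) * vec (tau t s) * (vec (tauDag t s) * vec (tau t s)) =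
      (4 : ℂ) • (vec (tauDag t s) * vec (tau t s)) := by
    have h1 := congrArg (fun a => vec (tauDag t s) * a * vec (tau t s))
      (vec_tau_mul_add_swap ht hs hts)
    simp only [mul_add, add_mul] at h1
    rw [← mul_assoc (vec (tauDag t s)) (vec (tauDag t s)), vec_tauDag_mul_self ht hs hts, zero_mul,
      zero_mul, add_zero, mul_smul_comm, mul_one, smul_mul_assoc, ← ofReal_smul_eq] at h1
    rw [← mul_assoc, mul_assoc (vec (tauDag t s))]
    rwa [Complex.ofReal_ofNat] at h1
  have hsign : ((-1 : ℂ) ^ (r + k + 1 + r + 1)) * (-1) ^ (r + k + 1 + r + 1) = 1 := by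
    rw [← mul_pow]; simp
  rw [MPsi_two_mul_add_one hm, MPsi_two_mul_add_one hm, monoTau_neg_right, monoTau_neg_right]
  simp only [dagger_mul, dagger_smul, dagger_vec_tau, dagger_vec_tauDag, map_pow, map_neg, map_one,
    smul_mul_assoc, mul_smul_comm, smul_smul]
  rw [hsign, mul_one, mul_assoc,
    ← mul_assoc (vec (tauDag t s) * vec (tau t s)) (vec (tauDag t s) * vec (tau t s)), h]
  simp only [smul_mul_assoc, mul_smul_comm, mul_assoc]

lemma HasMean.hasStiefelIntegral
    {F : EuclideanSpace ℝ (Fin m) → EuclideanSpace ℝ (Fin m) → ComplexCl m} {I : ComplexCl m}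
    (h : HasMean F I) : HasStiefelIntegral F I := h

end Psi

end HuaRadon

end

theorem proposition6p3 (m : ℕ) (hm : 3 ≤ m) (α k : ℕ) (x y : EuclideanSpace ℝ (Fin m)) :
    HuaRadon.HasStiefelIntegral
      (fun t s => HuaRadon.MPsi t s α k x * HuaRadon.dagger m (HuaRadon.MPsi t s α k y))
      (((HuaRadon.sphereArea m * HuaRadon.sphereArea (m - 1) * HuaRadon.gammaConst m α k : ℝ) : ℂ)
        ⊗ₜ[ℝ] HuaRadon.zonal (α + k) x y) := by
  open HuaRadon in
  have hval : ∀ c : ℝ, (c : ℂ) ⊗ₜ[ℝ] zonal (α + k) x y =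
      ((c * (2 ^ (α + k) * rise ((m : ℝ) / 2) (α + k) / (α + k).factorial) : ℝ) : ℂ) •
        zonalKernel (α + k) x y := by
    intro c
    rw [ofReal_smul_eq, mul_smul, ← one_tmul_zonal hm, TensorProduct.smul_tmul', Complex.real_smul,
      mul_one]
  rw [hval]
  refine HuaRadon.HasMean.hasStiefelIntegral ?_
  obtain ⟨r, rfl | rfl⟩ := α.even_or_odd'
  · rw [HuaRadon.gammaConst_two_mul hm]
    refine HuaRadon.HasMean.congr ?_ fun t s _ _ _ =>
      congrArg₂ (fun a b => a * HuaRadon.dagger m b)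
        (HuaRadon.MPsi_two_mul (by omega) t s x r k).symm
        (HuaRadon.MPsi_two_mul (by omega) t s y r k).symm
    rw [show 2 * r + k = r + k + r by ring]
    exact HuaRadon.hasMean_monoTau_mul_dagger hm (r + k) r x y
  · rw [HuaRadon.gammaConst_two_mul_add_one hm, Complex.ofReal_mul, mul_smul]
    refine HuaRadon.HasMean.congr ?_ fun t s ht hs hts =>
      (HuaRadon.MPsi_two_mul_add_one_mul_dagger (by omega) ht hs hts x y r k).symm
    rw [show 2 * r + 1 + k = r + (r + k + 1) by ring, Complex.ofReal_ofNat]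
    exact ((HuaRadon.hasMean_monoTau_mul_dagger hm r (r + k + 1) x y).comp_neg).smul 4
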